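/- **Conventions.** All ground sets are finite and $\mathbb K$ is a commutative ring with unit. A *delta-matroid* $D$ on $E$ is a non-empty family of subsets of $E$, the *feasible sets*, such that for all feasible $X,Y$ and $x\in X\triangle Y$ there is $y\in X\triangle Y$ (possibly $y=x$) with $X\triangle\{x,y\}$ feasible. The feasible sets of maximal (resp. minimal) cardinality are the bases of a matroid $D_{\max}$ (resp. $D_{\min}$). A *matroid perspective* $(M,M')$ is a pair of matroids on the same set $E$ with $\operatorname{rk}_M(B)-\operatorname{rk}_M(A)\ge \operatorname{rk}_{M'}(B)-\operatorname{rk}_{M'}(A)$ for all $A\subseteq B\subseteq E$. A *delta-matroid perspective* $(M,D,M')$ consists of matroids $M,M'$ and a delta-matroid $D$ on the same set such that $(M,D_{\max})$ and $(D_{\min},M')$ are matroid perspectives. An element of a delta-matroid is a *loop* if no feasible set contains it and a *coloop* if every feasible set does. If $a$ is not a coloop, the feasible sets of $D\setminus a$ are the feasible sets of $D$ that avoid $a$; if $a$ is not a loop, those of $D/a$ are the sets $F\setminus\{a\}$ with $a\in F$ feasible; if $a$ is a loop or a coloop, $D\setminus a=D/a$. Iterating gives the restriction $D|A$ (deletion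 of $E\setminus A$) and the contraction $D/A$ for $A\subseteq E$. Restriction and contraction of perspectives are componentwise, which makes matroid perspectives, delta-matroids, and delta-matroid perspectives into minors systems $\mathsf{MatPer}$, $\Delta\mathsf{Mat}$, $\Delta\mathsf{MatPer}$, each with exactly one structure on the empty set. For such a minors system $\mathsf S$, the *Grothendieck monoid* $U(\mathsf S)$ is the commutative monoid generated by the isomorphism classes $[X]$ of structures of $\mathsf S$, with relations $[X]=[X|A]\,[X/A]$ for every structure $X$ on $E$ and $A\subseteq E$, $[X\oplus Y]=[X]$ for $Y$ a structure on $\varnothing$, and $[1_{\mathsf S}]=1$, where $1_{\mathsf S}$ is the neutral structure on $\varnothing$. The *universal Tutte character* sends a structure $X$ on $E$ to $$T^{\mathsf S}(X)=\sum_{A\subseteq E}([X|A],\,(X|A)/A,\,[X/A])\in\mathbb K[U(\mathsf S)\times \mathsf S[\varnothing]\times U(\mathsf S)].$$ Write $\operatorname{cork}(M)=|E|-\operatorname{rk}(M)$ and $\operatorname{cork}_M(A)=\operatorname{rk}(M)-\operatorname{rk}_M(A)$. On a one-element set, let $c$, $l$ be the coloop and the loop (as matroids and as delta-matroids), and $n$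 the delta-matroid with feasible sets $\varnothing$ and $\{e\}$. **Proposition.** (1) Let $s,t,u,v,w$ be the classes in $U(\Delta\mathsf{MatPer})$ of $(c,c,l)$, $(c,l,l)$, $(c,c,c)$, $(l,l,l)$, $(c,n,l)$. There is an isomorphism of monoids $$U(\Delta\mathsf{MatPer})\simeq (s^{\mathbb N}t^{\mathbb N}u^{\mathbb N}v^{\mathbb N}w^{\mathbb N})/\langle w^2=st\rangle ,$$ mapping these five classes to the generators of the same name. For every delta-matroid perspective, $\operatorname{rk}(M')\le\operatorname{rk}(D_{\min})\le\operatorname{rk}(D_{\max})\le\operatorname{rk}(M)$, and the isomorphism maps the class of $(M,D,M')$ to $$s^{\operatorname{rk}(D_{\min})-\operatorname{rk}(M')}\,t^{\operatorname{rk}(M)-\operatorname{rk}(D_{\max})}\,u^{\operatorname{rk}(M')}\,v^{\operatorname{cork}(M)}\,w^{\operatorname{rk}(D_{\max})-\operatorname{rk}(D_{\min})}.$$ (2) There is a $\mathbb K$-algebra isomorphism of $\mathbb K[U(\Delta\mathsf{MatPer})\times\Delta\mathsf{MatPer}[\varnothing]\times U(\Delta\mathsf{MatPer})]$ with $$\mathbb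 K[s_1,t_1,u_1,v_1,w_1,s_2,t_2,u_2,v_2,w_2]/\langle w_1^2-s_1t_1,\ w_2^2-s_2t_2\rangle$$ that sends the generators of the first (second) copy of $U(\Delta\mathsf{MatPer})$ to the variables with subscript $1$ (subscript $2$), and under which $$\begin{aligned}T^{\Delta\mathsf{MatPer}}(M,D,M')=\sum_{A\subseteq E}\ & s_1^{\operatorname{rk}((D|A)_{\min})-\operatorname{rk}_{M'}(A)}\,t_1^{\operatorname{rk}_M(A)-\operatorname{rk}((D|A)_{\max})}\,u_1^{\operatorname{rk}_{M'}(A)}\,v_1^{|A|-\operatorname{rk}_M(A)}\,w_1^{\operatorname{rk}((D|A)_{\max})-\operatorname{rk}((D|A)_{\min})}\\ \cdot\ & s_2^{\operatorname{rk}((D/A)_{\min})-\operatorname{cork}_{M'}(A)}\,t_2^{\operatorname{cork}_M(A)-\operatorname{rk}((D/A)_{\max})}\,u_2^{\operatorname{cork}_{M'}(A)}\,v_2^{|E\setminus A|-\operatorname{cork}_M(A)}\,w_2^{\operatorname{rk}((D/A)_{\max})-\operatorname{rk}((D/A)_{\min})}.\end{aligned}$$ The $\mathbb K$-algebra map to $\mathbb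 K[s_i^{1/2},t_i^{1/2},u_i,v_i : i=1,2]$ with $w_i\mapsto s_i^{1/2}t_i^{1/2}$ that maps the other variables to those of the same name is injective. With $\sigma(D)=\frac12(\operatorname{rk}(D_{\max})+\operatorname{rk}(D_{\min}))$, the image of $T^{\Delta\mathsf{MatPer}}(M,D,M')$ under it is $$\sum_{A\subseteq E}s_1^{\sigma(D|A)-\operatorname{rk}_{M'}(A)}\,t_1^{\operatorname{rk}_M(A)-\sigma(D|A)}\,u_1^{\operatorname{rk}_{M'}(A)}\,v_1^{|A|-\operatorname{rk}_M(A)}\cdot s_2^{\sigma(D/A)-\operatorname{cork}_{M'}(A)}\,t_2^{\operatorname{cork}_M(A)-\sigma(D/A)}\,u_2^{\operatorname{cork}_{M'}(A)}\,v_2^{|E\setminus A|-\operatorname{cork}_M(A)}.$$ The specialization $(s_1,t_1,u_1,v_1,s_2,t_2,u_2,v_2)=(a,b,1,y,1,1,x,1)$ (with $s_1^{1/2}=a^{1/2}$, $t_1^{1/2}=b^{1/2}$, $s_2^{1/2}=t_2^{1/2}=1$) gives the Krushkal polynomial $$K_{(M,D,M')}(x,y,a,b)=\sum_{A\subseteq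 E}x^{\operatorname{rk}(M')-\operatorname{rk}_{M'}(A)}\,y^{|A|-\operatorname{rk}_M(A)}\,a^{\sigma(D|A)-\operatorname{rk}_{M'}(A)}\,b^{\operatorname{rk}_M(A)-\sigma(D|A)},$$ and conversely, whenever $s_2^{1/2},t_2^{1/2},u_1,v_2$ are evaluated at units and the other variables arbitrarily in a commutative $\mathbb K$-algebra, $$T^{\Delta\mathsf{MatPer}}(M,D,M')=s_2^{\sigma(D)-\operatorname{rk}(M')}\,t_2^{\operatorname{rk}(M)-\sigma(D)}\,u_1^{\operatorname{rk}(M')}\,v_2^{\operatorname{cork}(M)}\,K_{(M,D,M')}\!\left(\tfrac{u_2}{u_1},\tfrac{v_1}{v_2},\tfrac{s_1}{s_2},\tfrac{t_1}{t_2}\right),$$ where the square roots of $\tfrac{s_1}{s_2}$ and $\tfrac{t_1}{t_2}$ are $s_1^{1/2}/s_2^{1/2}$ and $t_1^{1/2}/t_2^{1/2}$. (3) The morphism $\Delta\mathsf{MatPer}\to\mathsf{MatPer}$, $(M,D,M')\mapsto(M,M')$, induces an isomorphism $U(\Delta\mathsf{MatPer})/\langle s=t=w\rangle\simeq U(\mathsf{MatPer})$.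 Moreover $U(\mathsf{MatPer})\simeq u^{\mathbb N}v^{\mathbb N}w^{\mathbb N}$, where the classes of $(c,c)$, $(l,l)$, $(c,l)$ map to $u,v,w$ and the class of $(M,M')$ maps to $u^{\operatorname{rk}(M')}\,v^{\operatorname{cork}(M)}\,w^{\operatorname{rk}(M)-\operatorname{rk}(M')}$. (4) The morphism $\Delta\mathsf{MatPer}\to\Delta\mathsf{Mat}$, $(M,D,M')\mapsto D$, induces an isomorphism $U(\Delta\mathsf{MatPer})/\langle s=u,\ t=v\rangle\simeq U(\Delta\mathsf{Mat})$. Moreover $U(\Delta\mathsf{Mat})\simeq(u^{\mathbb N}v^{\mathbb N}w^{\mathbb N})/\langle w^2=uv\rangle$, where the classes of $c$, $l$, $n$ map to $u,v,w$ and the class of a delta-matroid $D$ on $E$ maps to $u^{\operatorname{rk}(D_{\min})}\,v^{|E|-\operatorname{rk}(D_{\max})}\,w^{\operatorname{rk}(D_{\max})-\operatorname{rk}(D_{\min})}$. -/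

import Mathlib

universe u v

namespace TutteMinors
open Set
open scoped symmDiff

/-- A delta-matroid on a ground set `E`, given by its feasible sets. -/
@[ext]
structure DeltaMatroid (E : Type u) where
  feasible : Set (Set E)
  nonempty : feasible.Nonempty
  exchange : ∀ X ∈ feasible, ∀ Y ∈ feasible, ∀ x ∈ X ∆ Y, ∃ y ∈ X ∆ Y, X ∆ {x, y} ∈ feasible

namespace DeltaMatroid
variable {E E' : Type u}

/-- `F` is a feasible set with as many elements as possible in `Y`. -/
def MaxOn (D : DeltaMatroid E) (Y F : Set E) : Prop :=
  F ∈ D.feasible ∧ ∀ G ∈ D.feasible, (G ∩ Y).ncard ≤ (F ∩ Y).ncard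

/-- `F` is a feasible set with as few elements as possible in `Y`. -/
def MinOn (D : DeltaMatroid E) (Y F : Set E) : Prop :=
  F ∈ D.feasible ∧ ∀ G ∈ D.feasible, (F ∩ Y).ncard ≤ (G ∩ Y).ncard

/-- The twist of a delta-matroid by a set. -/
def twist (D : DeltaMatroid E) (Z : Set E) : DeltaMatroid E where
  feasible := {X | X ∆ Z ∈ D.feasible}
  nonempty := by
    obtain ⟨F, hF⟩ := D.nonempty
    exact ⟨F ∆ Z, by simpa [symmDiff_assoc] using hF⟩
  exchange := by
    intro X hX Y hY x hx
    have e : (X ∆ Z) ∆ (Y ∆ Z) = X ∆ Y := by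
      rw [symmDiff_symmDiff_symmDiff_comm]; simp
    obtain ⟨y, hy, h⟩ := D.exchange _ hX _ hY x (by rwa [e])
    refine ⟨y, by rwa [e] at hy, ?_⟩
    simpa [symmDiff_assoc, symmDiff_comm Z] using h

@[simp] lemma mem_twist (D : DeltaMatroid E) (Z X : Set E) :
    X ∈ (D.twist Z).feasible ↔ X ∆ Z ∈ D.feasible := Iff.rfl

lemma twist_twist (D : DeltaMatroid E) (Z W : Set E) :
    (D.twist Z).twist W = D.twist (Z ∆ W) := by
  ext X
  simp [symmDiff_assoc, symmDiff_comm Z]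

lemma exists_maxOn [Finite E] (D : DeltaMatroid E) (Y : Set E) : ∃ F, D.MaxOn Y F := by
  obtain ⟨F, hF, h⟩ := Set.exists_max_image D.feasible (fun F => (F ∩ Y).ncard)
    (Set.toFinite _) D.nonempty
  exact ⟨F, hF, h⟩

/-- Augmentation for subsets of feasible sets. -/
lemma augment [Finite E] (D : DeltaMatroid E) : ∀ (n : ℕ) (I J : Set E), (I \ J).ncard = n →
    (∃ F ∈ D.feasible, I ⊆ F) → (∃ F ∈ D.feasible, J ⊆ F) → I.ncard < J.ncard →
    ∃ e ∈ J, e ∉ I ∧ ∃ F ∈ D.feasible, insert e I ⊆ F := by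
  intro n
  induction n using Nat.strong_induction_on with
  | _ n ih =>
  intro I J hn hI hJ hlt
  obtain ⟨F, hF, hIF⟩ := hI
  obtain ⟨G, hG, hJG⟩ := hJ
  by_cases h0 : I ⊆ J
  · obtain ⟨e, heJ, heI⟩ := Set.exists_mem_notMem_of_ncard_lt_ncard hlt
    exact ⟨e, heJ, heI, G, hG, Set.insert_subset (hJG heJ) (h0.trans hJG)⟩
  obtain ⟨y, hyI, hyJ⟩ := Set.not_subset.1 h0
  -- a set `J'` containing `y`, close to `J`
  have key : ∃ J', (∃ F ∈ D.feasible, J' ⊆ F) ∧ J.ncard ≤ J'.ncard ∧ I \ J' ⊆ (I \ J) \ {y} ∧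
      J' \ I ⊆ J \ I := by
    by_cases hyG : y ∈ G
    · refine ⟨insert y J, ⟨G, hG, Set.insert_subset hyG hJG⟩,
        Set.ncard_le_ncard (Set.subset_insert _ _) (Set.toFinite _), ?_, ?_⟩
      · intro z hz; simp at hz ⊢; tauto
      · intro z hz; simp at hz ⊢; rcases hz with ⟨rfl | h, h'⟩ <;> tauto
    · obtain ⟨y', hy', h⟩ := D.exchange G hG F hF y (Or.inr ⟨hIF hyI, hyG⟩)
      by_cases hyy : y' ∈ J
      · have hy'F : y' ∉ F := by
          rcases hy' with h | h
          · exact h.2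
          · exact absurd (hJG hyy) h.2
        have hy'I : y' ∉ I := fun h => hy'F (hIF h)
        refine ⟨insert y (J \ {y'}), ⟨_, h, ?_⟩, ?_, ?_, ?_⟩
        · intro z hz
          rcases hz with rfl | ⟨hz, hz'⟩
          · exact Or.inr ⟨by simp, hyG⟩
          · refine Or.inl ⟨hJG hz, ?_⟩
            rintro (rfl | rfl)
            · exact hyJ hz
            · exact hz' rfl
        · rw [Set.ncard_insert_of_notMem (by simp [hyJ]) (Set.toFinite _),
            Set.ncard_sdiff_singleton_add_one hyy (Set.toFinite _)]
        · intro z hz; simp at hz ⊢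
          refine ⟨⟨hz.1, fun hzJ => ?_⟩, fun h => hz.2.1 h⟩
          exact hy'I (hz.2.2 hzJ ▸ hz.1)
        · intro z hz; simp at hz ⊢; rcases hz with ⟨rfl | h, h'⟩ <;> tauto
      · refine ⟨insert y J, ⟨_, h, ?_⟩,
          Set.ncard_le_ncard (Set.subset_insert _ _) (Set.toFinite _), ?_, ?_⟩
        · intro z hz
          rcases hz with rfl | hz
          · exact Or.inr ⟨by simp, hyG⟩
          · refine Or.inl ⟨hJG hz, ?_⟩
            rintro (rfl | rfl)
            · exact hyJ hz
            · exact hyy hz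
        · intro z hz; simp at hz ⊢; tauto
        · intro z hz; simp at hz ⊢; rcases hz with ⟨rfl | h, h'⟩ <;> tauto
  obtain ⟨J', hJ', hc, h1, h2⟩ := key
  have hlt' : (I \ J').ncard < n := by
    rw [← hn]
    refine Set.ncard_lt_ncard (h1.trans_ssubset ?_) (Set.toFinite _)
    exact Set.sdiff_singleton_ssubset.2 ⟨hyI, hyJ⟩
  obtain ⟨e, heJ, heI, hF⟩ := ih _ hlt' I J' rfl ⟨F, hF, hIF⟩ hJ' (hlt.trans_le hc)
  exact ⟨e, (h2 ⟨heJ, heI⟩).1, heI, hF⟩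

/-- The sets that are contained in a feasible set extend inside `Y` to the maximal size. -/
lemma extend [Finite E] (D : DeltaMatroid E) {Y I F₀ : Set E} (h₀ : D.MaxOn Y F₀)
    (hI : ∃ F ∈ D.feasible, I ⊆ F) (hIY : I ⊆ Y) : ∃ F, D.MaxOn Y F ∧ I ⊆ F := by
  obtain ⟨J, ⟨⟨F, hF, hJF⟩, hJY, hIJ⟩, hmax⟩ := Set.exists_max_image
    {J : Set E | (∃ F ∈ D.feasible, J ⊆ F) ∧ J ⊆ Y ∧ I ⊆ J} Set.ncard (Set.toFinite _)
    ⟨I, hI, hIY, Subset.rfl⟩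
  refine ⟨F, ⟨hF, fun G hG => (h₀.2 G hG).trans ?_⟩, hIJ.trans hJF⟩
  refine le_trans ?_ (Set.ncard_le_ncard (Set.subset_inter hJF hJY) (Set.toFinite _))
  by_contra hlt
  push Not at hlt
  obtain ⟨e, he, heJ, F', hF', hs⟩ := D.augment _ J (F₀ ∩ Y) rfl ⟨F, hF, hJF⟩
    ⟨F₀, h₀.1, Set.inter_subset_left⟩ hlt
  have := hmax (insert e J) ⟨⟨F', hF', hs⟩, Set.insert_subset he.2 hJY,
    hIJ.trans (Set.subset_insert _ _)⟩
  rw [Set.ncard_insert_of_notMem heJ (Set.toFinite _)] at this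
  omega

lemma symmDiff_pair_inter (F Y : Set E) (x y : E) :
    (F ∆ {x, y}) ∩ Y = (F ∩ Y) ∆ ({x, y} ∩ Y) := by
  ext z; simp only [mem_inter_iff, mem_symmDiff, mem_insert_iff, mem_singleton_iff]; tauto

/-- Among the sets that are maximal on `Y` with a given trace outside `Y`, one is maximal
on a given subset of `Y`. -/
lemma MaxOn.swap [Finite E] {D : DeltaMatroid E} {X Y F : Set E} (hF : D.MaxOn Y F)
    (hXY : X ⊆ Y) : ∃ F', F' \ Y = F \ Y ∧ D.MaxOn Y F' ∧ D.MaxOn X F' := by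
  obtain ⟨G, hG⟩ := D.exists_maxOn X
  suffices H : ∀ n, ∀ F, D.MaxOn Y F → (F ∆ G).ncard = n →
      ∃ F', F' \ Y = F \ Y ∧ D.MaxOn Y F' ∧ D.MaxOn X F' from H _ F hF rfl
  intro n
  induction n using Nat.strong_induction_on with
  | _ n ih =>
  intro F hF hn
  by_cases hle : (G ∩ X).ncard ≤ (F ∩ X).ncard
  · exact ⟨F, rfl, hF, hF.1, fun H hH => (hG.2 H hH).trans hle⟩
  push Not at hle
  obtain ⟨x, ⟨hxG, hxX⟩, hxF⟩ := Set.exists_mem_notMem_of_ncard_lt_ncard hle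
  have hxF : x ∉ F := fun h => hxF ⟨h, hxX⟩
  have hxY := hXY hxX
  obtain ⟨y, hy, hFy⟩ := D.exchange F hF.1 G hG.1 x (Or.inr ⟨hxG, hxF⟩)
  have hc := hF.2 _ hFy
  have hyFY : y ∈ F ∧ y ∈ Y := by
    by_contra hn
    have : insert x (F ∩ Y) ⊆ (F ∆ {x, y}) ∩ Y := by
      intro z hz
      rcases hz with rfl | ⟨hz, hzY⟩
      · exact ⟨Or.inr ⟨by simp, hxF⟩, hxY⟩
      · refine ⟨Or.inl ⟨hz, ?_⟩, hzY⟩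
        rintro (rfl | rfl)
        · exact hxF hz
        · exact hn ⟨hz, hzY⟩
    have := Set.ncard_le_ncard this (Set.toFinite _)
    rw [Set.ncard_insert_of_notMem (by simp [hxF]) (Set.toFinite _)] at this
    omega
  obtain ⟨hyF, hyY⟩ := hyFY
  have hyG : y ∉ G := by
    rcases hy with h | h
    · exact h.2
    · exact absurd hyF h.2
  have hxy : x ≠ y := fun h => hxF (h ▸ hyF)
  have e1 : (F ∆ {x, y}) ∩ Y = insert x ((F ∩ Y) \ {y}) := by
    ext z
    by_cases h1 : z = x
    · subst h1; simp [mem_symmDiff, hxF, hxY]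
    · by_cases h2 : z = y
      · subst h2; simp [mem_symmDiff, hyF, h1]
      · simp [mem_symmDiff, h1, h2]
  have hM : D.MaxOn Y (F ∆ {x, y}) := by
    refine ⟨hFy, fun H hH => (hF.2 H hH).trans (le_of_eq ?_)⟩
    rw [e1, Set.ncard_insert_of_notMem (by simp [hxF]) (Set.toFinite _),
      Set.ncard_sdiff_singleton_add_one (show y ∈ F ∩ Y from ⟨hyF, hyY⟩) (Set.toFinite _)]
  have hlt : ((F ∆ {x, y}) ∆ G).ncard < n := by
    rw [← hn]
    refine Set.ncard_lt_ncard ⟨?_, ?_⟩ (Set.toFinite _)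
    · intro z hz
      by_cases h1 : z = x
      · subst h1; exact Or.inr ⟨hxG, hxF⟩
      · by_cases h2 : z = y
        · subst h2; exact Or.inl ⟨hyF, hyG⟩
        · simpa [mem_symmDiff, h1, h2] using hz
    · intro h
      have := h (a := x) (Or.inr ⟨hxG, hxF⟩)
      simp [mem_symmDiff, hxF, hxG] at this
  obtain ⟨F', h1, h2, h3⟩ := ih _ hlt _ hM rfl
  refine ⟨F', h1.trans ?_, h2, h3⟩
  ext z
  by_cases h1 : z = x
  · subst h1; simp [hxY]
  · by_cases h2 : z = y
    · subst h2; simp [hyY]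
    · simp [mem_symmDiff, h1, h2]

/-- Greedy maximization: first on `X`, then on a larger set `Y`. -/
lemma MaxOn.of_greedy [Finite E] {D : DeltaMatroid E} {X Y F : Set E} (hXY : X ⊆ Y)
    (hF : D.MaxOn X F) (h : ∀ G, D.MaxOn X G → (G ∩ Y).ncard ≤ (F ∩ Y).ncard) :
    D.MaxOn Y F := by
  obtain ⟨F₀, h₀⟩ := D.exists_maxOn Y
  obtain ⟨F₁, -, h₁, h₂⟩ := h₀.swap hXY
  exact ⟨hF.1, fun G hG => (h₁.2 G hG).trans (h F₁ h₂)⟩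

/-- The exchange axiom for the sets that are maximal on `Y`, outside `Y`. -/
lemma MaxOn.exchange [Finite E] {D : DeltaMatroid E} {Y F G : Set E} (hF : D.MaxOn Y F)
    (hG : D.MaxOn Y G) {x : E} (hx : x ∈ F ∆ G) (hxY : x ∉ Y) :
    ∃ y ∈ F ∆ G, y ∉ Y ∧ ∃ H, D.MaxOn Y H ∧ H \ Y = (F ∆ {x, y}) \ Y := by
  obtain ⟨y, hy, hFy⟩ := D.exchange F hF.1 G hG.1 x hx
  have hnoY : ∀ {y}, y ∉ Y → (F ∆ {x, y}) ∩ Y = F ∩ Y := by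
    intro y hyY
    ext z
    by_cases h1 : z = x
    · subst h1; simp [hxY]
    · by_cases h2 : z = y
      · subst h2; simp [hyY]
      · simp [mem_symmDiff, h1, h2]
  by_cases hyY : y ∉ Y
  · exact ⟨y, hy, hyY, _, ⟨hFy, by rw [hnoY hyY]; exact hF.2⟩, rfl⟩
  push Not at hyY
  have hxy : x ≠ y := fun h => hxY (h ▸ hyY)
  -- now repair `F ∆ {x, y}`
  suffices H : ∀ n, ∀ F₁ ∈ D.feasible, (F₁ ∆ G).ncard = n → F₁ \ Y = (F ∆ {x}) \ Y →
      (F ∩ Y).ncard ≤ (F₁ ∩ Y).ncard + 1 →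
      ∃ y ∈ F ∆ G, y ∉ Y ∧ ∃ H, D.MaxOn Y H ∧ H \ Y = (F ∆ {x, y}) \ Y by
    refine H _ _ hFy rfl ?_ ?_
    · ext z
      by_cases h2 : z = y
      · subst h2; simp [hyY]
      · simp [mem_symmDiff, h2]
    · have : F ∩ Y ⊆ insert y ((F ∆ {x, y}) ∩ Y) := by
        intro z hz
        by_cases h1 : z = x
        · subst h1; exact absurd hz.2 hxY
        · by_cases h2 : z = y
          · simp [h2]
          · exact Or.inr ⟨Or.inl ⟨hz.1, by simp [h1, h2]⟩, hz.2⟩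
      exact (Set.ncard_le_ncard this (Set.toFinite _)).trans (Set.ncard_insert_le _ _)
  intro n
  induction n using Nat.strong_induction_on with
  | _ n ih =>
  intro F₁ hF₁ hn hout hcard
  have hFx : (F ∆ {x, x}) \ Y = (F ∆ {x}) \ Y := by simp
  by_cases hle : (F ∩ Y).ncard ≤ (F₁ ∩ Y).ncard
  · exact ⟨x, hx, hxY, F₁, ⟨hF₁, fun H hH => (hF.2 H hH).trans hle⟩, hout.trans hFx.symm⟩
  push Not at hle
  have hGF : (F ∩ Y).ncard ≤ (G ∩ Y).ncard := hG.2 F hF.1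
  obtain ⟨z, ⟨hzG, hzY⟩, hzF₁⟩ := Set.exists_mem_notMem_of_ncard_lt_ncard (hle.trans_le hGF)
  have hzF₁ : z ∉ F₁ := fun h => hzF₁ ⟨h, hzY⟩
  obtain ⟨w, hw, hFw⟩ := D.exchange F₁ hF₁ G hG.1 z (Or.inr ⟨hzG, hzF₁⟩)
  have hout' : ∀ a, a ∉ Y → (a ∈ F₁ ↔ a ∈ F ∆ {x}) := by
    intro a ha
    have := Set.ext_iff.1 hout a
    simpa [ha] using this
  by_cases hwY : w ∈ Y
  · by_cases hwF : w ∈ F₁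
    · -- swap, one step closer to `G`
      have hwG : w ∉ G := by
        rcases hw with h | h
        · exact h.2
        · exact absurd hwF h.2
      have hzw : z ≠ w := fun h => hzF₁ (h ▸ hwF)
      have e1 : (F₁ ∆ {z, w}) ∩ Y = insert z ((F₁ ∩ Y) \ {w}) := by
        ext a
        by_cases h1 : a = z
        · subst h1; simp [mem_symmDiff, hzF₁, hzY]
        · by_cases h2 : a = w
          · subst h2; simp [mem_symmDiff, hwF, h1]
          · simp [mem_symmDiff, h1, h2]
      refine ih _ ?_ (F₁ ∆ {z, w}) hFw rfl ?_ ?_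
      · rw [← hn]
        refine Set.ncard_lt_ncard ⟨?_, ?_⟩ (Set.toFinite _)
        · intro a ha
          by_cases h1 : a = z
          · subst h1; exact Or.inr ⟨hzG, hzF₁⟩
          · by_cases h2 : a = w
            · subst h2; exact Or.inl ⟨hwF, hwG⟩
            · simpa [mem_symmDiff, h1, h2] using ha
        · intro h
          have := h (a := z) (Or.inr ⟨hzG, hzF₁⟩)
          simp [mem_symmDiff, hzF₁, hzG] at this
      · rw [← hout]
        ext a
        by_cases h1 : a = z
        · subst h1; simp [hzY]
        · by_cases h2 : a = w
          · subst h2; simp [hwY]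
          · simp [mem_symmDiff, h1, h2]
      · rw [e1, Set.ncard_insert_of_notMem (by simp [hzF₁]) (Set.toFinite _),
          Set.ncard_sdiff_singleton_add_one (show w ∈ F₁ ∩ Y from ⟨hwF, hwY⟩) (Set.toFinite _)]
        exact hcard
    · refine ⟨x, hx, hxY, F₁ ∆ {z, w}, ⟨hFw, fun H hH => (hF.2 H hH).trans ?_⟩, ?_⟩
      · refine hcard.trans ?_
        rw [← Set.ncard_insert_of_notMem (a := z) (s := F₁ ∩ Y) (by simp [hzF₁]) (Set.toFinite _)]
        refine Set.ncard_le_ncard ?_ (Set.toFinite _)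
        intro a ha
        rcases ha with rfl | ⟨h1, h2⟩
        · exact ⟨Or.inr ⟨by simp, hzF₁⟩, hzY⟩
        · refine ⟨Or.inl ⟨h1, ?_⟩, h2⟩
          rintro (rfl | rfl)
          · exact hzF₁ h1
          · exact hwF h1
      · rw [hFx, ← hout]
        ext a
        by_cases h1 : a = z
        · subst h1; simp [hzY]
        · by_cases h2 : a = w
          · subst h2; simp [hwY]
          · simp [mem_symmDiff, h1, h2]
  · have hzw : z ≠ w := fun h => hwY (h ▸ hzY)
    have hwx : w ≠ x := by
      rintro rfl
      have h1 := hout' w hwY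
      simp only [mem_symmDiff, mem_singleton_iff] at h1 hw hx
      tauto
    refine ⟨w, ?_, hwY, F₁ ∆ {z, w}, ⟨hFw, fun H hH => (hF.2 H hH).trans ?_⟩, ?_⟩
    · have h1 := hout' w hwY
      simp only [mem_symmDiff, mem_singleton_iff] at h1 hw ⊢
      tauto
    · refine hcard.trans ?_
      rw [← Set.ncard_insert_of_notMem (a := z) (s := F₁ ∩ Y) (by simp [hzF₁]) (Set.toFinite _)]
      refine Set.ncard_le_ncard ?_ (Set.toFinite _)
      intro a ha
      rcases ha with rfl | ⟨h1, h2⟩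
      · exact ⟨Or.inr ⟨by simp, hzF₁⟩, hzY⟩
      · refine ⟨Or.inl ⟨h1, ?_⟩, h2⟩
        rintro (rfl | rfl)
        · exact hzF₁ h1
        · exact hwY h2
    · ext a
      simp only [mem_sdiff]
      refine and_congr_left fun ha => ?_
      have h1 := hout' a ha
      have h2 : a ≠ z := fun h => ha (h ▸ hzY)
      simp only [mem_symmDiff, mem_singleton_iff, mem_insert_iff] at h1 ⊢
      have : a = w → a ≠ x := fun h => h ▸ hwx
      tauto

/-! ### Upper and lower matroid -/

/-- The dual delta-matroid: its feasible sets are the complements of the feasible sets. -/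
def dual (D : DeltaMatroid E) : DeltaMatroid E := D.twist univ

lemma mem_dual (D : DeltaMatroid E) (X : Set E) : X ∈ D.dual.feasible ↔ Xᶜ ∈ D.feasible := by
  simp [dual, symmDiff_def, Set.compl_eq_univ_sdiff]

/-- The upper matroid: its bases are the feasible sets of maximum cardinality. -/
def upper [Finite E] (D : DeltaMatroid E) : Matroid E :=
  Matroid.ofIsBaseOfFinite (E := univ) (Set.toFinite _)
    (fun B => B ∈ D.feasible ∧ ∀ F ∈ D.feasible, F.ncard ≤ B.ncard)
    (Set.exists_max_image D.feasible Set.ncard (Set.toFinite _) D.nonempty)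
    (by
      intro X Y hX hY a ha
      have hc : (X \ {a}).ncard < Y.ncard := by
        have h1 := Set.ncard_sdiff_singleton_add_one ha.1 (Set.toFinite _)
        have h2 := hY.2 X hX.1
        omega
      obtain ⟨e, heY, he, F, hF, hs⟩ := D.augment _ (X \ {a}) Y rfl ⟨X, hX.1, Set.sdiff_subset⟩
        ⟨Y, hY.1, Subset.rfl⟩ hc
      have hea : e ≠ a := fun h => ha.2 (h ▸ heY)
      have heX : e ∉ X := fun h => he ⟨h, hea⟩
      have hcard : (insert e (X \ {a})).ncard = X.ncard := by
        rw [Set.ncard_insert_of_notMem he (Set.toFinite _),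
          Set.ncard_sdiff_singleton_add_one ha.1 (Set.toFinite _)]
      have hFe : insert e (X \ {a}) = F :=
        Set.eq_of_subset_of_ncard_le hs (by rw [hcard]; exact hX.2 F hF) (Set.toFinite _)
      refine ⟨e, ⟨heY, heX⟩, hFe ▸ hF, fun G hG => ?_⟩
      rw [hcard]; exact hX.2 G hG)
    (fun _ _ => Set.subset_univ _)

lemma upper_isBase [Finite E] (D : DeltaMatroid E) (B : Set E) : D.upper.IsBase B ↔
    B ∈ D.feasible ∧ ∀ F ∈ D.feasible, F.ncard ≤ B.ncard := Iff.rfl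

@[simp] lemma upper_ground [Finite E] (D : DeltaMatroid E) : D.upper.E = univ := rfl

lemma isBase_dual_upper_dual [Finite E] (D : DeltaMatroid E) (B : Set E) :
    D.dual.upper✶.IsBase B ↔ B ∈ D.feasible ∧ ∀ F ∈ D.feasible, B.ncard ≤ F.ncard := by
  rw [Matroid.dual_isBase_iff (by simp), upper_isBase, upper_ground, ← Set.compl_eq_univ_sdiff,
    mem_dual, compl_compl]
  refine and_congr_right fun _ => ⟨fun h F hF => ?_, fun h F hF => ?_⟩
  · have := h Fᶜ (by simpa [mem_dual] using hF)
    have h1 := Set.ncard_add_ncard_compl F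
    have h2 := Set.ncard_add_ncard_compl B
    omega
  · have := h Fᶜ ((D.mem_dual F).1 hF)
    have h1 := Set.ncard_add_ncard_compl F
    have h2 := Set.ncard_add_ncard_compl B
    omega

/-- The lower matroid: its bases are the feasible sets of minimum cardinality. -/
def lower [Finite E] (D : DeltaMatroid E) : Matroid E :=
  Matroid.ofIsBaseOfFinite (E := univ) (Set.toFinite _)
    (fun B => B ∈ D.feasible ∧ ∀ F ∈ D.feasible, B.ncard ≤ F.ncard)
    (Set.exists_min_image D.feasible Set.ncard (Set.toFinite _) D.nonempty)
    (by
      intro X Y hX hY a ha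
      simp only [← isBase_dual_upper_dual] at hX hY ⊢
      exact hX.exchange hY ha)
    (fun _ _ => Set.subset_univ _)

lemma lower_isBase [Finite E] (D : DeltaMatroid E) (B : Set E) : D.lower.IsBase B ↔
    B ∈ D.feasible ∧ ∀ F ∈ D.feasible, B.ncard ≤ F.ncard := Iff.rfl

@[simp] lemma lower_ground [Finite E] (D : DeltaMatroid E) : D.lower.E = univ := rfl

lemma lower_eq [Finite E] (D : DeltaMatroid E) : D.lower = D.dual.upper✶ :=
  Matroid.ext_isBase (by simp) fun B _ => by rw [isBase_dual_upper_dual, lower_isBase]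

lemma upper_indep [Finite E] (D : DeltaMatroid E) (I : Set E) :
    D.upper.Indep I ↔ ∃ F ∈ D.feasible, I ⊆ F := by
  rw [Matroid.indep_iff]
  refine ⟨fun ⟨B, hB, h⟩ => ⟨B, hB.1, h⟩, fun h => ?_⟩
  obtain ⟨F₀, h₀⟩ := D.exists_maxOn univ
  obtain ⟨F, hF, hIF⟩ := D.extend h₀ h (Set.subset_univ _)
  exact ⟨F, ⟨hF.1, by simpa using hF.2⟩, hIF⟩

end DeltaMatroid

/-! ### Matroids: rank, minors, relabelling -/


section Mat
open scoped Matroid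
variable {E E' E'' : Type u}

/-- The rank of a set in a matroid, as a natural number (the ground sets are finite). -/
noncomputable def rk (M : Matroid E) (X : Set E) : ℕ := (M.eRk X).toNat

/-- The rank of a matroid. -/
noncomputable def rank (M : Matroid E) : ℕ := rk M M.E

lemma cast_rk [Finite E] (M : Matroid E) (X : Set E) : (rk M X : ℕ∞) = M.eRk X :=
  ENat.natCast_toNat (((M.eRk_le_encard X).trans_lt (Set.toFinite X).encard_lt_top).ne)

lemma rk_mono [Finite E] (M : Matroid E) {X Y : Set E} (h : X ⊆ Y) : rk M X ≤ rk M Y := by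
  have := M.eRk_mono h
  rw [← cast_rk, ← cast_rk] at this
  exact_mod_cast this

lemma rk_submod [Finite E] (M : Matroid E) (X Y : Set E) :
    rk M (X ∩ Y) + rk M (X ∪ Y) ≤ rk M X + rk M Y := by
  have := M.eRk_inter_add_eRk_union_le X Y
  simp only [← cast_rk] at this
  exact_mod_cast this

lemma rk_comap [Finite E] [Finite E'] (M : Matroid E) (f : E' → E) (X : Set E') :
    rk (M.comap f) X = rk M (f '' X) := by
  simp [rk, Matroid.eRk_comap]

lemma rk_dual [Finite E] {M : Matroid E} (hM : M.E = univ) (X : Set E) :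
    rk M✶ X + rk M univ = rk M Xᶜ + X.ncard := by
  have := M.eRk_dual_add_eRank X (by simp [hM])
  rw [Matroid.eRank_def, hM, ← Set.compl_eq_univ_sdiff, ← (Set.toFinite X).cast_ncard_eq] at this
  simp only [← cast_rk] at this
  exact_mod_cast this

lemma rk_empty [Finite E] (M : Matroid E) : rk M ∅ = 0 := by simp [rk]

lemma rk_contract [Finite E] {M : Matroid E} (hM : M.E = univ) {C X : Set E}
    (h : Disjoint X C) : rk (M ／ C) X + rk M C = rk M (X ∪ C) := by
  obtain ⟨I, hI⟩ := M.exists_isBasis C (by simp [hM])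
  obtain ⟨J, hJ, hIJ⟩ := hI.indep.subset_isBasis_of_subset (hI.subset.trans
    (Set.subset_union_right (s := X))) (by simp [hM])
  have hb := hJ.contract_isBasis hI (hJ.indep.subset (by simp [hIJ]))
  have e1 : ((X ∪ C) \ C) = X := by
    rw [Set.union_sdiff_right]; exact h.sdiff_eq_left
  have h1 := hb.eRk_eq_encard
  rw [e1] at h1
  have hJC : J ∩ C = I := by
    refine (hI.eq_of_subset_indep (hJ.indep.subset Set.inter_subset_left)
      (Set.subset_inter hIJ hI.subset) Set.inter_subset_right).symm
  have e2 : J \ C = J \ I := by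
    rw [← hJC]; simp
  have h2 := hJ.eRk_eq_encard
  have h3 := hI.eRk_eq_encard
  rw [e2] at h1
  have h4 := Set.encard_sdiff_add_encard_of_subset hIJ
  rw [← h1, ← h2, ← h3] at h4
  simp only [← cast_rk] at h4
  exact_mod_cast h4

lemma ext_rk [Finite E] {M N : Matroid E} (hM : M.E = univ) (hN : N.E = univ)
    (h : ∀ X, rk M X = rk N X) : M = N := by
  refine Matroid.ext_indep (by rw [hM, hN]) fun I _ => ?_
  rw [Matroid.indep_iff_eRk_eq_encard_of_finite (Set.toFinite _),
    Matroid.indep_iff_eRk_eq_encard_of_finite (Set.toFinite _), ← cast_rk, ← cast_rk, h]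

/-- Restriction of a matroid to the range of an embedding, relabelled along the embedding. -/
def matRestr (f : E' ↪ E) (M : Matroid E) : Matroid E' := M.comap f

/-- Contraction in a matroid of all elements outside the range of an embedding, relabelled
along the embedding. -/
def matContr (f : E' ↪ E) (M : Matroid E) : Matroid E' := (M ／ (range f)ᶜ).comap f

/-- `M'` has the rank function of the minor of `M` in which `P` is contracted and in which the
elements outside `P` and the range of `f` are deleted. -/
def HasRk (M' : Matroid E') (f : E' ↪ E) (P : Set E) (M : Matroid E) : Prop :=
  ∀ X, rk M' X + rk M P = rk M (f '' X ∪ P)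

lemma matRestr_ground {f : E' ↪ E} {M : Matroid E} (hM : M.E = univ) :
    (matRestr f M).E = univ := by simp [matRestr, hM]

lemma matContr_ground {f : E' ↪ E} {M : Matroid E} (hM : M.E = univ) :
    (matContr f M).E = univ := by
  ext x; simp [matContr, hM]

lemma mapEquiv_ground {σ : E ≃ E'} {M : Matroid E} (hM : M.E = univ) :
    (M.mapEquiv σ).E = univ := by simp [hM]

variable [Finite E] [Finite E'] [Finite E'']

lemma hasRk_matRestr (f : E' ↪ E) (M : Matroid E) : HasRk (matRestr f M) f ∅ M := by
  intro X; simp [matRestr, rk_comap, rk_empty]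

lemma hasRk_matContr (f : E' ↪ E) {M : Matroid E} (hM : M.E = univ) :
    HasRk (matContr f M) f (range f)ᶜ M := by
  intro X
  rw [matContr, rk_comap, rk_contract hM]
  exact Set.disjoint_compl_right_iff_subset.2 (Set.image_subset_range _ _)

lemma hasRk_mapEquiv (σ : E' ≃ E) (M : Matroid E) (hM : M.E = univ) :
    HasRk (M.mapEquiv σ.symm) σ.toEmbedding ∅ M := by
  intro X
  have : X = σ.symm '' (σ '' X) := by simp [Set.image_image]
  simp only [rk_empty, add_zero, union_empty]
  conv_lhs => rw [this]
  rw [rk, Matroid.mapEquiv_eq_map, Matroid.eRk_map _ _ (by simp [hM])]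
  rfl

lemma HasRk.comp {M : Matroid E} {M' : Matroid E'} {M'' : Matroid E''} {f : E' ↪ E}
    {g : E'' ↪ E'} {P : Set E} {P' : Set E'} (h : HasRk M' f P M) (h' : HasRk M'' g P' M') :
    HasRk M'' (g.trans f) (f '' P' ∪ P) M := by
  intro X
  have h1 := h' X
  have h2 := h P'
  have h3 := h (g '' X ∪ P')
  rw [Set.image_union, Set.union_assoc] at h3
  have e : (g.trans f) '' X = f '' (g '' X) := by simp [Set.image_image]
  rw [e]
  omega

lemma HasRk.unique {M : Matroid E} {M' N' : Matroid E'} {f g : E' ↪ E} {P Q : Set E}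
    (h : HasRk M' f P M) (h' : HasRk N' g Q M) (hf : f = g) (hP : P = Q)
    (hM : M'.E = univ) (hN : N'.E = univ) : M' = N' := by
  subst hf hP
  refine ext_rk hM hN fun X => ?_
  have h1 := h X
  have h2 := h' X
  omega

lemma HasRk.dual {M : Matroid E} {M' : Matroid E'} {f : E' ↪ E} {P Q : Set E}
    (h : HasRk M' f P M) (hM : M.E = univ) (hM' : M'.E = univ) (hPQ : Disjoint P Q)
    (hR : P ∪ Q = (range f)ᶜ) : HasRk M'✶ f Q M✶ := by
  intro X
  have hmem : ∀ x, (x ∈ P ∨ x ∈ Q) ↔ ∀ y, f y ≠ x := fun x => by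
    have := Set.ext_iff.1 hR x
    simpa using this
  have e1 : (f '' X ∪ Q)ᶜ = f '' Xᶜ ∪ P := by
    ext x
    have h1 := hmem x
    have h2 : x ∈ P → x ∉ Q := fun a b => Set.disjoint_left.1 hPQ a b
    by_cases hx : ∃ y, f y = x
    · obtain ⟨y, rfl⟩ := hx
      have : ¬ (f y ∈ P ∨ f y ∈ Q) := fun h => (h1.1 h) y rfl
      simp; tauto
    · push Not at hx
      have h3 := h1.2 hx
      simp [hx]; tauto
  have e2 : Qᶜ = f '' univ ∪ P := by
    ext x
    have h1 := hmem x
    have h2 : x ∈ P → x ∉ Q := fun a b => Set.disjoint_left.1 hPQ a b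
    by_cases hx : ∃ y, f y = x
    · obtain ⟨y, rfl⟩ := hx
      have : ¬ (f y ∈ P ∨ f y ∈ Q) := fun h => (h1.1 h) y rfl
      simp; tauto
    · push Not at hx
      have h3 := h1.2 hx
      simp [hx]; tauto
  have d1 := rk_dual hM' X
  have d2 := rk_dual hM Q
  have d3 := rk_dual hM (f '' X ∪ Q)
  have hc : (f '' X ∪ Q).ncard = X.ncard + Q.ncard := by
    rw [Set.ncard_union_eq ?_ (Set.toFinite _) (Set.toFinite _),
      Set.ncard_image_of_injective _ f.injective]
    refine Set.disjoint_left.2 ?_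
    rintro _ ⟨y, -, rfl⟩ hy
    exact (hmem _).1 (Or.inr hy) y rfl
  have h1 := h Xᶜ
  have h2 := h univ
  rw [e1] at d3
  rw [e2] at d2
  omega

/-- A matroid perspective: increments of the rank of `N` are at most those of the rank of `M`,
i.e. `rk N Y - rk N X ≤ rk M Y - rk M X` for `X ⊆ Y`. -/
def IsPersp (M N : Matroid E) : Prop :=
  ∀ X Y : Set E, X ⊆ Y → rk N Y + rk M X ≤ rk M Y + rk N X

lemma IsPersp.trans {M N L : Matroid E} (h : IsPersp M N) (h' : IsPersp N L) :
    IsPersp M L := fun X Y hXY => by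
  have := h X Y hXY
  have := h' X Y hXY
  omega

lemma IsPersp.dual {M N : Matroid E} (h : IsPersp M N) (hM : M.E = univ) (hN : N.E = univ) :
    IsPersp N✶ M✶ := fun X Y hXY => by
  have := h Yᶜ Xᶜ (Set.compl_subset_compl.2 hXY)
  have := rk_dual hM X
  have := rk_dual hM Y
  have := rk_dual hN X
  have := rk_dual hN Y
  omega

lemma IsPersp.minor {M N : Matroid E} {M' N' : Matroid E'} {f : E' ↪ E} {P : Set E}
    (h : IsPersp M N) (hM : HasRk M' f P M) (hN : HasRk N' f P N) : IsPersp M' N' :=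
  fun X Y hXY => by
  have := h (f '' X ∪ P) (f '' Y ∪ P) (Set.union_subset_union_left _ (Set.image_mono hXY))
  have := hM X
  have := hM Y
  have := hN X
  have := hN Y
  omega

end Mat

namespace DeltaMatroid
variable {E E' E'' : Type u}

/-! ### Minors and relabelling of delta-matroids -/

lemma maxOn_twist {D : DeltaMatroid E} {Y Z F : Set E} (h : Disjoint Z Y) :
    (D.twist Z).MaxOn Y F ↔ D.MaxOn Y (F ∆ Z) := by
  have e : ∀ G : Set E, (G ∆ Z) ∩ Y = G ∩ Y := by
    intro G; ext x
    have := fun (a : x ∈ Z) => Set.disjoint_left.1 h a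
    simp [mem_symmDiff]; tauto
  unfold MaxOn
  rw [e]
  refine and_congr_right fun _ => ⟨fun H G hG => ?_, fun H G hG => ?_⟩
  · have := H (G ∆ Z) (by simpa [symmDiff_assoc] using hG)
    rwa [e] at this
  · have := H _ hG
    rwa [e] at this

lemma minOn_iff [Finite E] {D : DeltaMatroid E} {Y F : Set E} :
    D.MinOn Y F ↔ (D.twist Y).MaxOn Y (F ∆ Y) := by
  have e : ∀ G : Set E, ((G ∆ Y) ∩ Y).ncard + (G ∩ Y).ncard = Y.ncard := by
    intro G
    rw [← Set.ncard_union_eq]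
    · congr 1; ext x; simp [mem_symmDiff]; tauto
    · refine Set.disjoint_left.2 fun x hx hx' => ?_
      simp [mem_symmDiff] at hx hx'; tauto
  unfold MaxOn MinOn
  rw [mem_twist, symmDiff_symmDiff_cancel_right]
  refine and_congr_right fun _ => ⟨fun H G hG => ?_, fun H G hG => ?_⟩
  · have h1 := H _ hG
    have h2 := e F
    have h3 := e (G ∆ Y)
    rw [symmDiff_symmDiff_cancel_right] at h3
    omega
  · have h1 := H (G ∆ Y) (by simpa [symmDiff_assoc] using hG)
    have h2 := e F
    have h3 := e G
    omega

/-- Contraction of all elements outside the range of an embedding, relabelled along the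
embedding: the feasible sets of `D` with the most elements outside the range are kept. -/
def contr [Finite E] (f : E' ↪ E) (D : DeltaMatroid E) : DeltaMatroid E' where
  feasible := (fun F => f ⁻¹' F) '' {F | D.MaxOn (range f)ᶜ F}
  nonempty := by
    obtain ⟨F, hF⟩ := D.exists_maxOn (range f)ᶜ
    exact ⟨_, F, hF, rfl⟩
  exchange := by
    rintro _ ⟨F, hF, rfl⟩ _ ⟨G, hG, rfl⟩ x hx
    have hx' : f x ∈ F ∆ G := by simpa [mem_symmDiff] using hx
    obtain ⟨_, hy, hyr, H, hH, e⟩ := MaxOn.exchange hF hG hx' (by simp)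
    simp only [mem_compl_iff, mem_range, not_not] at hyr
    obtain ⟨y, rfl⟩ := hyr
    refine ⟨y, by simpa [mem_symmDiff] using hy, H, hH, ?_⟩
    ext z
    have := Set.ext_iff.1 e (f z)
    simpa [mem_symmDiff] using this

lemma restr_aux [Finite E] (f : E' ↪ E) (D : DeltaMatroid E) :
    (fun F => f ⁻¹' F) '' {F | D.MinOn (range f)ᶜ F} =
      ((D.twist (range f)ᶜ).contr f).feasible := by
  have e : ∀ F : Set E, f ⁻¹' (F ∆ (range f)ᶜ) = f ⁻¹' F := by
    intro F; ext z; simp [mem_symmDiff]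
  ext X
  constructor
  · rintro ⟨F, hF, rfl⟩
    exact ⟨_, minOn_iff.1 hF, e F⟩
  · rintro ⟨F, hF, rfl⟩
    refine ⟨F ∆ (range f)ᶜ, minOn_iff.2 ?_, e F⟩
    simpa [symmDiff_assoc] using hF

/-- Restriction to the range of an embedding, i.e. deletion of all elements outside the range,
relabelled along the embedding: the feasible sets of `D` with the fewest elements outside the
range are kept. -/
def restr [Finite E] (f : E' ↪ E) (D : DeltaMatroid E) : DeltaMatroid E' where
  feasible := (fun F => f ⁻¹' F) '' {F | D.MinOn (range f)ᶜ F}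
  nonempty := by rw [restr_aux]; exact DeltaMatroid.nonempty _
  exchange := by rw [restr_aux]; exact DeltaMatroid.exchange _

lemma restr_eq [Finite E] (f : E' ↪ E) (D : DeltaMatroid E) :
    D.restr f = (D.twist (range f)ᶜ).contr f := DeltaMatroid.ext (restr_aux f D)

/-- Contraction of a single element that is not a loop. -/
lemma contr_singleton [Finite E] (f : E' ↪ E) (D : DeltaMatroid E) {a : E}
    (hf : (range f)ᶜ = {a}) (h : ∃ B ∈ D.feasible, a ∈ B) :
    (D.contr f).feasible = (fun B => f ⁻¹' B) '' {B | B ∈ D.feasible ∧ a ∈ B} := by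
  obtain ⟨B, hB, haB⟩ := h
  have hc : ∀ F : Set E, (F ∩ {a}).ncard = 1 ↔ a ∈ F := fun F => by
    by_cases hF : a ∈ F <;> simp [hF]
  have hl : ∀ F : Set E, (F ∩ {a}).ncard ≤ 1 := fun F =>
    (Set.ncard_le_ncard Set.inter_subset_right (Set.toFinite _)).trans (by simp)
  refine congrArg (Set.image fun B => f ⁻¹' B) (Set.ext fun F => and_congr_right fun _ => ?_)
  rw [hf, ← hc F]
  refine ⟨fun H => le_antisymm (hl F) ?_, fun H G _ => H ▸ hl G⟩
  have := H B hB
  rwa [(hc B).2 haB] at this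

/-- Deletion of a single element that is not a coloop. -/
lemma restr_singleton [Finite E] (f : E' ↪ E) (D : DeltaMatroid E) {a : E}
    (hf : (range f)ᶜ = {a}) (h : ∃ B ∈ D.feasible, a ∉ B) :
    (D.restr f).feasible = (fun B => f ⁻¹' B) '' {B | B ∈ D.feasible ∧ a ∉ B} := by
  obtain ⟨B, hB, haB⟩ := h
  have hc : ∀ F : Set E, (F ∩ {a}).ncard = 0 ↔ a ∉ F := fun F => by
    by_cases hF : a ∈ F <;> simp [hF]
  refine congrArg (Set.image fun B => f ⁻¹' B) (Set.ext fun F => and_congr_right fun _ => ?_)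
  rw [hf, ← hc F]
  refine ⟨fun H => ?_, fun H G _ => H ▸ Nat.zero_le _⟩
  have := H B hB
  rw [(hc B).2 haB] at this
  exact Nat.le_zero.1 this

/-- The deletion and the contraction of a loop or a coloop are equal. -/
lemma contr_eq_restr_singleton [Finite E] (f : E' ↪ E) (D : DeltaMatroid E) {a : E}
    (hf : (range f)ᶜ = {a})
    (h : (∀ B ∈ D.feasible, a ∉ B) ∨ (∀ B ∈ D.feasible, a ∈ B)) :
    D.contr f = D.restr f := by
  refine DeltaMatroid.ext (congrArg (Set.image fun B => f ⁻¹' B) (Set.ext fun F => and_congr_right fun hF => ?_))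
  have e : ∀ G ∈ D.feasible, (G ∩ (range f)ᶜ).ncard = (F ∩ (range f)ᶜ).ncard := by
    intro G hG
    rw [hf]
    rcases h with h | h <;> simp [h G hG, h F hF]
  exact ⟨fun _ G hG => (e G hG).ge, fun _ G hG => (e G hG).le⟩

/-- Relabelling along a bijection. -/
def map (σ : E ≃ E') (D : DeltaMatroid E) : DeltaMatroid E' where
  feasible := {X | σ ⁻¹' X ∈ D.feasible}
  nonempty := by
    obtain ⟨F, hF⟩ := D.nonempty
    exact ⟨σ '' F, by simpa using hF⟩
  exchange := by
    intro X hX Y hY x hx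
    obtain ⟨y, hy, h⟩ := D.exchange _ hX _ hY (σ.symm x) (by simpa [mem_symmDiff] using hx)
    refine ⟨σ y, by simpa [mem_symmDiff] using hy, ?_⟩
    have e : σ ⁻¹' (X ∆ {x, σ y}) = (σ ⁻¹' X) ∆ {σ.symm x, y} := by
      ext z
      simp [mem_symmDiff, Equiv.eq_symm_apply]
    change σ ⁻¹' (X ∆ {x, σ y}) ∈ D.feasible
    rwa [e]

lemma twist_empty (D : DeltaMatroid E) : D.twist ∅ = D := by ext X; simp [symmDiff_def]

lemma map_eq [Finite E] (σ : E' ≃ E) (D : DeltaMatroid E) :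
    D.map σ.symm = (D.twist ∅).contr σ.toEmbedding := by
  rw [twist_empty]
  ext X
  constructor
  · intro h
    refine ⟨σ.symm ⁻¹' X, ⟨h, ?_⟩, ?_⟩
    · intro G _; simp
    · ext; simp
  · rintro ⟨F, hF, rfl⟩
    have : σ.symm ⁻¹' (σ.toEmbedding ⁻¹' F) = F := by ext; simp
    change σ.symm ⁻¹' (σ.toEmbedding ⁻¹' F) ∈ D.feasible
    rw [this]; exact hF.1

lemma ncard_split [Finite E] [Finite E'] (f : E' ↪ E) (F : Set E) (X : Set E') :
    (F ∩ (f '' X ∪ (range f)ᶜ)).ncard = (f ⁻¹' F ∩ X).ncard + (F ∩ (range f)ᶜ).ncard := by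
  rw [Set.inter_union_distrib_left, Set.ncard_union_eq ?_ (Set.toFinite _) (Set.toFinite _),
    ← Set.image_preimage_inter, Set.ncard_image_of_injective _ f.injective]
  refine Set.disjoint_left.2 ?_
  rintro x ⟨-, y, -, rfl⟩ ⟨-, h⟩
  exact h ⟨y, rfl⟩

lemma MaxOn.ncard_eq {D : DeltaMatroid E} {Y F G : Set E} (hF : D.MaxOn Y F)
    (hG : D.MaxOn Y G) : (F ∩ Y).ncard = (G ∩ Y).ncard :=
  le_antisymm (hG.2 F hF.1) (hF.2 G hG.1)

lemma contr_maxOn [Finite E] [Finite E'] {f : E' ↪ E} {D : DeltaMatroid E} {X : Set E'}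
    {F : Set E} (hF : D.MaxOn (range f)ᶜ F) (hF' : D.MaxOn (f '' X ∪ (range f)ᶜ) F) :
    (D.contr f).MaxOn X (f ⁻¹' F) := by
  refine ⟨⟨F, hF, rfl⟩, ?_⟩
  rintro _ ⟨G, hG, rfl⟩
  have h1 := hF'.2 G hG.1
  rw [ncard_split, ncard_split, hF.ncard_eq hG] at h1
  change (f ⁻¹' G ∩ X).ncard ≤ _
  omega

lemma maxOn_of_contr [Finite E] [Finite E'] {f : E' ↪ E} {D : DeltaMatroid E} {X : Set E'}
    {F : Set E} (hF : D.MaxOn (range f)ᶜ F) (h : (D.contr f).MaxOn X (f ⁻¹' F)) :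
    D.MaxOn (f '' X ∪ (range f)ᶜ) F := by
  refine hF.of_greedy Set.subset_union_right fun G hG => ?_
  have h1 : (f ⁻¹' G ∩ X).ncard ≤ (f ⁻¹' F ∩ X).ncard := h.2 _ ⟨G, hG, rfl⟩
  rw [ncard_split, ncard_split, hF.ncard_eq hG]
  omega

lemma contr_contr [Finite E] [Finite E'] (f : E' ↪ E) (g : E'' ↪ E') (D : DeltaMatroid E) :
    (D.contr f).contr g = D.contr (g.trans f) := by
  have hr : f '' (range g)ᶜ ∪ (range f)ᶜ = (range (g.trans f))ᶜ := by
    ext x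
    by_cases hx : ∃ y, f y = x
    · obtain ⟨y, rfl⟩ := hx
      simp
    · push Not at hx
      simp [hx]
  ext X
  constructor
  · rintro ⟨_, ⟨⟨F, hF, rfl⟩, h⟩, rfl⟩
    refine ⟨F, ?_, rfl⟩
    have := maxOn_of_contr (X := (range g)ᶜ) hF ⟨⟨F, hF, rfl⟩, h⟩
    rwa [hr] at this
  · rintro ⟨F, hF, rfl⟩
    have hF : D.MaxOn (range (g.trans f))ᶜ F := hF
    rw [← hr] at hF
    obtain ⟨F', e, h1, h2⟩ := hF.swap (Set.subset_union_right (s := f '' (range g)ᶜ))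
    refine ⟨f ⁻¹' F', contr_maxOn h2 h1, ?_⟩
    ext z
    have := Set.ext_iff.1 e (f (g z))
    simpa using this

lemma contr_twist [Finite E] (f : E' ↪ E) (D : DeltaMatroid E) (Z : Set E') :
    (D.contr f).twist Z = (D.twist (f '' Z)).contr f := by
  have hd : Disjoint (f '' Z) (range f)ᶜ :=
    Set.disjoint_compl_right_iff_subset.2 (Set.image_subset_range _ _)
  have e : ∀ F : Set E, f ⁻¹' (F ∆ (f '' Z)) = (f ⁻¹' F) ∆ Z := by
    intro F; ext z; simp [mem_symmDiff]
  ext X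
  constructor
  · rintro ⟨F, hF, h⟩
    refine ⟨F ∆ (f '' Z), (maxOn_twist hd).2 (by simpa [symmDiff_assoc] using hF), ?_⟩
    change f ⁻¹' F = _ at h
    change f ⁻¹' (F ∆ (f '' Z)) = X
    rw [e, h, symmDiff_assoc]; simp
  · rintro ⟨F, hF, rfl⟩
    exact ⟨F ∆ (f '' Z), (maxOn_twist hd).1 hF, e F⟩

/-- Composition of minors in normal form. -/
lemma minor_comp [Finite E] [Finite E'] (f : E' ↪ E) (g : E'' ↪ E') (D : DeltaMatroid E)
    (Z : Set E) (Z' : Set E') :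
    (((D.twist Z).contr f).twist Z').contr g = (D.twist (Z ∆ (f '' Z'))).contr (g.trans f) := by
  rw [contr_twist, twist_twist, contr_contr]

/-! ### Ranks of the upper matroid of a minor -/

lemma MaxOn.rk_upper [Finite E] {D : DeltaMatroid E} {Y F : Set E} (h : D.MaxOn Y F) :
    rk D.upper Y = (F ∩ Y).ncard := by
  have : D.upper.eRk Y = (F ∩ Y).ncard := by
    apply le_antisymm
    · rw [Matroid.eRk_le_iff]
      intro I hI hInd
      obtain ⟨G, hG, hIG⟩ := (D.upper_indep I).1 hInd
      rw [← (Set.toFinite I).cast_ncard_eq]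
      exact_mod_cast (Set.ncard_le_ncard (Set.subset_inter hIG hI) (Set.toFinite _)).trans
        (h.2 G hG)
    · rw [Matroid.le_eRk_iff]
      exact ⟨F ∩ Y, Set.inter_subset_right, (D.upper_indep _).2 ⟨F, h.1, Set.inter_subset_left⟩,
        ((Set.toFinite _).cast_ncard_eq).symm⟩
  rw [rk, this, ENat.toNat_natCast]

lemma rk_upper_twist [Finite E] (D : DeltaMatroid E) {Y Z : Set E} (h : Disjoint Z Y) :
    rk (D.twist Z).upper Y = rk D.upper Y := by
  obtain ⟨F, hF⟩ := (D.twist Z).exists_maxOn Y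
  rw [hF.rk_upper, ((maxOn_twist h).1 hF).rk_upper]
  congr 1
  ext x
  have := fun (a : x ∈ Z) => Set.disjoint_left.1 h a
  simp [mem_symmDiff]; tauto

lemma hasRk_upper_contr [Finite E] [Finite E'] (f : E' ↪ E) (D : DeltaMatroid E) :
    HasRk (D.contr f).upper f (range f)ᶜ D.upper := by
  intro X
  obtain ⟨F₀, h₀⟩ := D.exists_maxOn (f '' X ∪ (range f)ᶜ)
  obtain ⟨F, -, h1, h2⟩ := h₀.swap Set.subset_union_right
  rw [(contr_maxOn h2 h1).rk_upper, h2.rk_upper, h1.rk_upper, ncard_split]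

lemma isPersp_upper [Finite E] [Finite E'] {f : E' ↪ E} {D : DeltaMatroid E} {M : Matroid E}
    {M' : Matroid E'} {P Z : Set E} (h : IsPersp M D.upper) (hM : HasRk M' f P M)
    (hd : Disjoint P Z) (hR : P ∪ Z = (range f)ᶜ) :
    IsPersp M' ((D.twist Z).contr f).upper := by
  intro X Y hXY
  have hfd : ∀ W : Set E', Disjoint Z (f '' W ∪ P) := by
    intro W
    refine Set.disjoint_union_right.2 ⟨Set.disjoint_left.2 ?_, hd.symm⟩
    rintro _ hx ⟨y, -, rfl⟩
    have : f y ∈ (range f)ᶜ := hR ▸ Or.inr hx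
    exact this ⟨y, rfl⟩
  have h1 := h (f '' X ∪ P) (f '' Y ∪ P) (Set.union_subset_union_left _ (Set.image_mono hXY))
  rw [← rk_upper_twist D (hfd X), ← rk_upper_twist D (hfd Y)] at h1
  have h2 := hasRk_upper_contr f (D.twist Z) X
  have h3 := hasRk_upper_contr f (D.twist Z) Y
  have h4 := hM X
  have h5 := hM Y
  have h6 := rk_submod (D.twist Z).upper (f '' Y ∪ P) (f '' X ∪ (range f)ᶜ)
  rw [← hR] at h2 h3 h6
  have e1 : (f '' Y ∪ P) ∪ (f '' X ∪ (P ∪ Z)) = f '' Y ∪ (P ∪ Z) := by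
    ext z
    have := @hXY
    constructor
    · rintro ((h | h) | ⟨w, hw, rfl⟩ | h)
      · exact Or.inl h
      · exact Or.inr (Or.inl h)
      · exact Or.inl ⟨w, hXY hw, rfl⟩
      · exact Or.inr h
    · rintro (h | h)
      · exact Or.inl (Or.inl h)
      · exact Or.inr (Or.inr h)
  have e2 : f '' X ∪ P ⊆ (f '' Y ∪ P) ∩ (f '' X ∪ (P ∪ Z)) := by
    refine Set.subset_inter (Set.union_subset_union_left _ (Set.image_mono hXY)) ?_
    exact Set.union_subset_union_right _ Set.subset_union_left
  have h7 := rk_mono (D.twist Z).upper e2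
  rw [e1] at h6
  omega

lemma isPersp_lower [Finite E] [Finite E'] {f : E' ↪ E} {D : DeltaMatroid E} {M : Matroid E}
    {M' : Matroid E'} {P Z : Set E} (h : IsPersp D.lower M) (hM : HasRk M' f P M)
    (hE : M.E = univ) (hE' : M'.E = univ)
    (hd : Disjoint P Z) (hR : P ∪ Z = (range f)ᶜ) :
    IsPersp ((D.twist Z).contr f).lower M' := by
  have h1 := h.dual (by simp) hE
  rw [lower_eq, Matroid.dual_dual] at h1
  have h2 := isPersp_upper h1 (hM.dual hE hE' hd hR) hd.symm (by rwa [Set.union_comm])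
  have h3 := h2.dual (by simpa using hE') (by simp)
  rw [Matroid.dual_dual] at h3
  convert h3 using 1
  rw [lower_eq]
  congr 2
  rw [dual, contr_twist, dual, twist_twist, twist_twist]
  congr 2
  ext x
  have h1 := Set.ext_iff.1 hR x
  have h2 := fun (a : x ∈ P) => Set.disjoint_left.1 hd a
  simp only [mem_union, mem_compl_iff] at h1
  simp only [mem_symmDiff, image_univ, mem_univ, not_true_eq_false]
  tauto

/-- The upper and the lower matroid of a delta-matroid form a matroid perspective. -/
lemma isPersp_upper_lower [Finite E] (D : DeltaMatroid E) : IsPersp D.upper D.lower := by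
  intro X Y hXY
  set W := Yᶜ with hW
  have hdX : Disjoint W X := Set.disjoint_left.2 fun a ha hx => ha (hXY hx)
  obtain ⟨F₀, h₀⟩ := (D.twist W).exists_maxOn (X ∪ W)
  obtain ⟨F₁, e₁, -, h₁⟩ := h₀.swap (Set.subset_union_left (s := X) (t := W))
  obtain ⟨F₂, e₂, -, h₂⟩ := h₀.swap (Set.subset_union_right (s := X) (t := W))
  have h₁ := (maxOn_twist hdX).1 h₁
  have h₂ : D.dual.MaxOn W (F₂ ∆ Y) := by
    have : D.twist W = D.dual.twist Y := by
      rw [dual, twist_twist]; congr 1; ext x; simp [hW, mem_symmDiff]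
    rw [this] at h₂
    exact (maxOn_twist (disjoint_compl_right)).1 h₂
  -- rank estimates
  have r1 : ((F₁ ∆ W) ∩ Y).ncard ≤ rk D.upper Y := by
    obtain ⟨G, hG⟩ := D.exists_maxOn Y
    rw [hG.rk_upper]; exact hG.2 _ h₁.1
  have r2 : ((F₂ ∆ Y) ∩ Xᶜ).ncard ≤ rk D.dual.upper Xᶜ := by
    obtain ⟨G, hG⟩ := D.dual.exists_maxOn Xᶜ
    rw [hG.rk_upper]; exact hG.2 _ h₂.1
  have r3 := h₁.rk_upper
  have r4 := h₂.rk_upper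
  have hZ : ∀ x, x ∈ Y → x ∉ X → (x ∈ F₁ ↔ x ∈ F₂) := by
    intro x hy hx
    have h1 := Set.ext_iff.1 e₁ x
    have h2 := Set.ext_iff.1 e₂ x
    simp [hx, hW, hy] at h1 h2
    rw [h1, h2]
  have c1 : ((F₁ ∆ W) ∩ Y).ncard = ((F₁ ∆ W) ∩ X).ncard + (F₁ ∩ (Y \ X)).ncard := by
    rw [← Set.ncard_union_eq ?_ (Set.toFinite _) (Set.toFinite _)]
    · congr 1
      ext x
      have := @hXY x
      simp [mem_symmDiff, hW]; tauto
    · exact Set.disjoint_left.2 fun a ha hx => hx.2.2 ha.2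
  have c2 : ((F₂ ∆ Y) ∩ Xᶜ).ncard = ((F₂ ∆ Y) ∩ W).ncard + ((Y \ X) \ F₁).ncard := by
    rw [← Set.ncard_union_eq ?_ (Set.toFinite _) (Set.toFinite _)]
    · congr 1
      ext x
      have := @hXY x
      have := hZ x
      simp [mem_symmDiff, hW]; tauto
    · exact Set.disjoint_left.2 fun a ha hx => ha.2 hx.1.1
  have c3 := Set.ncard_inter_add_ncard_sdiff_eq_ncard (Y \ X) F₁ (Set.toFinite _)
  rw [Set.inter_comm] at c3
  have c4 := Set.ncard_sdiff_add_ncard_of_subset hXY (Set.toFinite _)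
  have d1 := rk_dual (M := D.dual.upper) (by simp) X
  have d2 := rk_dual (M := D.dual.upper) (by simp) Y
  rw [← lower_eq] at d1 d2
  rw [← hW] at d2
  omega

end DeltaMatroid

/-! ### Minors systems -/

/-- A minors system. A structure on a finite set `A ⊔ B` is written as a structure on `A ⊕ B`;
by functoriality in bijections this covers every decomposition of a finite set into two parts.
`res` is `X ↦ X|A`, `con` is `X ↦ X/A`, and `sum` is the direct sum with a structure on `∅`. -/
structure MinorsSystem where
  /-- structures on a finite set -/
  Str : (E : Type u) → [Finite E] → Type v
  /-- relabelling along a bijection -/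
  map : ∀ {E F : Type u} [Finite E] [Finite F], E ≃ F → Str E → Str F
  map_refl : ∀ {E : Type u} [Finite E] (X : Str E), map (Equiv.refl E) X = X
  map_trans : ∀ {E F G : Type u} [Finite E] [Finite F] [Finite G] (σ : E ≃ F) (τ : F ≃ G)
    (X : Str E), map (σ.trans τ) X = map τ (map σ X)
  /-- restriction to the first part -/
  res : ∀ {A B : Type u} [Finite A] [Finite B], Str (A ⊕ B) → Str A
  /-- contraction of the first part -/
  con : ∀ {A B : Type u} [Finite A] [Finite B], Str (A ⊕ B) → Str B
  /-- direct sum with a structure on the empty set -/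
  sum : ∀ {E : Type u} [Finite E], Str E → Str PEmpty.{u + 1} → Str E
  /-- the neutral element -/
  one : Str PEmpty.{u + 1}
  res_map : ∀ {A A' B B' : Type u} [Finite A] [Finite A'] [Finite B] [Finite B'] (σ : A ≃ A')
    (τ : B ≃ B') (X : Str (A ⊕ B)), res (map (Equiv.sumCongr σ τ) X) = map σ (res X)
  con_map : ∀ {A A' B B' : Type u} [Finite A] [Finite A'] [Finite B] [Finite B'] (σ : A ≃ A')
    (τ : B ≃ B') (X : Str (A ⊕ B)), con (map (Equiv.sumCongr σ τ) X) = map τ (con X)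
  res_res : ∀ {A B C : Type u} [Finite A] [Finite B] [Finite C] (X : Str ((A ⊕ B) ⊕ C)),
    res (res X) = res (map (Equiv.sumAssoc A B C) X)
  con_res : ∀ {A B C : Type u} [Finite A] [Finite B] [Finite C] (X : Str ((A ⊕ B) ⊕ C)),
    con (res X) = res (con (map (Equiv.sumAssoc A B C) X))
  con_con : ∀ {A B C : Type u} [Finite A] [Finite B] [Finite C] (X : Str ((A ⊕ B) ⊕ C)),
    con X = con (con (map (Equiv.sumAssoc A B C) X))
  res_empty : ∀ {E : Type u} [Finite E] (X : Str E),
    res (map (Equiv.sumEmpty E PEmpty.{u + 1}).symm X) = X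
  con_empty : ∀ {E : Type u} [Finite E] (X : Str E),
    con (map (Equiv.emptySum PEmpty.{u + 1} E).symm X) = X
  map_sum : ∀ {E F : Type u} [Finite E] [Finite F] (σ : E ≃ F) (X : Str E)
    (Y : Str PEmpty.{u + 1}), map σ (sum X Y) = sum (map σ X) Y
  sum_assoc : ∀ {E : Type u} [Finite E] (X : Str E) (Y Z : Str PEmpty.{u + 1}),
    sum X (sum Y Z) = sum (sum X Y) Z
  sum_comm : ∀ X Y : Str PEmpty.{u + 1}, sum X Y = sum Y X
  sum_one : ∀ {E : Type u} [Finite E] (X : Str E), sum X one = X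
  res_sum : ∀ {A B : Type u} [Finite A] [Finite B] (X : Str (A ⊕ B)) (Y : Str PEmpty.{u + 1}),
    res (sum X Y) = sum (res X) Y
  con_sum : ∀ {A B : Type u} [Finite A] [Finite B] (X : Str (A ⊕ B)) (Y : Str PEmpty.{u + 1}),
    con (sum X Y) = sum (con X) Y

/-- The free commutative monoid, written multiplicatively. -/
abbrev FreeCommMonoid (α : Type*) := Multiplicative (α →₀ ℕ)

namespace FreeCommMonoid

/-- The generators of the free commutative monoid. -/
noncomputable def of {α : Type*} (a : α) : FreeCommMonoid α :=
  Multiplicative.ofAdd (Finsupp.single a 1)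

/-- The universal property of the free commutative monoid. -/
noncomputable def lift {α M : Type*} [CommMonoid M] (f : α → M) : FreeCommMonoid α →* M :=
  AddMonoidHom.toMultiplicativeLeft
    (Finsupp.liftAddHom fun a => multiplesHom (Additive M) (Additive.ofMul (f a)))

@[simp] lemma lift_of {α M : Type*} [CommMonoid M] (f : α → M) (a : α) :
    lift f (of a) = f a := by
  simp [lift, of]

end FreeCommMonoid

/-- The commutative monoid with a given set of generators and given relations. -/
abbrev PresentedCommMonoid {α : Type*} (r : FreeCommMonoid α → FreeCommMonoid α → Prop) :=
  (conGen r).Quotient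

/-- A generator of a presented commutative monoid. -/
noncomputable def PresentedCommMonoid.of {α : Type*}
    (r : FreeCommMonoid α → FreeCommMonoid α → Prop) (a : α) : PresentedCommMonoid r :=
  (FreeCommMonoid.of a : FreeCommMonoid α)

namespace MinorsSystem
variable (S : MinorsSystem.{u, v})

/-- The restriction `X|A`. -/
noncomputable def restrict {E : Type u} [Finite E] (X : S.Str E) (A : Set E) : S.Str A := by
  classical exact S.res (S.map (Equiv.Set.sumCompl A).symm X)

/-- The contraction `X/A`. -/
noncomputable def contract {E : Type u} [Finite E] (X : S.Str E) (A : Set E) :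
    S.Str (Aᶜ : Set E) := by
  classical exact S.con (S.map (Equiv.Set.sumCompl A).symm X)

/-- The contraction `X/E` of the whole ground set, a structure on the empty set. -/
def contractAll {E : Type u} [Finite E] (X : S.Str E) : S.Str PEmpty.{u + 1} :=
  S.con (S.map (Equiv.sumEmpty E PEmpty.{u + 1}).symm X)

/-- Structures on the empty set form a commutative monoid under direct sum. -/
instance : CommMonoid (S.Str PEmpty.{u + 1}) where
  mul := S.sum
  one := S.one
  mul_assoc X Y Z := (S.sum_assoc X Y Z).symm
  mul_comm := S.sum_comm
  mul_one X := S.sum_one X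
  one_mul X := (S.sum_comm _ _).trans (S.sum_one X)

/-- All structures on all finite sets. -/
abbrev Total := Σ E : {E : Type u // Finite E}, @MinorsSystem.Str S E.1 E.2

/-- A structure, together with its ground set. -/
def toTotal {E : Type u} [h : Finite E] (X : S.Str E) : S.Total := ⟨⟨E, h⟩, X⟩

/-- Two structures are isomorphic if a bijection of the ground sets maps one to the other. -/
def Iso (X Y : S.Total) : Prop :=
  ∃ σ : X.1.1 ≃ Y.1.1, @MinorsSystem.map S _ _ X.1.2 Y.1.2 σ X.2 = Y.2

/-- The setoid of isomorphism. -/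
def isoSetoid : Setoid S.Total where
  r := S.Iso
  iseqv := by
    refine ⟨?_, ?_, ?_⟩
    · rintro ⟨⟨E, hE⟩, X⟩
      exact ⟨Equiv.refl E, S.map_refl X⟩
    · rintro ⟨⟨E, hE⟩, X⟩ ⟨⟨F, hF⟩, Y⟩ ⟨σ, h⟩
      refine ⟨σ.symm, ?_⟩
      dsimp only at h σ ⊢
      rw [← h, ← S.map_trans, Equiv.self_trans_symm, S.map_refl]
    · rintro ⟨⟨E, hE⟩, X⟩ ⟨⟨F, hF⟩, Y⟩ ⟨⟨G, hG⟩, Z⟩ ⟨σ, h⟩ ⟨τ, h'⟩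
      refine ⟨σ.trans τ, ?_⟩
      dsimp only at h h' σ τ ⊢
      rw [S.map_trans, h, h']

/-- Isomorphism classes of structures. -/
abbrev IsoClass := Quotient S.isoSetoid

/-- The isomorphism class of a structure. -/
def isoClass {E : Type u} [Finite E] (X : S.Str E) : S.IsoClass :=
  Quotient.mk S.isoSetoid (S.toTotal X)

/-- The defining relations of the Grothendieck monoid. -/
inductive GrothRel : FreeCommMonoid S.IsoClass → FreeCommMonoid S.IsoClass → Prop
  | mul {E : Type u} [Finite E] (X : S.Str E) (A : Set E) :
      GrothRel (.of (S.isoClass X))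
        (.of (S.isoClass (S.restrict X A)) * .of (S.isoClass (S.contract X A)))
  | sum {E : Type u} [Finite E] (X : S.Str E) (Y : S.Str PEmpty.{u + 1}) :
      GrothRel (.of (S.isoClass (S.sum X Y))) (.of (S.isoClass X))
  | one : GrothRel (.of (S.isoClass S.one)) 1

/-- The Grothendieck monoid `U(S)`. -/
abbrev Groth := PresentedCommMonoid S.GrothRel

/-- The class `[X]` of a structure in the Grothendieck monoid. -/
noncomputable def cls {E : Type u} [Finite E] (X : S.Str E) : S.Groth :=
  PresentedCommMonoid.of S.GrothRel (S.isoClass X)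

/-- A norm for a minors system with values in a commutative monoid. -/
structure Norm (U : Type*) [CommMonoid U] where
  toFun : ∀ {E : Type u} [Finite E], S.Str E → U
  map' : ∀ {E F : Type u} [Finite E] [Finite F] (σ : E ≃ F) (X : S.Str E),
    toFun (S.map σ X) = toFun X
  mul' : ∀ {E : Type u} [Finite E] (X : S.Str E) (A : Set E),
    toFun X = toFun (S.restrict X A) * toFun (S.contract X A)
  sum' : ∀ {E : Type u} [Finite E] (X : S.Str E) (Y : S.Str PEmpty.{u + 1}),
    toFun (S.sum X Y) = toFun X
  one' : toFun S.one = 1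

variable {S}

/-- The composition of a norm with a morphism of monoids. -/
def Norm.comp {U V : Type*} [CommMonoid U] [CommMonoid V] (N : S.Norm U) (f : U →* V) :
    S.Norm V where
  toFun X := f (N.toFun X)
  map' σ X := by rw [N.map']
  mul' X A := by rw [N.mul' X A, map_mul]
  sum' X Y := by rw [N.sum']
  one' := by rw [N.one', map_one]

variable (S) in
/-- The universal norm `X ↦ [X]`. -/
noncomputable def universalNorm : S.Norm S.Groth where
  toFun X := S.cls X
  map' {E F} _ _ σ X := by
    have : S.isoClass (S.map σ X) = S.isoClass X :=
      (Quotient.sound (s := S.isoSetoid) ⟨σ, rfl⟩ :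
        Quotient.mk S.isoSetoid (S.toTotal X) = Quotient.mk _ (S.toTotal (S.map σ X))).symm
    simp [cls, this]
  mul' X A := (Con.eq _).2 (ConGen.Rel.of _ _ (GrothRel.mul X A))
  sum' X Y := (Con.eq _).2 (ConGen.Rel.of _ _ (GrothRel.sum X Y))
  one' := (Con.eq _).2 (ConGen.Rel.of _ _ GrothRel.one)

/-- The morphism of monoids out of the Grothendieck monoid induced by a norm. -/
noncomputable def Norm.lift {U : Type*} [CommMonoid U] (N : S.Norm U) : S.Groth →* U :=
  Con.lift (conGen S.GrothRel)
    (FreeCommMonoid.lift fun c : S.IsoClass =>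
      Quotient.lift (s := S.isoSetoid) (fun X : S.Total => @Norm.toFun _ _ _ N X.1.1 X.1.2 X.2)
        (by
          rintro ⟨⟨E, hE⟩, X⟩ ⟨⟨F, hF⟩, Y⟩ ⟨σ, h⟩
          dsimp only at h σ ⊢
          rw [← h, N.map']) c)
    (Con.conGen_le.2 (by
      rintro _ _ h
      rw [Con.ker_rel]
      cases h with
      | mul X A => simp only [map_mul, map_one, FreeCommMonoid.lift_of]; exact N.mul' X A
      | sum X Y => simp only [map_mul, map_one, FreeCommMonoid.lift_of]; exact N.sum' X Y
      | one => simp only [map_mul, map_one, FreeCommMonoid.lift_of]; exact N.one'))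

lemma Norm.lift_cls {U : Type*} [CommMonoid U] (N : S.Norm U) {E : Type u} [Finite E]
    (X : S.Str E) : N.lift (S.cls X) = N.toFun X := by
  change FreeCommMonoid.lift _ (FreeCommMonoid.of _) = _
  rw [FreeCommMonoid.lift_of]
  rfl

/-- The Tutte character associated to two norms and a twist map (its values on structures;
it extends linearly to formal combinations of structures). -/
noncomputable def tutteChar {R : Type*} [CommRing R] (N₁ : S.Norm R)
    (τ : S.Str PEmpty.{u + 1} →* R) (N₂ : S.Norm R) {E : Type u} [Finite E] (X : S.Str E) : R :=
  ∑ᶠ A : Set E, N₁.toFun (S.restrict X A) * τ (S.contractAll (S.restrict X A)) *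
    N₂.toFun (S.contract X A)

variable (S) in
/-- The ring in which the universal Tutte character takes its values. -/
abbrev UnivRing (K : Type*) [CommRing K] :=
  MonoidAlgebra K (S.Groth × S.Str PEmpty.{u + 1} × S.Groth)

/-- The universal Tutte character. -/
noncomputable def universalTutte (K : Type*) [CommRing K] {E : Type u} [Finite E] (X : S.Str E) :
    S.UnivRing K :=
  tutteChar
    (S.universalNorm.comp ((MonoidAlgebra.of K _).comp (MonoidHom.inl _ _)))
    ((MonoidAlgebra.of K _).comp ((MonoidHom.inr _ _).comp (MonoidHom.inl _ _)))
    (S.universalNorm.comp ((MonoidAlgebra.of K _).comp ((MonoidHom.inr _ _).comp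
      (MonoidHom.inr _ _)))) X

/-- A morphism of minors systems. -/
structure Hom (S T : MinorsSystem.{u, v}) where
  toFun : ∀ {E : Type u} [Finite E], S.Str E → T.Str E
  map' : ∀ {E F : Type u} [Finite E] [Finite F] (σ : E ≃ F) (X : S.Str E),
    toFun (S.map σ X) = T.map σ (toFun X)
  res' : ∀ {A B : Type u} [Finite A] [Finite B] (X : S.Str (A ⊕ B)),
    toFun (S.res X) = T.res (toFun X)
  con' : ∀ {A B : Type u} [Finite A] [Finite B] (X : S.Str (A ⊕ B)),
    toFun (S.con X) = T.con (toFun X)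
  sum' : ∀ {E : Type u} [Finite E] (X : S.Str E) (Y : S.Str PEmpty.{u + 1}),
    toFun (S.sum X Y) = T.sum (toFun X) (toFun Y)
  one' : toFun S.one = T.one

/-- The pull-back of a norm along a morphism. -/
def Norm.pullback {S T : MinorsSystem.{u, v}} {U : Type*} [CommMonoid U] (N : T.Norm U)
    (f : Hom S T) : S.Norm U where
  toFun X := N.toFun (f.toFun X)
  map' σ X := by rw [f.map', N.map']
  mul' X A := by
    rw [N.mul' _ A]
    simp only [restrict, contract, f.res', f.con', f.map']
  sum' X Y := by rw [f.sum', N.sum']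
  one' := by rw [f.one', N.one']

/-- The morphism of Grothendieck monoids induced by a morphism of minors systems,
`[X] ↦ [f X]`. -/
noncomputable def Hom.groth {S T : MinorsSystem.{u, v}} (f : Hom S T) : S.Groth →* T.Groth :=
  (T.universalNorm.pullback f).lift

end MinorsSystem

/-! ### The minors systems of delta-matroids, matroid perspectives, and delta-matroid
perspectives -/

open Function.Embedding (inl inr)

/-- A matroid perspective `(M, N)` on the ground set `E`. -/
@[ext]
structure MatPer (E : Type u) where
  M : Matroid E
  N : Matroid E
  ground_M : M.E = univ
  ground_N : N.E = univ
  persp : IsPersp M N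

/-- A delta-matroid perspective `(M, D, N)` on the ground set `E`. -/
@[ext]
structure DeltaMatPer (E : Type u) [Finite E] where
  M : Matroid E
  D : DeltaMatroid E
  N : Matroid E
  ground_M : M.E = univ
  ground_N : N.E = univ
  persp_upper : IsPersp M D.upper
  persp_lower : IsPersp D.lower N

section ops
variable {E F A B : Type u} [Finite E] [Finite F] [Finite A] [Finite B]

namespace MatPer

/-- Relabelling. -/
def map (σ : E ≃ F) (X : MatPer E) : MatPer F where
  M := X.M.mapEquiv σ
  N := X.N.mapEquiv σ
  ground_M := mapEquiv_ground X.ground_M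
  ground_N := mapEquiv_ground X.ground_N
  persp := X.persp.minor (hasRk_mapEquiv σ.symm X.M X.ground_M)
    (hasRk_mapEquiv σ.symm X.N X.ground_N)

/-- Restriction, componentwise. -/
def res (X : MatPer (A ⊕ B)) : MatPer A where
  M := matRestr inl X.M
  N := matRestr inl X.N
  ground_M := matRestr_ground X.ground_M
  ground_N := matRestr_ground X.ground_N
  persp := X.persp.minor (hasRk_matRestr _ _) (hasRk_matRestr _ _)

/-- Contraction, componentwise. -/
def con (X : MatPer (A ⊕ B)) : MatPer B where
  M := matContr inr X.M
  N := matContr inr X.N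
  ground_M := matContr_ground X.ground_M
  ground_N := matContr_ground X.ground_N
  persp := X.persp.minor (hasRk_matContr _ X.ground_M) (hasRk_matContr _ X.ground_N)

/-- `X'` has the rank functions of the minor of `X` in which `P` is contracted. -/
def IsMinor (X' : MatPer F) (f : F ↪ E) (P : Set E) (X : MatPer E) : Prop :=
  HasRk X'.M f P X.M ∧ HasRk X'.N f P X.N

lemma isMinor_map (σ : E ≃ F) (X : MatPer E) :
    IsMinor (map σ X) σ.symm.toEmbedding ∅ X :=
  ⟨hasRk_mapEquiv σ.symm X.M X.ground_M, hasRk_mapEquiv σ.symm X.N X.ground_N⟩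

lemma isMinor_refl (X : MatPer E) : IsMinor X (Function.Embedding.refl E) ∅ X :=
  ⟨fun Y => by simp [rk_empty], fun Y => by simp [rk_empty]⟩

lemma isMinor_res (X : MatPer (A ⊕ B)) : IsMinor (res X) inl ∅ X :=
  ⟨hasRk_matRestr _ _, hasRk_matRestr _ _⟩

lemma isMinor_con (X : MatPer (A ⊕ B)) : IsMinor (con X) inr (range inr)ᶜ X :=
  ⟨hasRk_matContr _ X.ground_M, hasRk_matContr _ X.ground_N⟩

lemma IsMinor.comp {X : MatPer E} {X' : MatPer F} {X'' : MatPer A} {f : F ↪ E} {g : A ↪ F}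
    {P : Set E} {P' : Set F} (h' : IsMinor X'' g P' X') (h : IsMinor X' f P X) :
    IsMinor X'' (g.trans f) (f '' P' ∪ P) X := ⟨h.1.comp h'.1, h.2.comp h'.2⟩

lemma IsMinor.unique {X : MatPer E} {X' Y' : MatPer F} {f g : F ↪ E} {P Q : Set E}
    (h : IsMinor X' f P X) (h' : IsMinor Y' g Q X) (hf : f = g) (hP : P = Q) : X' = Y' :=
  MatPer.ext (h.1.unique h'.1 hf hP X'.ground_M Y'.ground_M)
    (h.2.unique h'.2 hf hP X'.ground_N Y'.ground_N)

end MatPer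

namespace DeltaMatPer

/-- Relabelling. -/
def map (σ : E ≃ F) (X : DeltaMatPer E) : DeltaMatPer F where
  M := X.M.mapEquiv σ
  D := X.D.map σ
  N := X.N.mapEquiv σ
  ground_M := mapEquiv_ground X.ground_M
  ground_N := mapEquiv_ground X.ground_N
  persp_upper := by
    have h := DeltaMatroid.map_eq σ.symm X.D
    rw [Equiv.symm_symm] at h
    rw [h]
    exact DeltaMatroid.isPersp_upper X.persp_upper (hasRk_mapEquiv σ.symm X.M X.ground_M)
      (by simp) (by simp)
  persp_lower := by
    have h := DeltaMatroid.map_eq σ.symm X.D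
    rw [Equiv.symm_symm] at h
    rw [h]
    exact DeltaMatroid.isPersp_lower X.persp_lower (hasRk_mapEquiv σ.symm X.N X.ground_N)
      X.ground_N (mapEquiv_ground X.ground_N) (by simp) (by simp)

/-- Restriction, componentwise. -/
def res (X : DeltaMatPer (A ⊕ B)) : DeltaMatPer A where
  M := matRestr inl X.M
  D := X.D.restr inl
  N := matRestr inl X.N
  ground_M := matRestr_ground X.ground_M
  ground_N := matRestr_ground X.ground_N
  persp_upper := by
    rw [DeltaMatroid.restr_eq]
    exact DeltaMatroid.isPersp_upper X.persp_upper (hasRk_matRestr _ _) (by simp) (by simp)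
  persp_lower := by
    rw [DeltaMatroid.restr_eq]
    exact DeltaMatroid.isPersp_lower X.persp_lower (hasRk_matRestr _ _) X.ground_N
      (matRestr_ground X.ground_N) (by simp) (by simp)

/-- Contraction, componentwise. -/
def con (X : DeltaMatPer (A ⊕ B)) : DeltaMatPer B where
  M := matContr inr X.M
  D := X.D.contr inr
  N := matContr inr X.N
  ground_M := matContr_ground X.ground_M
  ground_N := matContr_ground X.ground_N
  persp_upper := by
    rw [← X.D.twist_empty]
    exact DeltaMatroid.isPersp_upper X.persp_upper (hasRk_matContr _ X.ground_M) (by simp)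
      (by simp)
  persp_lower := by
    rw [← X.D.twist_empty]
    exact DeltaMatroid.isPersp_lower X.persp_lower (hasRk_matContr _ X.ground_N) X.ground_N
      (matContr_ground X.ground_N) (by simp) (by simp)

/-- The matroid perspective `(M, N)` of a delta-matroid perspective `(M, D, N)`. -/
def toMatPer (X : DeltaMatPer E) : MatPer E where
  M := X.M
  N := X.N
  ground_M := X.ground_M
  ground_N := X.ground_N
  persp := (X.persp_upper.trans X.D.isPersp_upper_lower).trans X.persp_lower

lemma ext' {X Y : DeltaMatPer E} (h : X.toMatPer = Y.toMatPer) (hD : X.D = Y.D) : X = Y :=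
  DeltaMatPer.ext (congrArg MatPer.M h) hD (congrArg MatPer.N h)

end DeltaMatPer
end ops

namespace DeltaMatroid
variable {E F A B C : Type u} [Finite E] [Finite F] [Finite A] [Finite B] [Finite C]

/-- Normal form of a minor of a delta-matroid. -/
def IsMinor (D' : DeltaMatroid F) (f : F ↪ E) (Z : Set E) (D : DeltaMatroid E) : Prop :=
  D' = (D.twist Z).contr f

lemma isMinor_map (σ : E ≃ F) (D : DeltaMatroid E) :
    IsMinor (D.map σ) σ.symm.toEmbedding ∅ D := map_eq σ.symm D

lemma isMinor_refl (D : DeltaMatroid E) : IsMinor D (Function.Embedding.refl E) ∅ D := by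
  have h := map_eq (Equiv.refl E) D
  have e : D.map (Equiv.refl E).symm = D := rfl
  rw [e] at h
  exact h

lemma isMinor_res (D : DeltaMatroid (A ⊕ B)) :
    IsMinor (D.restr (inl : A ↪ A ⊕ B)) inl (range inl)ᶜ D := restr_eq _ _

lemma isMinor_con (D : DeltaMatroid (A ⊕ B)) :
    IsMinor (D.contr (inr : B ↪ A ⊕ B)) inr ∅ D := by
  rw [IsMinor, twist_empty]

lemma IsMinor.comp {D : DeltaMatroid E} {D' : DeltaMatroid F} {D'' : DeltaMatroid A} {f : F ↪ E}
    {g : A ↪ F} {Z : Set E} {Z' : Set F} (h' : IsMinor D'' g Z' D') (h : IsMinor D' f Z D) :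
    IsMinor D'' (g.trans f) (Z ∆ (f '' Z')) D := by
  rw [IsMinor, ← minor_comp, ← h]; exact h'

lemma IsMinor.unique {D : DeltaMatroid E} {D' D'' : DeltaMatroid F} {f g : F ↪ E} {P Q : Set E}
    (h : IsMinor D' f P D) (h' : IsMinor D'' g Q D) (hf : f = g) (hP : P = Q) : D' = D'' := by
  subst hf hP; rw [h, h']

end DeltaMatroid

/-- The minors system of delta-matroids. Being connected, it has only one possible direct sum
with structures on the empty set. -/
def deltaMat : MinorsSystem.{u, u} where
  Str E _ := DeltaMatroid E
  map σ D := D.map σ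
  map_refl D := rfl
  map_trans σ τ D := rfl
  res D := D.restr inl
  con D := D.contr inr
  sum D _ := D
  one := ⟨univ, ⟨∅, trivial⟩, fun _ _ _ _ x => x.elim⟩
  res_map σ τ D := by
    refine ((D.map _).isMinor_res.comp (D.isMinor_map _)).unique
      ((D.restr inl).isMinor_map σ |>.comp D.isMinor_res) ?_ ?_
    · ext x; rfl
    · ext (x | x)
      · simpa [mem_symmDiff] using σ.symm.surjective x
      · simpa [mem_symmDiff] using τ.symm.surjective x
  con_map σ τ D := by
    refine ((D.map _).isMinor_con.comp (D.isMinor_map _)).unique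
      ((D.contr inr).isMinor_map τ |>.comp D.isMinor_con) ?_ ?_
    · ext x; rfl
    · ext (x | x)
      · simpa [mem_symmDiff] using σ.symm.surjective x
      · simpa [mem_symmDiff] using τ.symm.surjective x
  res_res D := by
    refine ((D.restr inl).isMinor_res.comp D.isMinor_res).unique
      ((D.map _).isMinor_res.comp (D.isMinor_map _)) ?_ ?_
    · ext x; rfl
    · ext ((x | x) | x) <;> simp [mem_symmDiff]
  con_res D := by
    refine ((D.restr inl).isMinor_con.comp D.isMinor_res).unique
      ((((D.map _).contr inr).isMinor_res.comp (D.map _).isMinor_con).comp (D.isMinor_map _)) ?_ ?_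
    · ext x; rfl
    · ext ((x | x) | x) <;> simp [mem_symmDiff]
  con_con D := by
    refine D.isMinor_con.unique
      ((((D.map _).contr inr).isMinor_con.comp (D.map _).isMinor_con).comp (D.isMinor_map _)) ?_ ?_
    · ext x; rfl
    · ext ((x | x) | x) <;> simp [mem_symmDiff]
  res_empty D := by
    refine ((D.map _).isMinor_res.comp (D.isMinor_map _)).unique D.isMinor_refl ?_ ?_
    · ext x; rfl
    · ext x; simp [mem_symmDiff]
  con_empty D := by
    refine ((D.map _).isMinor_con.comp (D.isMinor_map _)).unique D.isMinor_refl ?_ ?_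
    · ext x; rfl
    · ext x; simp [mem_symmDiff]
  map_sum _ _ _ := rfl
  sum_assoc _ _ _ := rfl
  sum_comm D D' := by
    ext X
    have h : ∀ D : DeltaMatroid PEmpty, X ∈ D.feasible := fun D => by
      obtain ⟨Y, hY⟩ := D.nonempty
      rwa [Subsingleton.elim X Y]
    exact ⟨fun _ => h _, fun _ => h _⟩
  sum_one _ := rfl
  res_sum _ _ := rfl
  con_sum _ _ := rfl

/-- The minors system of matroid perspectives. -/
def matPer : MinorsSystem.{u, u} where
  Str E _ := MatPer E
  map σ X := X.map σ
  map_refl X := (X.isMinor_map _).unique X.isMinor_refl rfl rfl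
  map_trans σ τ X := (X.isMinor_map _).unique (((X.map σ).isMinor_map τ).comp (X.isMinor_map σ))
    (by ext; rfl) (by simp)
  res X := X.res
  con X := X.con
  sum X _ := X
  one := ⟨Matroid.emptyOn _, Matroid.emptyOn _, by ext x; exact x.elim, by ext x; exact x.elim,
    fun _ _ _ => le_rfl⟩
  res_map σ τ D := by
    refine ((D.map _).isMinor_res.comp (D.isMinor_map _)).unique
      (D.res.isMinor_map σ |>.comp D.isMinor_res) ?_ ?_
    · ext x; rfl
    · ext (x | x)
      · simpa using σ.symm.surjective x
      · simpa using τ.symm.surjective x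
  con_map σ τ D := by
    refine ((D.map _).isMinor_con.comp (D.isMinor_map _)).unique
      (D.con.isMinor_map τ |>.comp D.isMinor_con) ?_ ?_
    · ext x; rfl
    · ext (x | x)
      · simpa using σ.symm.surjective x
      · simpa using τ.symm.surjective x
  res_res D := by
    refine (D.res.isMinor_res.comp D.isMinor_res).unique
      ((D.map _).isMinor_res.comp (D.isMinor_map _)) ?_ ?_
    · ext x; rfl
    · ext ((x | x) | x) <;> simp
  con_res D := by
    refine (D.res.isMinor_con.comp D.isMinor_res).unique
      (((D.map _).con.isMinor_res.comp (D.map _).isMinor_con).comp (D.isMinor_map _)) ?_ ?_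
    · ext x; rfl
    · ext ((x | x) | x) <;> simp
  con_con D := by
    refine D.isMinor_con.unique
      (((D.map _).con.isMinor_con.comp (D.map _).isMinor_con).comp (D.isMinor_map _)) ?_ ?_
    · ext x; rfl
    · ext ((x | x) | x) <;> simp
  res_empty D := by
    refine ((D.map _).isMinor_res.comp (D.isMinor_map _)).unique D.isMinor_refl ?_ ?_
    · ext x; rfl
    · ext x; simp
  con_empty D := by
    refine ((D.map _).isMinor_con.comp (D.isMinor_map _)).unique D.isMinor_refl ?_ ?_
    · ext x; rfl
    · ext x; simp
  map_sum _ _ _ := rfl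
  sum_assoc _ _ _ := rfl
  sum_comm X Y := by
    have h : ∀ {M N : Matroid PEmpty}, M.E = univ → N.E = univ → M = N := fun hM hN =>
      ext_rk hM hN fun Z => by rw [Subsingleton.elim Z ∅, rk_empty, rk_empty]
    exact MatPer.ext (h X.ground_M Y.ground_M) (h X.ground_N Y.ground_N)
  sum_one _ := rfl
  res_sum _ _ := rfl
  con_sum _ _ := rfl

/-- The minors system of delta-matroid perspectives. -/
def deltaMatPer : MinorsSystem.{u, u} where
  Str E _ := DeltaMatPer E
  map σ X := X.map σ
  map_refl X := DeltaMatPer.ext' (matPer.map_refl X.toMatPer) (deltaMat.map_refl X.D)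
  map_trans σ τ X :=
    DeltaMatPer.ext' (matPer.map_trans σ τ X.toMatPer) (deltaMat.map_trans σ τ X.D)
  res X := X.res
  con X := X.con
  sum X _ := X
  one :=
    { M := Matroid.emptyOn _
      D := deltaMat.one
      N := Matroid.emptyOn _
      ground_M := by ext x; exact x.elim
      ground_N := by ext x; exact x.elim
      persp_upper := fun X Y _ => by rw [Subsingleton.elim X Y, add_comm]
      persp_lower := fun X Y _ => by rw [Subsingleton.elim X Y, add_comm] }
  res_map σ τ X :=
    DeltaMatPer.ext' (matPer.res_map σ τ X.toMatPer) (deltaMat.res_map σ τ X.D)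
  con_map σ τ X :=
    DeltaMatPer.ext' (matPer.con_map σ τ X.toMatPer) (deltaMat.con_map σ τ X.D)
  res_res X := DeltaMatPer.ext' (matPer.res_res X.toMatPer) (deltaMat.res_res X.D)
  con_res X := DeltaMatPer.ext' (matPer.con_res X.toMatPer) (deltaMat.con_res X.D)
  con_con X := DeltaMatPer.ext' (matPer.con_con X.toMatPer) (deltaMat.con_con X.D)
  res_empty X := DeltaMatPer.ext' (matPer.res_empty X.toMatPer) (deltaMat.res_empty X.D)
  con_empty X := DeltaMatPer.ext' (matPer.con_empty X.toMatPer) (deltaMat.con_empty X.D)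
  map_sum _ _ _ := rfl
  sum_assoc _ _ _ := rfl
  sum_comm X Y :=
    DeltaMatPer.ext' (matPer.sum_comm X.toMatPer Y.toMatPer) (deltaMat.sum_comm X.D Y.D)
  sum_one _ := rfl
  res_sum _ _ := rfl
  con_sum _ _ := rfl

/-- The morphism of minors systems `(M, D, N) ↦ (M, N)`. -/
def homMatPer : MinorsSystem.Hom deltaMatPer.{u} matPer.{u} where
  toFun X := DeltaMatPer.toMatPer X
  map' _ _ := rfl
  res' _ := rfl
  con' _ := rfl
  sum' _ _ := rfl
  one' := rfl

/-- The morphism of minors systems `(M, D, N) ↦ D`. -/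
def homDeltaMat : MinorsSystem.Hom deltaMatPer.{u} deltaMat.{u} where
  toFun X := DeltaMatPer.D X
  map' _ _ := rfl
  res' _ := rfl
  con' _ := rfl
  sum' _ _ := rfl
  one' := rfl

/-! ### One-element structures -/

/-- The coloop on a one-element set. -/
def coloopMat : Matroid PUnit.{u + 1} := Matroid.freeOn univ

/-- The loop on a one-element set. -/
def loopMat : Matroid PUnit.{u + 1} := Matroid.loopyOn univ

lemma punit_subset_iff {X Y : Set PUnit.{u + 1}} (h : X ⊆ Y) :
    X = Y ∨ (X = ∅ ∧ Y = univ) := by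
  rcases X.eq_empty_or_nonempty with hX | hX
  · rcases Y.eq_empty_or_nonempty with hY | hY
    · exact Or.inl (hX.trans hY.symm)
    · exact Or.inr ⟨hX, Subsingleton.eq_univ_of_nonempty hY⟩
  · left
    rw [Subsingleton.eq_univ_of_nonempty hX, Subsingleton.eq_univ_of_nonempty (hX.mono h)]

/-- The three delta-matroids on a one-element set: the coloop `c`, with feasible set `{e}`. -/
def coloopDelta : DeltaMatroid PUnit.{u + 1} where
  feasible := {univ}
  nonempty := ⟨_, rfl⟩
  exchange := by rintro _ rfl _ rfl x hx; simp at hx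

/-- The loop `l`, with feasible set `∅`. -/
def loopDelta : DeltaMatroid PUnit.{u + 1} where
  feasible := {∅}
  nonempty := ⟨_, rfl⟩
  exchange := by rintro _ rfl _ rfl x hx; simp at hx

/-- The delta-matroid `n`, with feasible sets `∅` and `{e}`. -/
def bothDelta : DeltaMatroid PUnit.{u + 1} where
  feasible := {∅, univ}
  nonempty := ⟨∅, Or.inl rfl⟩
  exchange := by
    intro X _ Y _ x hx
    refine ⟨x, hx, ?_⟩
    rcases Set.eq_empty_or_nonempty (X ∆ {x, x}) with h | h
    · exact Or.inl h
    · exact Or.inr (Subsingleton.eq_univ_of_nonempty h)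

lemma isPersp_punit {M N : Matroid PUnit.{u + 1}} (h : rk N univ ≤ rk M univ) :
    IsPersp M N := by
  intro X Y hXY
  rcases punit_subset_iff hXY with rfl | ⟨rfl, rfl⟩
  · rw [add_comm]
  · simpa [rk_empty] using h

lemma rk_coloopMat : rk coloopMat.{u} univ = 1 := by
  rw [rk, coloopMat, Matroid.eRk_freeOn Subset.rfl]
  simp [Set.encard_univ]

lemma rk_loopMat : rk loopMat.{u} univ = 0 := by simp [rk, loopMat]

lemma rk_punit_le (M : Matroid PUnit.{u + 1}) : rk M univ ≤ 1 := by
  have := M.eRk_le_encard univ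
  rw [← cast_rk] at this
  simp only [Set.encard_univ, ENat.card_eq_coe_fintype_card, Fintype.card_punit] at this
  exact_mod_cast this

lemma rk_upper_punit {D : DeltaMatroid PUnit.{u + 1}} {F : Set PUnit.{u + 1}}
    (h : D.MaxOn univ F) (hF : F = ∅) : rk D.upper univ = 0 := by
  rw [h.rk_upper, hF]; simp

lemma rk_lower_punit {D : DeltaMatroid PUnit.{u + 1}} (h : univ ∈ D.feasible)
    (h' : ∀ F ∈ D.feasible, F = univ) : rk D.lower univ = 1 := by
  have hB : D.lower.IsBase univ :=
    (D.lower_isBase _).2 ⟨h, fun F hF => by rw [h' F hF]⟩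
  have := hB.encard_eq_eRank
  rw [Matroid.eRank_def, D.lower_ground] at this
  rw [rk, ← this]
  simp [Set.encard_univ]

/-- The delta-matroid perspective `(c, c, l)`. -/
def ccl : DeltaMatPer PUnit.{u + 1} where
  M := coloopMat
  D := coloopDelta
  N := loopMat
  ground_M := rfl
  ground_N := rfl
  persp_upper := isPersp_punit (by rw [rk_coloopMat]; exact rk_punit_le _)
  persp_lower := isPersp_punit (by rw [rk_loopMat]; exact Nat.zero_le _)

/-- The delta-matroid perspective `(c, l, l)`. -/
def cll : DeltaMatPer PUnit.{u + 1} where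
  M := coloopMat
  D := loopDelta
  N := loopMat
  ground_M := rfl
  ground_N := rfl
  persp_upper := isPersp_punit (by rw [rk_coloopMat]; exact rk_punit_le _)
  persp_lower := isPersp_punit (by rw [rk_loopMat]; exact Nat.zero_le _)

/-- The delta-matroid perspective `(c, c, c)`. -/
def ccc : DeltaMatPer PUnit.{u + 1} where
  M := coloopMat
  D := coloopDelta
  N := coloopMat
  ground_M := rfl
  ground_N := rfl
  persp_upper := isPersp_punit (by rw [rk_coloopMat]; exact rk_punit_le _)
  persp_lower := isPersp_punit (by
    rw [rk_lower_punit (D := coloopDelta) rfl (fun F hF => hF)]; exact rk_punit_le _)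

/-- The delta-matroid perspective `(l, l, l)`. -/
def lll : DeltaMatPer PUnit.{u + 1} where
  M := loopMat
  D := loopDelta
  N := loopMat
  ground_M := rfl
  ground_N := rfl
  persp_upper := isPersp_punit (by
    rw [rk_upper_punit (D := loopDelta) (F := ∅)
      ⟨rfl, fun G hG => by rw [show G = ∅ from hG]⟩ rfl]
    exact Nat.zero_le _)
  persp_lower := isPersp_punit (by rw [rk_loopMat]; exact Nat.zero_le _)

/-- The delta-matroid perspective `(c, n, l)`. -/
def cnl : DeltaMatPer PUnit.{u + 1} where
  M := coloopMat
  D := bothDelta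
  N := loopMat
  ground_M := rfl
  ground_N := rfl
  persp_upper := isPersp_punit (by rw [rk_coloopMat]; exact rk_punit_le _)
  persp_lower := isPersp_punit (by rw [rk_loopMat]; exact Nat.zero_le _)

/-- The matroid perspective `(c, c)`. -/
def cc : MatPer PUnit.{u + 1} := ⟨coloopMat, coloopMat, rfl, rfl, isPersp_punit le_rfl⟩

/-- The matroid perspective `(l, l)`. -/
def ll : MatPer PUnit.{u + 1} := ⟨loopMat, loopMat, rfl, rfl, isPersp_punit le_rfl⟩

/-- The matroid perspective `(c, l)`. -/
def cl : MatPer PUnit.{u + 1} :=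
  ⟨coloopMat, loopMat, rfl, rfl, isPersp_punit (by rw [rk_loopMat]; exact Nat.zero_le _)⟩

/-- The corank of a matroid. -/
noncomputable def corank {E : Type u} (M : Matroid E) : ℕ := M.E.ncard - rank M

/-! ### The target monoids and rings -/

/-- The five generators `s, t, u, v, w`. -/
inductive Gen5
  | s | t | u | v | w

/-- The relation `w ^ 2 = s t`. -/
inductive Rel5 : FreeCommMonoid Gen5 → FreeCommMonoid Gen5 → Prop
  | sq : Rel5 (.of .w ^ 2) (.of .s * .of .t)

/-- The commutative monoid `⟨s, t, u, v, w ∣ w ^ 2 = s t⟩`. -/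
abbrev Mon5 := PresentedCommMonoid Rel5

/-- The generators of `Mon5`. -/
noncomputable def Mon5.gen (g : Gen5) : Mon5 := PresentedCommMonoid.of Rel5 g

/-- The three generators `u, v, w`. -/
inductive Gen3
  | u | v | w

/-- The relation `w ^ 2 = u v`. -/
inductive Rel3 : FreeCommMonoid Gen3 → FreeCommMonoid Gen3 → Prop
  | sq : Rel3 (.of .w ^ 2) (.of .u * .of .v)

/-- The commutative monoid `⟨u, v, w ∣ w ^ 2 = u v⟩`. -/
abbrev Mon3 := PresentedCommMonoid Rel3

/-- The generators of `Mon3`. -/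
noncomputable def Mon3.gen (g : Gen3) : Mon3 := PresentedCommMonoid.of Rel3 g

/-- The five classes `s = [(c,c,l)]`, `t = [(c,l,l)]`, `u = [(c,c,c)]`, `v = [(l,l,l)]`,
`w = [(c,n,l)]`. -/
noncomputable def genClass : Gen5 → deltaMatPer.{u}.Groth
  | .s => deltaMatPer.cls ccl
  | .t => deltaMatPer.cls cll
  | .u => deltaMatPer.cls ccc
  | .v => deltaMatPer.cls lll
  | .w => deltaMatPer.cls cnl

/-- The relation `s = t = w` on the Grothendieck monoid of delta-matroid perspectives. -/
inductive RelMatPer : deltaMatPer.{u}.Groth → deltaMatPer.{u}.Groth → Prop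
  | st : RelMatPer (genClass .s) (genClass .t)
  | tw : RelMatPer (genClass .t) (genClass .w)

/-- The relations `s = u`, `t = v` on the Grothendieck monoid of delta-matroid perspectives. -/
inductive RelDeltaMat : deltaMatPer.{u}.Groth → deltaMatPer.{u}.Groth → Prop
  | su : RelDeltaMat (genClass .s) (genClass .u)
  | tv : RelDeltaMat (genClass .t) (genClass .v)

section rings
open MvPolynomial
variable (K : Type*) [CommRing K]

/-- The ideal of the relations `w_i ^ 2 = s_i t_i`; the variables `g_1` and `g_2` are indexed by
`(g, 0)` and `(g, 1)`. -/
noncomputable def tutteIdeal : Ideal (MvPolynomial (Gen5 × Fin 2) K) :=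
  Ideal.span (range fun i : Fin 2 => X (.w, i) ^ 2 - X (.s, i) * X (.t, i))

/-- The ring `K[s_1, t_1, u_1, v_1, w_1, s_2, t_2, u_2, v_2, w_2] / (w_i ^ 2 - s_i t_i)`. -/
abbrev TutteRing := MvPolynomial (Gen5 × Fin 2) K ⧸ tutteIdeal K

/-- The generators of `TutteRing K`. -/
noncomputable def tvar (g : Gen5) (i : Fin 2) : TutteRing K :=
  Ideal.Quotient.mk (tutteIdeal K) (X (g, i))

/-- The variables `rs = s ^ (1/2)`, `rt = t ^ (1/2)`, `u`, `v`. -/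
inductive RootVar
  | rs | rt | u | v

/-- The images of the variables under the embedding that writes `w` as
`s ^ (1/2) * t ^ (1/2)`. -/
noncomputable def rootVal : Gen5 × Fin 2 → MvPolynomial (RootVar × Fin 2) K
  | (.s, i) => X (.rs, i) ^ 2
  | (.t, i) => X (.rt, i) ^ 2
  | (.u, i) => X (.u, i)
  | (.v, i) => X (.v, i)
  | (.w, i) => X (.rs, i) * X (.rt, i)

/-- The map from `TutteRing K` to the polynomial ring in
`s_i ^ (1/2), t_i ^ (1/2), u_i, v_i`. -/
noncomputable def rootEmb : TutteRing K →ₐ[K] MvPolynomial (RootVar × Fin 2) K :=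
  Ideal.Quotient.liftₐ (tutteIdeal K) (aeval (rootVal K)) (by
    intro a ha
    have : tutteIdeal K ≤ RingHom.ker (aeval (R := K) (rootVal K)) := by
      rw [tutteIdeal, Ideal.span_le]
      rintro _ ⟨i, rfl⟩
      simp only [SetLike.mem_coe, RingHom.mem_ker, map_sub, map_mul, map_pow, aeval_X, rootVal]
      ring
    exact this ha)

/-- The variables `x`, `y`, `ra = a ^ (1/2)`, `rb = b ^ (1/2)` of the Krushkal polynomial. -/
inductive KVar
  | x | y | ra | rb

/-- Twice the mean `σ(D)` of the ranks of the upper and the lower matroid. -/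
noncomputable def twiceSigma {E : Type u} [Finite E] (D : DeltaMatroid E) : ℕ :=
  rank D.upper + rank D.lower

/-- The restriction of a delta-matroid to a subset of its ground set. -/
noncomputable def DeltaMatroid.restrict {E : Type u} [Finite E] (D : DeltaMatroid E)
    (A : Set E) : DeltaMatroid A := deltaMat.restrict D A

/-- The contraction of a subset of the ground set in a delta-matroid. -/
noncomputable def DeltaMatroid.contract {E : Type u} [Finite E] (D : DeltaMatroid E)
    (A : Set E) : DeltaMatroid (Aᶜ : Set E) := deltaMat.contract D A

/-- The Krushkal polynomial of a delta-matroid perspective, in the variables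
`x`, `y`, `a ^ (1/2)`, `b ^ (1/2)`. -/
noncomputable def krushkal {E : Type u} [Finite E] (P : DeltaMatPer E) : MvPolynomial KVar K :=
  ∑ᶠ A : Set E, X .x ^ (rank P.N - rk P.N A) * X .y ^ (A.ncard - rk P.M A) *
    X .ra ^ (twiceSigma (P.D.restrict A) - 2 * rk P.N A) *
    X .rb ^ (2 * rk P.M A - twiceSigma (P.D.restrict A))

/-- The specialization `(s_1, t_1, u_1, v_1, s_2, t_2, u_2, v_2) = (a, b, 1, y, 1, 1, x, 1)`. -/
noncomputable def krushkalVal : RootVar × Fin 2 → MvPolynomial KVar K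
  | (.rs, 0) => X .ra
  | (.rt, 0) => X .rb
  | (.u, 0) => 1
  | (.v, 0) => X .y
  | (.rs, 1) => 1
  | (.rt, 1) => 1
  | (.u, 1) => X .x
  | (.v, 1) => 1

/-- The values `(x, y, a, b) = (u_2 / u_1, v_1 / v_2, s_1 / s_2, t_1 / t_2)`, at the level of the
square roots `a ^ (1/2)`, `b ^ (1/2)`; used only where the denominators are invertible. -/
noncomputable def ratioVal {R : Type*} [CommRing R] (z : RootVar × Fin 2 → R) : KVar → R
  | .x => z (.u, 1) * Ring.inverse (z (.u, 0))
  | .y => z (.v, 0) * Ring.inverse (z (.v, 1))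
  | .ra => z (.rs, 0) * Ring.inverse (z (.rs, 1))
  | .rb => z (.rt, 0) * Ring.inverse (z (.rt, 1))

end rings
end TutteMinors

open TutteMinors

set_option linter.unusedSectionVars false

namespace TutteMinors
open Set
open scoped symmDiff
open Function.Embedding (inl inr)

/-! ### Ranks of restrictions and contractions -/

section ranks
variable {E F : Type u} [Finite E] [Finite F]

/-! A norm is determined by its values on one-element structures: the multiplicative relation for a
one-element subset splits off a point and leaves a smaller structure, and each of the three minors
systems has exactly one structure on the empty set (`Norm.eq_of_punit`). Hence each Grothendieck
monoid is generated by the classes of its one-element structures. A one-element delta-matroid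
perspective amounts to a weakly increasing 0/1 sequence rk(M') ≤ rk(D_min) ≤ rk(D_max) ≤ rk(M), and
there are five of these: v, t, w, s, u.

The relation w² = st holds because one class can be computed in two ways. Take two elements, M free,
M' of rank zero, and D with a maximal chain of sets as feasible sets. Splitting off the element
whose singleton is feasible gives two copies of (c,n,l); splitting off the other element gives
(c,l,l) and (c,c,l) (`cls_ofDelta_pair`, `genClass_w_sq`).

There is no further relation because the rank formula of the theorem is a norm with values in
`Mon5`. The ranks of M' and the coranks of M add up under restriction and contraction. The ranks of
D_min and D_max do not do so separately, but their sum 2σ(D) does (`DeltaMatroid.twiceSigma_add`).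
This is enough: when w² = st, the monomial s^a t^b w^e depends only on 2a+e and 2b+e
(`pow_mul_pow_congr`), and for the rank formula these numbers are 2σ(D) − 2 rk(M') and 2 rk(M) −
2σ(D). The induced homomorphism is inverse to the one given by the generators.

For the additivity of σ, the ranks of (D|A)_min and (D/A)_max are read off from D_min and D_max.
Those of (D|A)_max and (D/A)_min both involve the upper rank of the twist of D by the complement of
A, with opposite signs, so it cancels in the sum.

Matroid perspectives and delta-matroids are treated in the same way, and the two quotient statements
then compare presentations on generators. The universal ring is the monoid algebra of two copies of
U, since the factor in between is trivial. Adjoining square roots sends monomials to monomials whose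
exponents are exactly the numbers 2a+e, 2b+e and the exponents of u and v, so a linear retraction
exists (`rootRetract_rootEmb`). After this substitution only σ and matroid ranks occur as exponents.
They are additive, so a common monomial can be pulled out of the Tutte sum, and what remains is the
Krushkal polynomial. -/

lemma rank_eq_rk_univ {M : Matroid E} (hM : M.E = univ) : rank M = rk M univ := by
  rw [rank, hM]

lemma eq_empty_or_univ [Subsingleton E] (Z : Set E) : Z = ∅ ∨ Z = univ :=
  Z.eq_empty_or_nonempty.imp_right Subsingleton.eq_univ_of_nonempty

lemma rk_le_rank {M : Matroid E} (hM : M.E = univ) (A : Set E) : rk M A ≤ rank M := by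
  rw [rank_eq_rk_univ hM]; exact rk_mono M (subset_univ A)

lemma rk_le_ncard (M : Matroid E) (A : Set E) : rk M A ≤ A.ncard := by
  have := M.eRk_le_encard A
  rw [← cast_rk, ← (Set.toFinite A).cast_ncard_eq] at this
  exact_mod_cast this

lemma rank_le_card {M : Matroid E} (hM : M.E = univ) : rank M ≤ Nat.card E := by
  rw [rank_eq_rk_univ hM, ← Set.ncard_univ]; exact rk_le_ncard _ _

lemma HasRk.rank_add {M : Matroid E} {M' : Matroid F} {f : F ↪ E} {P : Set E}
    (h : HasRk M' f P M) (hM' : M'.E = univ) : rank M' + rk M P = rk M (range f ∪ P) := by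
  rw [rank_eq_rk_univ hM', h univ, image_univ]

lemma HasRk.rank_eq {M : Matroid E} {M' : Matroid F} {f : F ↪ E}
    (h : HasRk M' f ∅ M) (hM' : M'.E = univ) : rank M' = rk M (range f) := by
  have := h.rank_add hM'
  simpa [rk_empty] using this

lemma HasRk.rank_add_compl {M : Matroid E} {M' : Matroid F} {f : F ↪ E}
    (h : HasRk M' f (range f)ᶜ M) (hM : M.E = univ) (hM' : M'.E = univ) :
    rank M' + rk M (range f)ᶜ = rank M := by
  rw [h.rank_add hM', union_compl_self, rank_eq_rk_univ hM]

lemma HasRk.congr {M : Matroid E} {M' : Matroid F} {f g : F ↪ E} {P Q : Set E}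
    (h : HasRk M' f P M) (hf : f = g) (hP : P = Q) : HasRk M' g Q M := by
  subst hf hP; exact h

lemma IsPersp.rank_le {M N : Matroid E} (h : IsPersp M N) (hM : M.E = univ) (hN : N.E = univ) :
    rank N ≤ rank M := by
  have := h ∅ univ (empty_subset _)
  rw [rank_eq_rk_univ hM, rank_eq_rk_univ hN]
  simpa [rk_empty] using this

lemma rank_add_corank {M : Matroid E} (hM : M.E = univ) : rank M + corank M = Nat.card E := by
  have := rank_le_card hM
  rw [corank, hM, Set.ncard_univ]
  omega

end ranks

/-! ### Ranks of the minors of a matroid perspective -/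

namespace MatPer
variable {E F : Type u} [Finite E] [Finite F]

/-- `matPer.restrict` passes through the decomposition of `E` as `A ⊕ Aᶜ`; this removes the detour
and leaves rank functions along the inclusion of `A`. -/
lemma isMinor_restrict (X : MatPer E) (A : Set E) :
    IsMinor (matPer.restrict X A : MatPer A) (Function.Embedding.subtype (· ∈ A)) ∅ X := by
  classical
  have h := (isMinor_res (X.map (Equiv.Set.sumCompl A).symm)).comp
    (X.isMinor_map (Equiv.Set.sumCompl A).symm)
  exact ⟨h.1.congr (by ext x; rfl) (by simp), h.2.congr (by ext x; rfl) (by simp)⟩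

lemma isMinor_contract (X : MatPer E) (A : Set E) :
    IsMinor (matPer.contract X A : MatPer (Aᶜ : Set E))
      (Function.Embedding.subtype (· ∈ Aᶜ)) A X := by
  classical
  have h := (isMinor_con (X.map (Equiv.Set.sumCompl A).symm)).comp
    (X.isMinor_map (Equiv.Set.sumCompl A).symm)
  -- The contracted elements are those outside the image of `Aᶜ`, that is, the elements of `A`.
  have e : (Equiv.Set.sumCompl A).symm.symm.toEmbedding '' (range inr)ᶜ ∪ ∅ = A := by
    ext x
    by_cases hx : x ∈ A
    · simp [Equiv.Set.sumCompl_symm_apply_of_mem hx, hx]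
    · simp [Equiv.Set.sumCompl_symm_apply_of_notMem hx, hx]
  exact ⟨h.1.congr (by ext x; rfl) e, h.2.congr (by ext x; rfl) e⟩

lemma range_subtype (A : Set E) : range (Function.Embedding.subtype (· ∈ A)) = A := by
  ext x; simp

lemma rank_restrict_M (X : MatPer E) (A : Set E) :
    rank (matPer.restrict X A : MatPer A).M = rk X.M A := by
  rw [(X.isMinor_restrict A).1.rank_eq (ground_M _), range_subtype]

lemma rank_restrict_N (X : MatPer E) (A : Set E) :
    rank (matPer.restrict X A : MatPer A).N = rk X.N A := by
  rw [(X.isMinor_restrict A).2.rank_eq (ground_N _), range_subtype]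

lemma rank_contract_M (X : MatPer E) (A : Set E) :
    rank (matPer.contract X A : MatPer (Aᶜ : Set E)).M = rank X.M - rk X.M A := by
  have h := (X.isMinor_contract A).1.rank_add (ground_M _)
  rw [range_subtype, compl_union_self] at h
  rw [rank_eq_rk_univ X.ground_M, ← h]; simp

lemma rank_contract_N (X : MatPer E) (A : Set E) :
    rank (matPer.contract X A : MatPer (Aᶜ : Set E)).N = rank X.N - rk X.N A := by
  have h := (X.isMinor_contract A).2.rank_add (ground_N _)
  rw [range_subtype, compl_union_self] at h
  rw [rank_eq_rk_univ X.ground_N, ← h]; simp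

lemma rank_le (X : MatPer E) : rank X.N ≤ rank X.M :=
  X.persp.rank_le X.ground_M X.ground_N

/-- The perspective inequality between `A` and the ground set, with all terms positive. It ensures
that the truncated subtractions in the ranks of `X/A` cause no error. -/
lemma rk_add_rk_le (X : MatPer E) (A : Set E) :
    rank X.N + rk X.M A ≤ rank X.M + rk X.N A := by
  rw [rank_eq_rk_univ X.ground_M, rank_eq_rk_univ X.ground_N]
  exact X.persp A univ (subset_univ A)

lemma rk_le_rk (X : MatPer E) (A : Set E) : rk X.N A ≤ rk X.M A := by
  simpa [rk_empty] using X.persp ∅ A (empty_subset A)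

lemma ext_rank [Subsingleton E] {X Y : MatPer E} (hM : rank X.M = rank Y.M)
    (hN : rank X.N = rank Y.N) : X = Y := by
  rw [rank_eq_rk_univ X.ground_M, rank_eq_rk_univ Y.ground_M] at hM
  rw [rank_eq_rk_univ X.ground_N, rank_eq_rk_univ Y.ground_N] at hN
  refine MatPer.ext (ext_rk X.ground_M Y.ground_M fun Z => ?_)
    (ext_rk X.ground_N Y.ground_N fun Z => ?_) <;>
  rcases eq_empty_or_univ Z with rfl | rfl <;> simp only [rk_empty, hM, hN]

end MatPer

/-! ### Upper and lower ranks of the minors of a delta-matroid -/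

namespace DeltaMatroid
variable {E F : Type u} [Finite E] [Finite F]

/-- Few elements outside `A` means many elements outside `A` after twisting by `Aᶜ`. With
restriction in this form, ranks of all minors reduce to upper ranks of contractions. -/
lemma restrict_eq (D : DeltaMatroid E) (A : Set E) :
    D.restrict A = (D.twist Aᶜ).contr (Function.Embedding.subtype (· ∈ A)) := by
  classical
  refine IsMinor.unique ((D.map (Equiv.Set.sumCompl A).symm).isMinor_res.comp
    (D.isMinor_map (Equiv.Set.sumCompl A).symm)) rfl (by ext x; rfl) ?_
  ext x
  by_cases hx : x ∈ A
  · simp [Equiv.Set.sumCompl_symm_apply_of_mem hx, hx, mem_symmDiff]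
  · simp [Equiv.Set.sumCompl_symm_apply_of_notMem hx, hx, mem_symmDiff]

lemma contract_eq (D : DeltaMatroid E) (A : Set E) :
    D.contract A = D.contr (Function.Embedding.subtype (· ∈ Aᶜ)) := by
  classical
  have h := (D.map (Equiv.Set.sumCompl A).symm).isMinor_con.comp
    (D.isMinor_map (Equiv.Set.sumCompl A).symm)
  refine h.unique (Q := ∅) (g := Function.Embedding.subtype (· ∈ Aᶜ)) ?_ (by ext x; rfl) (by simp)
  rw [IsMinor, twist_empty]

lemma rank_upper_contr {f : F ↪ E} (D : DeltaMatroid E) :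
    rank (D.contr f).upper + rk D.upper (range f)ᶜ = rank D.upper :=
  (hasRk_upper_contr f D).rank_add_compl rfl rfl

/-- The smallest feasible sets of `D` are the complements of the largest ones of the dual. Lower
ranks are always computed through this identity. -/
lemma rank_lower_add (D : DeltaMatroid E) : rank D.lower + rank D.dual.upper = Nat.card E := by
  have h := rk_dual (M := D.dual.upper) rfl univ
  rw [← lower_eq, compl_univ, rk_empty, zero_add, ncard_univ] at h
  exact h

lemma dual_contr (f : F ↪ E) (D : DeltaMatroid E) :
    (D.contr f).dual = (D.twist (range f)).contr f := by
  rw [dual, contr_twist, image_univ]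

/-- The rank of the lower matroid of a restriction. -/
lemma rank_lower_restrict (D : DeltaMatroid E) (A : Set E) :
    rank (D.restrict A).lower = rk D.lower A := by
  have h1 := (D.restrict A).rank_lower_add
  -- The twist by `Aᶜ` that encodes the deletion and the twist by `A` that encodes duality combine
  -- to the full dual: the dual of `D|A` is `D.dual` with `Aᶜ` contracted.
  have e : (Aᶜ : Set E) ∆ A = univ := by ext x; simp
  rw [restrict_eq, dual_contr, MatPer.range_subtype, twist_twist, e, ← restrict_eq] at h1
  have h2 := D.dual.rank_upper_contr (f := Function.Embedding.subtype (· ∈ A))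
  rw [MatPer.range_subtype] at h2
  have h3 := rk_dual (M := D.dual.upper) rfl A
  rw [← lower_eq] at h3
  change rk D.lower A + rank D.dual.upper = _ at h3
  rw [← Nat.card_coe_set_eq] at h3
  change _ + rank (D.dual.contr _).upper = _ at h1
  omega

/-- The rank of the upper matroid of a contraction. -/
lemma rank_upper_contract (D : DeltaMatroid E) (A : Set E) :
    rank (D.contract A).upper + rk D.upper A = rank D.upper := by
  have h := D.rank_upper_contr (f := Function.Embedding.subtype (· ∈ Aᶜ))
  rwa [MatPer.range_subtype, compl_compl, ← contract_eq] at h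

/-- The rank of the upper matroid of a restriction, in terms of a twist. -/
lemma rank_upper_restrict (D : DeltaMatroid E) (A : Set E) :
    rank (D.restrict A).upper + rk D.dual.upper Aᶜ = rank (D.twist Aᶜ).upper := by
  have h := (D.twist Aᶜ).rank_upper_contr (f := Function.Embedding.subtype (· ∈ A))
  -- Seen as a twist of the dual by `A`, the delta-matroid `D.twist Aᶜ` has the same upper rank on
  -- `Aᶜ` as `D.dual`, since `A` and `Aᶜ` are disjoint.
  have e : D.twist Aᶜ = D.dual.twist A := by
    rw [dual, twist_twist]; congr 1; ext x; simp [mem_symmDiff]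
  rw [MatPer.range_subtype, ← restrict_eq] at h
  rw [← h, e, rk_upper_twist _ disjoint_compl_right]

/-- The rank of the lower matroid of a contraction, in terms of a twist. -/
lemma rank_lower_contract (D : DeltaMatroid E) (A : Set E) :
    rank (D.contract A).lower + rank (D.twist Aᶜ).upper = rk D.upper A + (Aᶜ : Set E).ncard := by
  have h1 := (D.contract A).rank_lower_add
  have h2 := (D.twist Aᶜ).rank_upper_contr (f := Function.Embedding.subtype (· ∈ Aᶜ))
  rw [MatPer.range_subtype, compl_compl, rk_upper_twist _ disjoint_compl_left] at h2
  rw [contract_eq, dual_contr, MatPer.range_subtype, ← contract_eq, Nat.card_coe_set_eq] at h1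
  omega

/-- The mean rank of the upper and the lower matroid is additive. -/
lemma twiceSigma_add (D : DeltaMatroid E) (A : Set E) :
    twiceSigma (D.restrict A) + twiceSigma (D.contract A) = twiceSigma D := by
  have h1 := D.rank_lower_restrict A
  have h2 := D.rank_upper_contract A
  -- The upper rank of `D.twist Aᶜ` is not a function of the upper and lower matroids of `D`, but it
  -- enters `h3` and `h4` with opposite signs. Once it has cancelled, only rank duality is needed.
  have h3 := D.rank_upper_restrict A
  have h4 := D.rank_lower_contract A
  have h5 := rk_dual (M := D.dual.upper) rfl A
  rw [← lower_eq] at h5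
  change rk D.lower A + rank D.dual.upper = _ at h5
  have h6 := D.rank_lower_add
  have h7 := Set.ncard_add_ncard_compl A
  simp only [twiceSigma]
  omega

lemma rank_lower_le_upper (D : DeltaMatroid E) : rank D.lower ≤ rank D.upper :=
  D.isPersp_upper_lower.rank_le rfl rfl

lemma rank_upper_eq {D : DeltaMatroid E} {F : Set E} (hF : F ∈ D.feasible)
    (h : ∀ G ∈ D.feasible, G.ncard ≤ F.ncard) : rank D.upper = F.ncard := by
  have : D.MaxOn univ F := ⟨hF, by simpa using h⟩
  rw [rank_eq_rk_univ rfl, this.rk_upper, inter_univ]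

lemma rank_lower_eq {D : DeltaMatroid E} {F : Set E} (hF : F ∈ D.feasible)
    (h : ∀ G ∈ D.feasible, F.ncard ≤ G.ncard) : rank D.lower = F.ncard := by
  have h1 := D.rank_lower_add
  have h2 : rank D.dual.upper = Fᶜ.ncard := rank_upper_eq ((D.mem_dual _).2 (by simpa using hF)) (by
    intro G hG
    have := h _ ((D.mem_dual _).1 hG)
    have := Set.ncard_add_ncard_compl G
    have := Set.ncard_add_ncard_compl F
    omega)
  have := Set.ncard_add_ncard_compl F
  omega

lemma exists_rank_upper (D : DeltaMatroid E) : ∃ F ∈ D.feasible, F.ncard = rank D.upper ∧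
    ∀ G ∈ D.feasible, G.ncard ≤ rank D.upper := by
  obtain ⟨F, hF, h⟩ := Set.exists_max_image D.feasible Set.ncard (Set.toFinite _) D.nonempty
  exact ⟨F, hF, (rank_upper_eq hF h).symm, by rwa [rank_upper_eq hF h]⟩

lemma exists_rank_lower (D : DeltaMatroid E) : ∃ F ∈ D.feasible, F.ncard = rank D.lower ∧
    ∀ G ∈ D.feasible, rank D.lower ≤ G.ncard := by
  obtain ⟨F, hF, h⟩ := Set.exists_min_image D.feasible Set.ncard (Set.toFinite _) D.nonempty
  exact ⟨F, hF, (rank_lower_eq hF h).symm, by rwa [rank_lower_eq hF h]⟩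

/-- On at most one element a set is determined by its cardinality, which is 0 or 1. Both extreme
cardinalities are attained, and no value lies strictly between them. -/
lemma mem_feasible_iff_of_subsingleton [Subsingleton E] (D : DeltaMatroid E) (F : Set E) :
    F ∈ D.feasible ↔ F.ncard = rank D.lower ∨ F.ncard = rank D.upper := by
  obtain ⟨G, hG, hGc, hu⟩ := D.exists_rank_upper
  obtain ⟨H, hH, hHc, hl⟩ := D.exists_rank_lower
  have inj : ∀ X Y : Set E, X.ncard = Y.ncard → X = Y := by
    intro X Y h
    rcases eq_empty_or_univ X with rfl | rfl
    · rw [ncard_empty] at h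
      exact ((Set.ncard_eq_zero (Set.toFinite _)).1 h.symm).symm
    · exact (Set.eq_of_subset_of_ncard_le (subset_univ Y) h.le (Set.toFinite _)).symm
  constructor
  · intro hF
    have h1 := hu F hF
    have h2 := hl F hF
    have h3 := Set.ncard_le_one_of_subsingleton F
    have h4 := Set.ncard_le_one_of_subsingleton G
    omega
  · rintro (h | h)
    · rwa [inj F H (by omega)]
    · rwa [inj F G (by omega)]

/-- This makes it possible to identify one-element minors by their ranks, without computing feasible
sets. -/
lemma ext_rank [Subsingleton E] {D D' : DeltaMatroid E} (hl : rank D.lower = rank D'.lower)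
    (hu : rank D.upper = rank D'.upper) : D = D' := by
  ext F
  rw [mem_feasible_iff_of_subsingleton, mem_feasible_iff_of_subsingleton, hl, hu]

end DeltaMatroid

/-! ### Rank inequalities of delta-matroid perspectives -/

namespace DeltaMatPer
variable {E F : Type u} [Finite E] [Finite F]

lemma rank_N_le (P : DeltaMatPer E) : rank P.N ≤ rank P.D.lower :=
  P.persp_lower.rank_le rfl P.ground_N

lemma rank_upper_le (P : DeltaMatPer E) : rank P.D.upper ≤ rank P.M :=
  P.persp_upper.rank_le P.ground_M rfl

lemma ext_rank [Subsingleton E] {X Y : DeltaMatPer E} (hM : rank X.M = rank Y.M)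
    (hN : rank X.N = rank Y.N) (hl : rank X.D.lower = rank Y.D.lower)
    (hu : rank X.D.upper = rank Y.D.upper) : X = Y :=
  DeltaMatPer.ext' (MatPer.ext_rank hM hN) (DeltaMatroid.ext_rank hl hu)

lemma D_restrict (P : DeltaMatPer E) (A : Set E) :
    (deltaMatPer.restrict P A : DeltaMatPer A).D = P.D.restrict A := rfl

lemma D_contract (P : DeltaMatPer E) (A : Set E) :
    (deltaMatPer.contract P A : DeltaMatPer (Aᶜ : Set E)).D = P.D.contract A := rfl

end DeltaMatPer

/-! ### Homomorphisms out of presented commutative monoids -/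

lemma FreeCommMonoid.hom_ext {α M : Type*} [CommMonoid M] {f g : FreeCommMonoid α →* M}
    (h : ∀ a, f (.of a) = g (.of a)) : f = g := by
  refine MonoidHom.ext fun x => ?_
  change f (Multiplicative.ofAdd x.toAdd) = g (Multiplicative.ofAdd x.toAdd)
  induction x.toAdd using Finsupp.induction_linear with
  | zero => exact (map_one f).trans (map_one g).symm
  | add x y hx hy => rw [ofAdd_add, map_mul, map_mul, hx, hy]
  | single a n =>
    have : Multiplicative.ofAdd (Finsupp.single a n) = (FreeCommMonoid.of a) ^ n := by
      rw [FreeCommMonoid.of, ← ofAdd_nsmul, Finsupp.smul_single, smul_eq_mul, mul_one]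
    rw [this, map_pow, map_pow, h]

namespace PresentedCommMonoid
variable {α M : Type*} [CommMonoid M] {r : FreeCommMonoid α → FreeCommMonoid α → Prop}

/-- The universal property of a presented commutative monoid. -/
noncomputable def lift (f : α → M)
    (h : ∀ x y, r x y → FreeCommMonoid.lift f x = FreeCommMonoid.lift f y) :
    PresentedCommMonoid r →* M :=
  Con.lift (conGen r) (FreeCommMonoid.lift f) (Con.conGen_le.2 h)

lemma lift_of (f : α → M)
    (h : ∀ x y, r x y → FreeCommMonoid.lift f x = FreeCommMonoid.lift f y) (a : α) :
    lift f h (PresentedCommMonoid.of r a) = f a := by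
  change FreeCommMonoid.lift f (FreeCommMonoid.of a) = f a
  rw [FreeCommMonoid.lift_of]

lemma hom_ext {f g : PresentedCommMonoid r →* M}
    (h : ∀ a, f (of r a) = g (of r a)) : f = g :=
  Con.hom_ext (FreeCommMonoid.hom_ext h)

end PresentedCommMonoid

/-- The relation w² = st lets a factor st be traded for w², which changes neither 2a+e nor 2b+e.
These two numbers are therefore the only invariants needed, and this is why an additive σ suffices
for multiplicative rank norms. -/
lemma pow_mul_pow_congr {M : Type*} [CommMonoid M] {s t w : M} (h : w ^ 2 = s * t)
    {a b e a' b' e' : ℕ} (ha : 2 * a + e = 2 * a' + e') (hb : 2 * b + e = 2 * b' + e') :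
    s ^ a * t ^ b * w ^ e = s ^ a' * t ^ b' * w ^ e' := by
  wlog hle : e ≤ e' generalizing a b e a' b' e'
  · exact (this ha.symm hb.symm (by omega)).symm
  -- Here `e` and `e'` have the same parity, and `k = a - a'` is the number of factors st on the
  -- left to be turned into w².
  obtain ⟨k, rfl⟩ : ∃ k, e' = e + 2 * k := ⟨a - a', by omega⟩
  obtain rfl : a = a' + k := by omega
  obtain rfl : b = b' + k := by omega
  rw [pow_add w, pow_mul, h, mul_pow, pow_add, pow_add]
  ac_rfl

/-- The form in which multiplicativity of the delta-matroid perspective norm is checked: only 2a+e,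
2b+e and the exponents of u and v have to add up. -/
lemma pow_mul_pow_mul_congr {M : Type*} [CommMonoid M] {s t u v w : M} (h : w ^ 2 = s * t)
    {a b c d e a₁ b₁ c₁ d₁ e₁ a₂ b₂ c₂ d₂ e₂ : ℕ}
    (ha : 2 * a + e = 2 * (a₁ + a₂) + (e₁ + e₂)) (hb : 2 * b + e = 2 * (b₁ + b₂) + (e₁ + e₂))
    (hc : c = c₁ + c₂) (hd : d = d₁ + d₂) :
    s ^ a * t ^ b * u ^ c * v ^ d * w ^ e =
      (s ^ a₁ * t ^ b₁ * u ^ c₁ * v ^ d₁ * w ^ e₁) *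
        (s ^ a₂ * t ^ b₂ * u ^ c₂ * v ^ d₂ * w ^ e₂) := by
  have key := pow_mul_pow_congr h ha hb
  have e : s ^ a * t ^ b * u ^ c * v ^ d * w ^ e =
      (s ^ a * t ^ b * w ^ e) * (u ^ c * v ^ d) := by ac_rfl
  rw [e, key, hc, hd]
  simp only [pow_add]
  ac_rfl

namespace Mon5

lemma gen_w_sq : gen .w ^ 2 = gen .s * gen .t :=
  (Con.eq _).2 (ConGen.Rel.of _ _ Rel5.sq)

/-- Homomorphisms out of `Mon5`. -/
noncomputable def lift {M : Type*} [CommMonoid M] (f : Gen5 → M)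
    (h : f .w ^ 2 = f .s * f .t) : Mon5 →* M :=
  PresentedCommMonoid.lift f (by rintro _ _ ⟨⟩; simpa using h)

lemma lift_gen {M : Type*} [CommMonoid M] (f : Gen5 → M)
    (h : f .w ^ 2 = f .s * f .t) (g : Gen5) : lift f h (gen g) = f g :=
  PresentedCommMonoid.lift_of _ _ g

lemma hom_ext {M : Type*} [CommMonoid M] {f g : Mon5 →* M}
    (h : ∀ a, f (gen a) = g (gen a)) : f = g := PresentedCommMonoid.hom_ext h

end Mon5

namespace Mon3

lemma gen_w_sq : gen .w ^ 2 = gen .u * gen .v :=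
  (Con.eq _).2 (ConGen.Rel.of _ _ Rel3.sq)

/-- Homomorphisms out of `Mon3`. -/
noncomputable def lift {M : Type*} [CommMonoid M] (f : Gen3 → M)
    (h : f .w ^ 2 = f .u * f .v) : Mon3 →* M :=
  PresentedCommMonoid.lift f (by rintro _ _ ⟨⟩; simpa using h)

lemma lift_gen {M : Type*} [CommMonoid M] (f : Gen3 → M)
    (h : f .w ^ 2 = f .u * f .v) (g : Gen3) : lift f h (gen g) = f g :=
  PresentedCommMonoid.lift_of _ _ g

lemma hom_ext {M : Type*} [CommMonoid M] {f g : Mon3 →* M}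
    (h : ∀ a, f (gen a) = g (gen a)) : f = g := PresentedCommMonoid.hom_ext h

end Mon3

/-! ### Norms are determined by their values on one-element structures -/

namespace MinorsSystem
variable {S : MinorsSystem.{u, v}}

/-- Induction on the size of the ground set. One element is split off by restricting to it and
contracting it; on the empty set the only structure is the neutral one, where every norm is 1. -/
lemma Norm.eq_of_punit [Subsingleton (S.Str PEmpty.{u + 1})] {U : Type*} [CommMonoid U]
    {N N' : S.Norm U}
    (h : ∀ X : S.Str PUnit.{u + 1}, N.toFun X = N'.toFun X) {E : Type u} [Finite E]
    (X : S.Str E) : N.toFun X = N'.toFun X := by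
  suffices H : ∀ (n : ℕ) (E : Type u) [Finite E] (X : S.Str E), Nat.card E = n →
      N.toFun X = N'.toFun X from H _ E X rfl
  intro n
  induction n with
  | zero =>
    intro E _ X hE
    have : IsEmpty E := (Finite.card_eq_zero_iff).1 hE
    rw [← N.map' (Equiv.equivPEmpty E) X, ← N'.map' (Equiv.equivPEmpty E) X,
      Subsingleton.elim (S.map (Equiv.equivPEmpty E) X) S.one, N.one', N'.one']
  | succ n ih =>
    intro E _ X hE
    have : Nonempty E := (Finite.card_pos_iff).1 (by omega)
    obtain ⟨a⟩ := this
    rw [N.mul' X {a}, N'.mul' X {a}, ih _ (S.contract X {a})]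
    · congr 1
      have σ : ({a} : Set E) ≃ PUnit.{u + 1} := Equiv.ofUnique _ _
      rw [← N.map' σ, ← N'.map' σ, h]
    · have := Set.ncard_add_ncard_compl ({a} : Set E)
      rw [Set.ncard_singleton] at this
      rw [Nat.card_coe_set_eq]
      omega

/-- Isomorphism classes generate, and each of them has a representative. -/
lemma groth_hom_ext {M : Type*} [CommMonoid M] {f g : S.Groth →* M}
    (h : ∀ {E : Type u} [Finite E] (X : S.Str E), f (S.cls X) = g (S.cls X)) : f = g :=
  PresentedCommMonoid.hom_ext fun c => by
    induction c using Quotient.inductionOn with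
    | _ X => exact @h X.1.1 X.1.2 X.2

/-- A norm that has an inverse on generators is universal. -/
lemma Norm.leftInverse_lift [Subsingleton (S.Str PEmpty.{u + 1})] {U : Type*} [CommMonoid U]
    (N : S.Norm U) (ψ : U →* S.Groth)
    (h : ∀ X : S.Str PUnit.{u + 1}, ψ (N.toFun X) = S.cls X) :
    ψ.comp N.lift = MonoidHom.id _ :=
  groth_hom_ext fun X => by
    rw [MonoidHom.comp_apply, N.lift_cls, MonoidHom.id_apply]
    exact Norm.eq_of_punit (N := N.comp ψ) (N' := S.universalNorm) h X

lemma Hom.groth_cls {S T : MinorsSystem.{u, v}} (f : Hom S T) {E : Type u} [Finite E]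
    (X : S.Str E) : f.groth (S.cls X) = T.cls (f.toFun X) :=
  (T.universalNorm.pullback f).lift_cls X

end MinorsSystem

/-! ### Structures on the empty set and ranks of relabelled structures -/

instance : Subsingleton (matPer.{u}.Str PEmpty.{u + 1}) :=
  ⟨fun X Y => MatPer.ext_rank
    (by have := rank_le_card X.ground_M; have := rank_le_card Y.ground_M
        simp only [Nat.card_of_isEmpty] at *; omega)
    (by have := rank_le_card X.ground_N; have := rank_le_card Y.ground_N
        simp only [Nat.card_of_isEmpty] at *; omega)⟩

/-- The direct sum with a structure on the empty set returns its first argument, so commutativity of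
this sum is literally equality of any two such structures. -/
instance : Subsingleton (deltaMat.{u}.Str PEmpty.{u + 1}) :=
  ⟨fun D D' => deltaMat.sum_comm D D'⟩

instance : Subsingleton (deltaMatPer.{u}.Str PEmpty.{u + 1}) :=
  ⟨fun X Y => deltaMatPer.sum_comm X Y⟩

section relabel
variable {E F : Type u} [Finite E] [Finite F]

lemma rank_mapEquiv (σ : E ≃ F) {M : Matroid E} (hM : M.E = univ) :
    rank (M.mapEquiv σ) = rank M := by
  have h := (hasRk_mapEquiv σ.symm M hM).rank_eq (mapEquiv_ground hM)
  rw [Equiv.symm_symm] at h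
  rw [h, rank_eq_rk_univ hM]
  congr 1
  exact σ.symm.surjective.range_eq

lemma corank_eq {M : Matroid E} (hM : M.E = univ) : corank M = Nat.card E - rank M := by
  rw [corank, hM, Set.ncard_univ]

lemma corank_mapEquiv (σ : E ≃ F) {M : Matroid E} (hM : M.E = univ) :
    corank (M.mapEquiv σ) = corank M := by
  rw [corank_eq hM, corank_eq (mapEquiv_ground hM), rank_mapEquiv σ hM, Nat.card_congr σ]

namespace DeltaMatroid

/-- A relabelling is a contraction of the empty set, along a surjective embedding. -/
lemma rank_upper_map (σ : E ≃ F) (D : DeltaMatroid E) :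
    rank (D.map σ).upper = rank D.upper := by
  have h := map_eq σ.symm D
  rw [Equiv.symm_symm, twist_empty] at h
  have h' := D.rank_upper_contr (f := σ.symm.toEmbedding)
  have e : range σ.symm.toEmbedding = univ := σ.symm.surjective.range_eq
  rw [e, compl_univ, rk_empty, ← h] at h'
  exact h'

/-- Relabelling commutes with duality, so the upper rank of the dual and the size of the ground set
decide. -/
lemma rank_lower_map (σ : E ≃ F) (D : DeltaMatroid E) :
    rank (D.map σ).lower = rank D.lower := by
  have h1 := D.rank_lower_add
  have h2 := (D.map σ).rank_lower_add
  have e : (D.map σ).dual = D.dual.map σ := by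
    ext X
    rw [mem_dual]
    exact (D.mem_dual (σ ⁻¹' X)).symm
  rw [e, rank_upper_map] at h2
  rw [Nat.card_congr σ] at h1
  omega

end DeltaMatroid
end relabel

/-! ### Coranks of the minors of a matroid perspective -/

namespace MatPer
variable {E : Type u} [Finite E]

lemma corank_restrict (X : MatPer E) (A : Set E) :
    corank (matPer.restrict X A : MatPer A).M = A.ncard - rk X.M A :=
  (corank_eq (ground_M (matPer.restrict X A : MatPer A))).trans
    (by rw [rank_restrict_M, Nat.card_coe_set_eq])

lemma corank_contract (X : MatPer E) (A : Set E) :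
    corank (matPer.contract X A : MatPer (Aᶜ : Set E)).M =
      (Aᶜ : Set E).ncard - (rank X.M - rk X.M A) :=
  (corank_eq (ground_M (matPer.contract X A : MatPer (Aᶜ : Set E)))).trans
    (by rw [rank_contract_M, Nat.card_coe_set_eq])

lemma corank_add (X : MatPer E) (A : Set E) :
    corank X.M = (A.ncard - rk X.M A) + ((Aᶜ : Set E).ncard - (rank X.M - rk X.M A)) := by
  rw [← corank_restrict, ← corank_contract]
  have h1 := rank_add_corank (M := (matPer.restrict X A : MatPer A).M) (ground_M _)
  have h2 := rank_add_corank (M := (matPer.contract X A : MatPer (Aᶜ : Set E)).M) (ground_M _)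
  have h3 := rank_add_corank X.ground_M
  have h4 := rk_le_rank X.ground_M A
  have h5 := Set.ncard_add_ncard_compl A
  rw [rank_restrict_M, Nat.card_coe_set_eq] at h1
  rw [rank_contract_M, Nat.card_coe_set_eq] at h2
  omega

end MatPer

/-! ### The rank norms -/

/-- The norm of matroid perspectives that counts ranks. -/
noncomputable def matPerNorm : matPer.{u}.Norm (FreeCommMonoid Gen3) where
  toFun := fun {E} _ (X : MatPer E) =>
    .of .u ^ rank X.N * .of .v ^ corank X.M * .of .w ^ (rank X.M - rank X.N)
  map' := fun σ (X : MatPer _) => by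
    change FreeCommMonoid.of _ ^ rank (X.N.mapEquiv σ) * _ ^ corank (X.M.mapEquiv σ) *
      _ ^ (rank (X.M.mapEquiv σ) - rank (X.N.mapEquiv σ)) = _
    rw [rank_mapEquiv σ X.ground_M, rank_mapEquiv σ X.ground_N, corank_mapEquiv σ X.ground_M]
  mul' := fun {E} _ (X : MatPer E) A => by
    have h1 := X.rk_le_rk A
    have h2 := X.rk_add_rk_le A
    have h3 := X.corank_add A
    have h4 := rk_le_rank X.ground_M A
    have h5 := rk_le_rank X.ground_N A
    simp only [X.rank_restrict_M, X.rank_restrict_N, X.rank_contract_M, X.rank_contract_N,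
      X.corank_restrict, X.corank_contract]
    rw [mul_mul_mul_comm, mul_mul_mul_comm (_ ^ _), ← pow_add, ← pow_add, ← pow_add, h3]
    -- The perspective inequalities `h1`, `h2` and monotonicity `h4`, `h5` make every subtraction in
    -- the exponents of u and w exact.
    congr 3 <;> omega
  sum' _ _ := rfl
  one' := by
    have hM := rank_le_card (M := (matPer.{u}.one : MatPer _).M) (MatPer.ground_M _)
    have hN := rank_le_card (M := (matPer.{u}.one : MatPer _).N) (MatPer.ground_N _)
    have hc := rank_add_corank (M := (matPer.{u}.one : MatPer _).M) (MatPer.ground_M _)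
    rw [Nat.card_of_isEmpty] at hM hN hc
    have e1 : rank (matPer.{u}.one : MatPer _).M = 0 := by omega
    have e2 : rank (matPer.{u}.one : MatPer _).N = 0 := by omega
    have e3 : corank (matPer.{u}.one : MatPer _).M = 0 := by omega
    simp only [e1, e2, e3, pow_zero, mul_one, Nat.sub_self]

lemma matPerNorm_apply {E : Type u} [Finite E] (X : MatPer E) : matPerNorm.toFun (E := E) X =
    .of .u ^ rank X.N * .of .v ^ corank X.M * .of .w ^ (rank X.M - rank X.N) := rfl

/-- The norm of delta-matroids that counts ranks. -/
noncomputable def deltaMatNorm : deltaMat.{u}.Norm Mon3 where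
  toFun := fun {E} _ (D : DeltaMatroid E) =>
    Mon3.gen .u ^ rank D.lower * Mon3.gen .v ^ (Nat.card E - rank D.upper) *
      Mon3.gen .w ^ (rank D.upper - rank D.lower)
  map' := fun σ (D : DeltaMatroid _) => by
    change Mon3.gen _ ^ rank (D.map σ).lower * _ ^ (_ - rank (D.map σ).upper) *
      _ ^ (rank (D.map σ).upper - rank (D.map σ).lower) = _
    rw [D.rank_upper_map, D.rank_lower_map, Nat.card_congr σ]
  mul' := fun {E} _ (D : DeltaMatroid E) A => by
    change _ = (Mon3.gen _ ^ rank (D.restrict A).lower *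
      Mon3.gen _ ^ (Nat.card A - rank (D.restrict A).upper) *
      Mon3.gen _ ^ (rank (D.restrict A).upper - rank (D.restrict A).lower)) *
      (Mon3.gen _ ^ rank (D.contract A).lower *
      Mon3.gen _ ^ (Nat.card (Aᶜ : Set E) - rank (D.contract A).upper) *
      Mon3.gen _ ^ (rank (D.contract A).upper - rank (D.contract A).lower))
    rw [mul_mul_mul_comm, mul_mul_mul_comm (_ ^ _), ← pow_add, ← pow_add, ← pow_add]
    have h := D.twiceSigma_add A
    simp only [twiceSigma] at h
    have h1 := D.rank_lower_le_upper
    have h2 := (D.restrict A).rank_lower_le_upper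
    have h3 := (D.contract A).rank_lower_le_upper
    have h4 := rank_le_card (M := D.upper) rfl
    have h5 := rank_le_card (M := (D.restrict A).upper) rfl
    have h6 := rank_le_card (M := (D.contract A).upper) rfl
    have h7 := Set.ncard_add_ncard_compl A
    rw [← Nat.card_coe_set_eq, ← Nat.card_coe_set_eq] at h7
    -- The exponents themselves do not add up. Doubling those of u and v and adding that of w gives
    -- 2σ and twice the cardinality minus 2σ, which do by `h` and `h7`.
    exact pow_mul_pow_congr Mon3.gen_w_sq (by omega) (by omega)
  sum' _ _ := rfl
  one' := by
    have h1 := rank_le_card (M := DeltaMatroid.upper (deltaMat.{u}.one)) rfl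
    have h2 := DeltaMatroid.rank_lower_le_upper (deltaMat.{u}.one)
    rw [Nat.card_of_isEmpty] at h1
    have e1 : rank (DeltaMatroid.upper (deltaMat.{u}.one)) = 0 := by omega
    have e2 : rank (DeltaMatroid.lower (deltaMat.{u}.one)) = 0 := by omega
    simp only [e1, e2, pow_zero, mul_one, Nat.card_of_isEmpty, Nat.sub_self]

lemma deltaMatNorm_apply {E : Type u} [Finite E] (D : DeltaMatroid E) :
    deltaMatNorm.toFun (E := E) D =
      Mon3.gen .u ^ rank D.lower * Mon3.gen .v ^ (Nat.card E - rank D.upper) *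
        Mon3.gen .w ^ (rank D.upper - rank D.lower) := rfl

/-- The norm of delta-matroid perspectives that counts ranks. -/
noncomputable def deltaMatPerNorm : deltaMatPer.{u}.Norm Mon5 where
  toFun := fun {E} _ (P : DeltaMatPer E) =>
    Mon5.gen .s ^ (rank P.D.lower - rank P.N) * Mon5.gen .t ^ (rank P.M - rank P.D.upper) *
      Mon5.gen .u ^ rank P.N * Mon5.gen .v ^ corank P.M *
      Mon5.gen .w ^ (rank P.D.upper - rank P.D.lower)
  map' := fun σ (P : DeltaMatPer _) => by
    change Mon5.gen _ ^ (rank (P.D.map σ).lower - rank (P.N.mapEquiv σ)) *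
      Mon5.gen _ ^ (rank (P.M.mapEquiv σ) - rank (P.D.map σ).upper) *
      Mon5.gen _ ^ rank (P.N.mapEquiv σ) * Mon5.gen _ ^ corank (P.M.mapEquiv σ) *
      _ ^ (rank (P.D.map σ).upper - rank (P.D.map σ).lower) = _
    rw [P.D.rank_upper_map, P.D.rank_lower_map, rank_mapEquiv σ P.ground_M,
      rank_mapEquiv σ P.ground_N, corank_mapEquiv σ P.ground_M]
  mul' := fun {E} _ (P : DeltaMatPer E) A => by
    have r1 := P.toMatPer.rank_restrict_M A
    have r2 := P.toMatPer.rank_restrict_N A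
    have r3 := P.toMatPer.rank_contract_M A
    have r4 := P.toMatPer.rank_contract_N A
    have r5 := rk_le_rank P.ground_M A
    have r6 := rk_le_rank P.ground_N A
    have r7 := P.toMatPer.corank_restrict A
    have r8 := P.toMatPer.corank_contract A
    have r9 := P.toMatPer.corank_add A
    rw [← r7, ← r8] at r9
    have h := P.D.twiceSigma_add A
    simp only [twiceSigma] at h
    have h1 := P.D.rank_lower_le_upper
    have h2 := (P.D.restrict A).rank_lower_le_upper
    have h3 := (P.D.contract A).rank_lower_le_upper
    have h4 := P.rank_N_le
    have h5 := P.rank_upper_le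
    have h6 := DeltaMatPer.rank_N_le (deltaMatPer.restrict P A : DeltaMatPer A)
    have h7 := DeltaMatPer.rank_upper_le (deltaMatPer.restrict P A : DeltaMatPer A)
    have h8 := DeltaMatPer.rank_N_le (deltaMatPer.contract P A : DeltaMatPer (Aᶜ : Set E))
    have h9 := DeltaMatPer.rank_upper_le (deltaMatPer.contract P A : DeltaMatPer (Aᶜ : Set E))
    rw [DeltaMatPer.D_restrict] at h6 h7 ⊢
    rw [DeltaMatPer.D_contract] at h8 h9 ⊢
    change corank P.M = corank (deltaMatPer.restrict P A : DeltaMatPer A).M +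
      corank (deltaMatPer.contract P A : DeltaMatPer (Aᶜ : Set E)).M at r9
    change rank (deltaMatPer.restrict P A : DeltaMatPer A).M = rk P.M A at r1
    change rank (deltaMatPer.restrict P A : DeltaMatPer A).N = rk P.N A at r2
    change rank (deltaMatPer.contract P A : DeltaMatPer (Aᶜ : Set E)).M =
      rank P.M - rk P.M A at r3
    change rank (deltaMatPer.contract P A : DeltaMatPer (Aᶜ : Set E)).N =
      rank P.N - rk P.N A at r4
    -- The invariants to compare are 2σ − 2 rk(M') for s and 2 rk(M) − 2σ for t; both are additive
    -- by `h` and `r1`–`r4`.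
    exact pow_mul_pow_mul_congr Mon5.gen_w_sq (by omega) (by omega) (by omega) r9
  sum' _ _ := rfl
  one' := by
    have h1 := rank_le_card (M := (deltaMatPer.{u}.one : DeltaMatPer _).M)
      (DeltaMatPer.ground_M _)
    have h2 := DeltaMatPer.rank_upper_le (deltaMatPer.{u}.one : DeltaMatPer _)
    have h3 := DeltaMatroid.rank_lower_le_upper (deltaMatPer.{u}.one : DeltaMatPer _).D
    have h4 := DeltaMatPer.rank_N_le (deltaMatPer.{u}.one : DeltaMatPer _)
    have hc := rank_add_corank (M := (deltaMatPer.{u}.one : DeltaMatPer _).M)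
      (DeltaMatPer.ground_M _)
    rw [Nat.card_of_isEmpty] at h1 hc
    have e1 : rank (deltaMatPer.{u}.one : DeltaMatPer _).M = 0 := by omega
    have e2 : rank (deltaMatPer.{u}.one : DeltaMatPer _).D.upper = 0 := by omega
    have e3 : rank (deltaMatPer.{u}.one : DeltaMatPer _).D.lower = 0 := by omega
    have e4 : rank (deltaMatPer.{u}.one : DeltaMatPer _).N = 0 := by omega
    have e5 : corank (deltaMatPer.{u}.one : DeltaMatPer _).M = 0 := by omega
    simp only [e1, e2, e3, e4, e5, pow_zero, mul_one, Nat.sub_self]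

lemma deltaMatPerNorm_apply {E : Type u} [Finite E] (P : DeltaMatPer E) :
    deltaMatPerNorm.toFun (E := E) P =
      Mon5.gen .s ^ (rank P.D.lower - rank P.N) * Mon5.gen .t ^ (rank P.M - rank P.D.upper) *
        Mon5.gen .u ^ rank P.N * Mon5.gen .v ^ corank P.M *
        Mon5.gen .w ^ (rank P.D.upper - rank P.D.lower) := rfl

/-! ### Ranks of the one-element structures -/

lemma rank_coloopMat : rank coloopMat.{u} = 1 := rk_coloopMat
lemma rank_loopMat : rank loopMat.{u} = 0 := rk_loopMat

lemma ncard_univ_punit : (univ : Set PUnit.{u + 1}).ncard = 1 := by simp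

lemma rank_upper_coloopDelta : rank coloopDelta.{u}.upper = 1 :=
  (DeltaMatroid.rank_upper_eq (D := coloopDelta) (F := univ) rfl (by rintro _ rfl; rfl)).trans ncard_univ_punit

lemma rank_lower_coloopDelta : rank coloopDelta.{u}.lower = 1 :=
  (DeltaMatroid.rank_lower_eq (D := coloopDelta) (F := univ) rfl (by rintro _ rfl; rfl)).trans ncard_univ_punit

lemma rank_upper_loopDelta : rank loopDelta.{u}.upper = 0 :=
  (DeltaMatroid.rank_upper_eq (D := loopDelta) (F := ∅) rfl (by rintro _ rfl; rfl)).trans (ncard_empty _)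

lemma rank_lower_loopDelta : rank loopDelta.{u}.lower = 0 :=
  (DeltaMatroid.rank_lower_eq (D := loopDelta) (F := ∅) rfl (by rintro _ rfl; rfl)).trans (ncard_empty _)

lemma rank_upper_bothDelta : rank bothDelta.{u}.upper = 1 :=
  (DeltaMatroid.rank_upper_eq (D := bothDelta) (F := univ) (Or.inr rfl)
    fun _ _ => Set.ncard_le_ncard (subset_univ _)).trans ncard_univ_punit

lemma rank_lower_bothDelta : rank bothDelta.{u}.lower = 0 :=
  (DeltaMatroid.rank_lower_eq (D := bothDelta) (F := ∅) (Or.inl rfl) (by simp)).trans (ncard_empty _)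

/-- On a one-element set the four ranks determine the perspective, so a relabelling to the standard
point is an isomorphism onto `Y`. -/
lemma DeltaMatPer.cls_eq_cls_of_rank {E : Type u} [Finite E] (hE : Nat.card E = 1)
    (X : DeltaMatPer E) (Y : DeltaMatPer PUnit.{u + 1}) (hM : rank X.M = rank Y.M)
    (hN : rank X.N = rank Y.N) (hl : rank X.D.lower = rank Y.D.lower)
    (hu : rank X.D.upper = rank Y.D.upper) :
    deltaMatPer.cls (E := E) X = deltaMatPer.cls (E := PUnit) Y := by
  obtain ⟨_, ⟨a⟩⟩ := Nat.card_eq_one_iff_unique.1 hE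
  let σ : E ≃ PUnit.{u + 1} := ⟨fun _ => ⟨⟩, fun _ => a, fun _ => Subsingleton.elim _ _, fun _ => rfl⟩
  have h : X.map σ = Y := DeltaMatPer.ext_rank
    ((rank_mapEquiv σ X.ground_M).trans hM) ((rank_mapEquiv σ X.ground_N).trans hN)
    ((X.D.rank_lower_map σ).trans hl) ((X.D.rank_upper_map σ).trans hu)
  rw [← h]
  exact (deltaMatPer.universalNorm.map' σ X).symm

/-! ### The relation in the Grothendieck monoid of delta-matroid perspectives -/

section free
variable {E : Type u} [Finite E]

lemma rk_freeOn (X : Set E) : rk (Matroid.freeOn univ) X = X.ncard := by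
  rw [rk, Matroid.eRk_freeOn (subset_univ X), Set.ncard_def]

lemma rk_loopyOn (X : Set E) : rk (Matroid.loopyOn (univ : Set E)) X = 0 := by simp [rk]

/-- The largest delta-matroid perspective with a given delta-matroid. -/
def DeltaMatPer.ofDelta (D : DeltaMatroid E) : DeltaMatPer E where
  M := Matroid.freeOn univ
  D := D
  N := Matroid.loopyOn univ
  ground_M := rfl
  ground_N := rfl
  persp_upper X Y hXY := by
    have h := rk_submod D.upper X (Y \ X)
    rw [union_sdiff_cancel hXY] at h
    have h1 := rk_le_ncard D.upper (Y \ X)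
    have h2 := Set.ncard_sdiff_add_ncard_of_subset hXY
    rw [rk_freeOn, rk_freeOn]
    omega
  persp_lower X Y hXY := by
    have := rk_mono D.lower hXY
    rw [rk_loopyOn, rk_loopyOn]
    omega

/-- Applied to a suitable twist, this turns feasibility of any given set into a condition on an
upper rank. -/
lemma DeltaMatroid.rank_upper_eq_card_iff (D : DeltaMatroid E) :
    rank D.upper = Nat.card E ↔ univ ∈ D.feasible := by
  rw [← Set.ncard_univ]
  constructor
  · intro h
    obtain ⟨F, hF, hc, -⟩ := D.exists_rank_upper
    rwa [← Set.eq_of_subset_of_ncard_le (subset_univ F) (by rw [hc, h])]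
  · intro h
    exact DeltaMatroid.rank_upper_eq h fun _ _ => Set.ncard_le_ncard (subset_univ _)

/-- The ranks of the one-element minors of a delta-matroid on two elements in which the
empty set and the ground set are feasible. -/
lemma DeltaMatroid.rank_minors_pair (hE : Nat.card E = 2) (D : DeltaMatroid E)
    (h0 : ∅ ∈ D.feasible) (h1 : univ ∈ D.feasible) (x : E) :
    rank (D.restrict {x}).lower = 0 ∧ rank (D.contract {x}).upper = 1 ∧
      rank (D.restrict {x}).upper + rank (D.contract {x}).lower = 1 ∧
      (rank (D.restrict {x}).upper = 1 ↔ {x} ∈ D.feasible) := by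
  have hl : rank D.lower = 0 :=
    (DeltaMatroid.rank_lower_eq h0 (by simp)).trans (ncard_empty _)
  have hu := D.rank_upper_eq_card_iff.2 h1
  have hx : ({x} : Set E).ncard = 1 := ncard_singleton x
  have a1 := D.rank_lower_restrict {x}
  have a2 := rk_le_rank D.lower_ground {x}
  have a3 := D.rank_upper_contract {x}
  have a4 := rk_le_ncard D.upper {x}
  have a5 := rank_le_card (D.contract {x}).upper_ground
  have a6 := D.twiceSigma_add {x}
  have a7 := Set.ncard_add_ncard_compl ({x} : Set E)
  rw [Nat.card_coe_set_eq] at a5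
  have a8 := D.rank_upper_restrict {x}
  have a9 := rk_dual (M := D.dual.upper) rfl {x}
  rw [← lower_eq] at a9
  change rk D.lower _ + rank D.dual.upper = _ at a9
  have a10 := D.rank_lower_add
  simp only [twiceSigma] at a6
  refine ⟨by omega, by omega, by omega, ?_⟩
  -- The twist by `{x}ᶜ` has the ground set feasible exactly when `{x}` is feasible in `D`. Since ∅
  -- is feasible in `D`, the dual has a free upper matroid, and by `a8` the upper rank of `D|{x}` is
  -- 1 exactly when that of the twist is full.
  have e : (univ : Set E) ∆ {x}ᶜ = {x} := by ext y; simp [mem_symmDiff]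
  have a11 := (D.twist {x}ᶜ).rank_upper_eq_card_iff
  rw [mem_twist, e] at a11
  rw [← a11]
  omega

/-- Splitting off `x` leaves two points of the form (c, ·, l), as M is free and N has rank zero. If
`{x}` is feasible, both delta-matroids are n; otherwise the restriction is a loop and the
contraction a coloop. -/
lemma cls_ofDelta_pair (hE : Nat.card E = 2) (D : DeltaMatroid E)
    (h0 : ∅ ∈ D.feasible) (h1 : univ ∈ D.feasible) (x : E) :
    ({x} ∈ D.feasible → deltaMatPer.cls (E := E) (DeltaMatPer.ofDelta D) = genClass .w ^ 2) ∧
    ({x} ∉ D.feasible →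
      deltaMatPer.cls (E := E) (DeltaMatPer.ofDelta D) = genClass .s * genClass .t) := by
  obtain ⟨a1, a2, a3, a4⟩ := D.rank_minors_pair hE h0 h1 x
  set P := DeltaMatPer.ofDelta D with hP
  have hx : ({x} : Set E).ncard = 1 := ncard_singleton x
  have b1 : rank (deltaMatPer.restrict P {x} : DeltaMatPer ({x} : Set E)).M = 1 :=
    (P.toMatPer.rank_restrict_M {x}).trans ((rk_freeOn _).trans hx)
  have b2 : rank (deltaMatPer.restrict P {x} : DeltaMatPer ({x} : Set E)).N = 0 :=
    (P.toMatPer.rank_restrict_N {x}).trans (rk_loopyOn _)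
  have b3 : rank (deltaMatPer.contract P {x} : DeltaMatPer ({x}ᶜ : Set E)).M = 1 := by
    refine (P.toMatPer.rank_contract_M {x}).trans ?_
    change rk (Matroid.freeOn univ) univ - rk (Matroid.freeOn univ) {x} = 1
    rw [rk_freeOn, rk_freeOn, hx, ncard_univ, hE]
  have b4 : rank (deltaMatPer.contract P {x} : DeltaMatPer ({x}ᶜ : Set E)).N = 0 := by
    refine (P.toMatPer.rank_contract_N {x}).trans ?_
    change rk (Matroid.loopyOn univ) univ - _ = 0
    rw [rk_loopyOn, Nat.zero_sub]
  have c1 : Nat.card ({x} : Set E) = 1 := by rw [Nat.card_coe_set_eq, hx]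
  have c2 : Nat.card ({x}ᶜ : Set E) = 1 := by
    have := Set.ncard_add_ncard_compl ({x} : Set E)
    rw [Nat.card_coe_set_eq]; omega
  have hm : deltaMatPer.cls (E := E) P =
    deltaMatPer.cls (deltaMatPer.restrict P {x}) * deltaMatPer.cls (deltaMatPer.contract P {x}) :=
    deltaMatPer.universalNorm.mul' (E := E) P {x}
  rw [hm]
  constructor
  · intro h
    have h' := a4.2 h
    rw [sq]
    congr 1
    · exact DeltaMatPer.cls_eq_cls_of_rank c1 _ cnl (b1.trans rank_coloopMat.symm)
        (b2.trans rank_loopMat.symm) (a1.trans rank_lower_bothDelta.symm)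
        (h'.trans rank_upper_bothDelta.symm)
    · exact DeltaMatPer.cls_eq_cls_of_rank c2 _ cnl (b3.trans rank_coloopMat.symm)
        (b4.trans rank_loopMat.symm)
        ((by omega : rank (D.contract {x}).lower = 0).trans rank_lower_bothDelta.symm)
        (a2.trans rank_upper_bothDelta.symm)
  · intro h
    have h' : rank (D.restrict {x}).upper = 0 := by
      have := mt a4.1 h
      omega
    -- The restriction contributes t and the contraction s, so the factors appear in the order
    -- opposite to that of the claim.
    rw [mul_comm]
    congr 1
    · exact DeltaMatPer.cls_eq_cls_of_rank c2 _ ccl (b3.trans rank_coloopMat.symm)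
        (b4.trans rank_loopMat.symm)
        ((by omega : rank (D.contract {x}).lower = 1).trans rank_lower_coloopDelta.symm)
        (a2.trans rank_upper_coloopDelta.symm)
    · exact DeltaMatPer.cls_eq_cls_of_rank c1 _ cll (b1.trans rank_coloopMat.symm)
        (b2.trans rank_loopMat.symm) (a1.trans rank_lower_loopDelta.symm)
        (h'.trans rank_upper_loopDelta.symm)

end free

/-- The delta-matroid on two elements whose feasible sets form a maximal chain. -/
def chainDelta : DeltaMatroid (ULift.{u} Bool) where
  feasible := {F | ⟨true⟩ ∈ F → ⟨false⟩ ∈ F}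
  nonempty := ⟨∅, fun h => h.elim⟩
  exchange := by
    intro X hX Y hY x hx
    have hne : (⟨true⟩ : ULift.{u} Bool) ≠ ⟨false⟩ := by simp
    have hne' : (⟨false⟩ : ULift.{u} Bool) ≠ ⟨true⟩ := by simp
    simp only [mem_ofPred_eq, mem_symmDiff, mem_insert_iff, mem_singleton_iff] at *
    -- If changing `x` alone leaves the chain, then `X` and `Y` are ∅ and the whole set in some
    -- order, so the other element may be changed too.
    by_cases h : ((⟨true⟩ : ULift.{u} Bool) ∈ X ∆ {x} → ⟨false⟩ ∈ X ∆ {x})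
    · simp only [mem_symmDiff, mem_singleton_iff] at h
      exact ⟨x, hx, by tauto⟩
    · simp only [mem_symmDiff, mem_singleton_iff] at h
      obtain ⟨_ | _⟩ := x
      · exact ⟨⟨true⟩, by tauto, by tauto⟩
      · exact ⟨⟨false⟩, by tauto, by tauto⟩

/-- In the chain ∅ ⊂ {false} ⊂ {false, true} the singleton of `false` is feasible and that of `true`
is not. Splitting off the one or the other gives the two sides as values of the same class. -/
lemma genClass_w_sq : genClass.{u} .w ^ 2 = genClass .s * genClass .t := by
  have hc : Nat.card (ULift.{u} Bool) = 2 := by simp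
  have h0 : ∅ ∈ chainDelta.{u}.feasible := fun h => h.elim
  have h1 : univ ∈ chainDelta.{u}.feasible := fun _ => trivial
  rw [← (cls_ofDelta_pair hc chainDelta h0 h1 ⟨false⟩).1 fun _ => rfl]
  exact (cls_ofDelta_pair hc chainDelta h0 h1 ⟨true⟩).2 fun h => by simpa using h rfl

/-! ### The three Grothendieck monoids -/

/-- The homomorphism from `Mon5` to the Grothendieck monoid given by the generators. -/
noncomputable def ofMon5 : Mon5 →* deltaMatPer.{u}.Groth := Mon5.lift genClass genClass_w_sq

lemma ofMon5_gen (g : Gen5) : ofMon5.{u} (Mon5.gen g) = genClass g := Mon5.lift_gen _ _ g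

lemma rank_punit_eq {M : Matroid PUnit.{u + 1}} (hM : M.E = univ) : rank M = 0 ∨ rank M = 1 := by
  have := rank_le_card hM
  rw [Nat.card_unique] at this
  omega

/-- The ranks of N, the lower matroid, the upper matroid and M form a weakly increasing 0/1 sequence
of length four. There are five of these, one for each generator. -/
lemma deltaMatPerNorm_punit (X : DeltaMatPer PUnit.{u + 1}) :
    ∃ g, deltaMatPerNorm.toFun (E := PUnit) X = Mon5.gen g ∧
      deltaMatPer.cls (E := PUnit) X = genClass g := by
  have h1 := X.rank_N_le
  have h2 := X.D.rank_lower_le_upper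
  have h3 := X.rank_upper_le
  have hc := rank_add_corank X.ground_M
  rw [Nat.card_unique] at hc
  rw [deltaMatPerNorm_apply]
  have key := DeltaMatPer.cls_eq_cls_of_rank Nat.card_unique X
  rcases rank_punit_eq X.ground_M with m | m <;>
  rcases rank_punit_eq X.ground_N with n | n <;>
  rcases rank_punit_eq X.D.upper_ground with r | r <;>
  rcases rank_punit_eq X.D.lower_ground with l | l <;>
  -- Of the sixteen rank vectors, `omega` removes the eleven that are not increasing. The cases left
  -- are v, t, w, s, u, in this order.
  first
  | omega
  | skip
  · have c : corank X.M = 1 := by omega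
    exact ⟨.v, by simp [m, n, r, l, c], key lll (m.trans rank_loopMat.symm)
      (n.trans rank_loopMat.symm) (l.trans rank_lower_loopDelta.symm)
      (r.trans rank_upper_loopDelta.symm)⟩
  · have c : corank X.M = 0 := by omega
    exact ⟨.t, by simp [m, n, r, l, c], key cll (m.trans rank_coloopMat.symm)
      (n.trans rank_loopMat.symm) (l.trans rank_lower_loopDelta.symm)
      (r.trans rank_upper_loopDelta.symm)⟩
  · have c : corank X.M = 0 := by omega
    exact ⟨.w, by simp [m, n, r, l, c], key cnl (m.trans rank_coloopMat.symm)
      (n.trans rank_loopMat.symm) (l.trans rank_lower_bothDelta.symm)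
      (r.trans rank_upper_bothDelta.symm)⟩
  · have c : corank X.M = 0 := by omega
    exact ⟨.s, by simp [m, n, r, l, c], key ccl (m.trans rank_coloopMat.symm)
      (n.trans rank_loopMat.symm) (l.trans rank_lower_coloopDelta.symm)
      (r.trans rank_upper_coloopDelta.symm)⟩
  · have c : corank X.M = 0 := by omega
    exact ⟨.u, by simp [m, n, r, l, c], key ccc (m.trans rank_coloopMat.symm)
      (n.trans rank_coloopMat.symm) (l.trans rank_lower_coloopDelta.symm)
      (r.trans rank_upper_coloopDelta.symm)⟩

lemma deltaMatPerNorm_lift_genClass (g : Gen5) :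
    deltaMatPerNorm.{u}.lift (genClass g) = Mon5.gen g := by
  have cM : corank coloopMat.{u} = 0 :=
    (corank_eq rfl).trans (by rw [rank_coloopMat, Nat.card_unique])
  have cL : corank loopMat.{u} = 1 :=
    (corank_eq rfl).trans (by rw [rank_loopMat, Nat.card_unique])
  have h : ∀ X : DeltaMatPer PUnit.{u + 1}, deltaMatPerNorm.lift (deltaMatPer.cls (E := PUnit) X) =
      _ := fun X => (deltaMatPerNorm.lift_cls (E := PUnit) X).trans (deltaMatPerNorm_apply X)
  cases g <;> refine (h _).trans ?_ <;>
    simp [ccl, cll, ccc, lll, cnl, rank_coloopMat, rank_loopMat, rank_upper_coloopDelta,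
      rank_lower_coloopDelta, rank_upper_loopDelta, rank_lower_loopDelta, rank_upper_bothDelta,
      rank_lower_bothDelta, cM, cL]

/-- The Grothendieck monoid of delta-matroid perspectives. -/
noncomputable def grothDeltaMatPer : deltaMatPer.{u}.Groth ≃* Mon5 :=
  MonoidHom.toMulEquiv deltaMatPerNorm.lift ofMon5
    (deltaMatPerNorm.leftInverse_lift ofMon5 fun X => by
      obtain ⟨g, h, h'⟩ := deltaMatPerNorm_punit X
      exact (congrArg ofMon5 h).trans ((ofMon5_gen g).trans h'.symm))
    (Mon5.hom_ext fun g => by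
      rw [MonoidHom.comp_apply, ofMon5_gen, deltaMatPerNorm_lift_genClass, MonoidHom.id_apply])

lemma grothDeltaMatPer_genClass (g : Gen5) :
    grothDeltaMatPer.{u} (genClass g) = Mon5.gen g := deltaMatPerNorm_lift_genClass g

lemma grothDeltaMatPer_symm_gen (g : Gen5) :
    grothDeltaMatPer.{u}.symm (Mon5.gen g) = genClass g := ofMon5_gen g

lemma grothDeltaMatPer_cls {E : Type u} [Finite E] (P : DeltaMatPer E) :
    grothDeltaMatPer (deltaMatPer.cls (E := E) P) =
      Mon5.gen .s ^ (rank P.D.lower - rank P.N) * Mon5.gen .t ^ (rank P.M - rank P.D.upper) *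
        Mon5.gen .u ^ rank P.N * Mon5.gen .v ^ corank P.M *
        Mon5.gen .w ^ (rank P.D.upper - rank P.D.lower) :=
  deltaMatPerNorm.lift_cls (E := E) P

/-- The five classes generate, as they correspond to the generators of `Mon5` under the isomorphism.
-/
lemma groth_deltaMatPer_hom_ext {M : Type*} [CommMonoid M] {f g : deltaMatPer.{u}.Groth →* M}
    (h : ∀ a, f (genClass a) = g (genClass a)) : f = g := by
  have : f.comp grothDeltaMatPer.symm.toMonoidHom = g.comp grothDeltaMatPer.symm.toMonoidHom :=
    Mon5.hom_ext fun a => by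
      change f (grothDeltaMatPer.symm _) = g (grothDeltaMatPer.symm _)
      rw [grothDeltaMatPer_symm_gen, h]
  refine MonoidHom.ext fun x => ?_
  simpa using DFunLike.congr_fun this (grothDeltaMatPer x)

/-- The generators of the Grothendieck monoid of matroid perspectives. -/
noncomputable def genClassMatPer : Gen3 → matPer.{u}.Groth
  | .u => matPer.cls cc
  | .v => matPer.cls ll
  | .w => matPer.cls cl

/-- The inequality rk(N) ≤ rk(M) excludes only the pair of a loop followed by a coloop, which leaves
three cases. -/
lemma matPerNorm_punit (X : MatPer PUnit.{u + 1}) :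
    ∃ g, matPerNorm.toFun (E := PUnit) X = .of g ∧
      matPer.cls (E := PUnit) X = genClassMatPer g := by
  have h1 := X.rank_le
  have hc := rank_add_corank X.ground_M
  rw [Nat.card_unique] at hc
  rw [matPerNorm_apply]
  have key : ∀ Y : MatPer PUnit.{u + 1}, rank X.M = rank Y.M → rank X.N = rank Y.N →
      matPer.cls (E := PUnit) X = matPer.cls (E := PUnit) Y :=
    fun Y hM hN => by rw [MatPer.ext_rank hM hN]
  rcases rank_punit_eq X.ground_M with m | m <;>
  rcases rank_punit_eq X.ground_N with n | n <;>
  first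
  | omega
  | skip
  · have c : corank X.M = 1 := by omega
    exact ⟨.v, by simp [m, n, c], key ll (m.trans rank_loopMat.symm) (n.trans rank_loopMat.symm)⟩
  · have c : corank X.M = 0 := by omega
    exact ⟨.w, by simp [m, n, c], key cl (m.trans rank_coloopMat.symm)
      (n.trans rank_loopMat.symm)⟩
  · have c : corank X.M = 0 := by omega
    exact ⟨.u, by simp [m, n, c], key cc (m.trans rank_coloopMat.symm)
      (n.trans rank_coloopMat.symm)⟩

lemma matPerNorm_lift_genClassMatPer (g : Gen3) :
    matPerNorm.{u}.lift (genClassMatPer g) = .of g := by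
  have cM : corank coloopMat.{u} = 0 :=
    (corank_eq rfl).trans (by rw [rank_coloopMat, Nat.card_unique])
  have cL : corank loopMat.{u} = 1 :=
    (corank_eq rfl).trans (by rw [rank_loopMat, Nat.card_unique])
  have h : ∀ X : MatPer PUnit.{u + 1}, matPerNorm.lift (matPer.cls (E := PUnit) X) =
      _ := fun X => (matPerNorm.lift_cls (E := PUnit) X).trans (matPerNorm_apply X)
  cases g <;> refine (h _).trans ?_ <;>
    simp [cc, ll, cl, rank_coloopMat, rank_loopMat, cM, cL]

/-- The Grothendieck monoid of matroid perspectives. -/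
noncomputable def grothMatPer : matPer.{u}.Groth ≃* FreeCommMonoid Gen3 :=
  MonoidHom.toMulEquiv matPerNorm.lift (FreeCommMonoid.lift genClassMatPer)
    (matPerNorm.leftInverse_lift _ fun X => by
      obtain ⟨g, h, h'⟩ := matPerNorm_punit X
      exact (congrArg _ h).trans ((FreeCommMonoid.lift_of _ g).trans h'.symm))
    (FreeCommMonoid.hom_ext fun g => by
      rw [MonoidHom.comp_apply, FreeCommMonoid.lift_of, matPerNorm_lift_genClassMatPer,
        MonoidHom.id_apply])

/-- The generators of the Grothendieck monoid of delta-matroids. -/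
noncomputable def genClassDeltaMat : Gen3 → deltaMat.{u}.Groth
  | .u => deltaMat.cls coloopDelta
  | .v => deltaMat.cls loopDelta
  | .w => deltaMat.cls bothDelta

/-- Forgetting the two matroids sends s, t, w to the classes of c, l, n, so the relation w² = st is
carried over. -/
lemma genClassDeltaMat_w_sq :
    genClassDeltaMat.{u} .w ^ 2 = genClassDeltaMat .u * genClassDeltaMat .v := by
  have h := congrArg homDeltaMat.{u}.groth genClass_w_sq
  rw [map_mul, map_pow] at h
  have e : ∀ X : DeltaMatPer PUnit.{u + 1}, homDeltaMat.groth (deltaMatPer.cls (E := PUnit) X) =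
    deltaMat.cls (E := PUnit) X.D := fun X => homDeltaMat.groth_cls (E := PUnit) X
  simp only [genClass] at h
  rw [e, e, e] at h
  exact h

/-- The homomorphism from `Mon3` to the Grothendieck monoid given by the generators. -/
noncomputable def ofMon3 : Mon3 →* deltaMat.{u}.Groth :=
  Mon3.lift genClassDeltaMat genClassDeltaMat_w_sq

lemma ofMon3_gen (g : Gen3) : ofMon3.{u} (Mon3.gen g) = genClassDeltaMat g := Mon3.lift_gen _ _ g

lemma deltaMatNorm_punit (X : DeltaMatroid PUnit.{u + 1}) :
    ∃ g, deltaMatNorm.toFun (E := PUnit) X = Mon3.gen g ∧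
      deltaMat.cls (E := PUnit) X = genClassDeltaMat g := by
  have h1 := X.rank_lower_le_upper
  rw [deltaMatNorm_apply, Nat.card_unique]
  have key : ∀ Y : DeltaMatroid PUnit.{u + 1}, rank X.lower = rank Y.lower →
      rank X.upper = rank Y.upper →
      deltaMat.cls (E := PUnit) X = deltaMat.cls (E := PUnit) Y :=
    fun Y hM hN => by rw [DeltaMatroid.ext_rank hM hN]
  rcases rank_punit_eq X.lower_ground with l | l <;>
  rcases rank_punit_eq X.upper_ground with r | r <;>
  first
  | omega
  | skip
  · exact ⟨.v, by simp [l, r], key loopDelta (l.trans rank_lower_loopDelta.symm)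
      (r.trans rank_upper_loopDelta.symm)⟩
  · exact ⟨.w, by simp [l, r], key bothDelta (l.trans rank_lower_bothDelta.symm)
      (r.trans rank_upper_bothDelta.symm)⟩
  · exact ⟨.u, by simp [l, r], key coloopDelta (l.trans rank_lower_coloopDelta.symm)
      (r.trans rank_upper_coloopDelta.symm)⟩

lemma deltaMatNorm_lift_genClassDeltaMat (g : Gen3) :
    deltaMatNorm.{u}.lift (genClassDeltaMat g) = Mon3.gen g := by
  have h : ∀ X : DeltaMatroid PUnit.{u + 1}, deltaMatNorm.lift (deltaMat.cls (E := PUnit) X) =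
      _ := fun X => (deltaMatNorm.lift_cls (E := PUnit) X).trans (deltaMatNorm_apply X)
  cases g <;> refine (h _).trans ?_ <;>
    simp [rank_upper_coloopDelta, rank_lower_coloopDelta, rank_upper_loopDelta,
      rank_lower_loopDelta, rank_upper_bothDelta, rank_lower_bothDelta]

/-- The Grothendieck monoid of delta-matroids. -/
noncomputable def grothDeltaMat : deltaMat.{u}.Groth ≃* Mon3 :=
  MonoidHom.toMulEquiv deltaMatNorm.lift ofMon3
    (deltaMatNorm.leftInverse_lift _ fun X => by
      obtain ⟨g, h, h'⟩ := deltaMatNorm_punit X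
      exact (congrArg _ h).trans ((ofMon3_gen g).trans h'.symm))
    (Mon3.hom_ext fun g => by
      rw [MonoidHom.comp_apply, ofMon3_gen, deltaMatNorm_lift_genClassDeltaMat,
        MonoidHom.id_apply])

/-! ### The Grothendieck monoids as quotients of the one of delta-matroid perspectives -/

lemma homMatPer_groth_cls (X : DeltaMatPer PUnit.{u + 1}) :
    homMatPer.groth (deltaMatPer.cls (E := PUnit) X) = matPer.cls (E := PUnit) X.toMatPer :=
  homMatPer.groth_cls (E := PUnit) X

lemma homDeltaMat_groth_cls (X : DeltaMatPer PUnit.{u + 1}) :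
    homDeltaMat.groth (deltaMatPer.cls (E := PUnit) X) = deltaMat.cls (E := PUnit) X.D :=
  homDeltaMat.groth_cls (E := PUnit) X

/-- The image of a generator under `homMatPer`. -/
def Gen5.toMatPer : Gen5 → Gen3
  | .s => .w
  | .t => .w
  | .u => .u
  | .v => .v
  | .w => .w

/-- The image of a generator under `homDeltaMat`. -/
def Gen5.toDeltaMat : Gen5 → Gen3
  | .s => .u
  | .t => .v
  | .u => .u
  | .v => .v
  | .w => .w

lemma homMatPer_groth_genClass (g : Gen5) :
    homMatPer.{u}.groth (genClass g) = genClassMatPer g.toMatPer := by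
  cases g <;> exact homMatPer_groth_cls _

lemma homDeltaMat_groth_genClass (g : Gen5) :
    homDeltaMat.{u}.groth (genClass g) = genClassDeltaMat g.toDeltaMat := by
  cases g <;> exact homDeltaMat_groth_cls _

/-- A section of the two maps on generators. -/
def Gen3.toGen5 : Gen3 → Gen5
  | .u => .u
  | .v => .v
  | .w => .w

/-- The target is free on u, v, w, so a map back is obtained by choosing the classes of the same
name. The two maps are inverse to each other on generators. -/
lemma exists_mulEquiv_matPer : ∃ e : (conGen RelMatPer.{u}).Quotient ≃* matPer.{u}.Groth,
    ∀ p : deltaMatPer.{u}.Groth, e (Con.mk' (conGen RelMatPer) p) = homMatPer.groth p := by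
  let q : deltaMatPer.{u}.Groth →* (conGen RelMatPer.{u}).Quotient := Con.mk' _
  have hst : q (genClass .s) = q (genClass .t) :=
    (Con.eq _).2 (ConGen.Rel.of _ _ RelMatPer.st)
  have htw : q (genClass .t) = q (genClass .w) :=
    (Con.eq _).2 (ConGen.Rel.of _ _ RelMatPer.tw)
  let f : (conGen RelMatPer.{u}).Quotient →* matPer.{u}.Groth :=
    Con.lift _ homMatPer.groth (Con.conGen_le.2 (by
      rintro _ _ h
      rw [Con.ker_rel]
      cases h <;> simp only [homMatPer_groth_genClass] <;> rfl))
  have hf : ∀ p, f (q p) = homMatPer.groth p := fun p => rfl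
  let g : matPer.{u}.Groth →* (conGen RelMatPer.{u}).Quotient :=
    (FreeCommMonoid.lift fun a => q (genClass a.toGen5)).comp grothMatPer.toMonoidHom
  have hg : ∀ a, g (genClassMatPer a) = q (genClass a.toGen5) := fun a => by
    change FreeCommMonoid.lift _ (matPerNorm.lift _) = _
    rw [matPerNorm_lift_genClassMatPer, FreeCommMonoid.lift_of]
  have hgf : (g.comp f).comp q = q := groth_deltaMatPer_hom_ext (M := (conGen RelMatPer.{u}).Quotient)
    (f := (g.comp f).comp q) (g := q) fun a => by
    change g (homMatPer.groth (genClass a)) = q (genClass a)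
    rw [homMatPer_groth_genClass, hg]
    -- Only s and t are moved by going to the target and back; both become w, to which the quotient
    -- identifies them.
    cases a
    · exact (hst.trans htw).symm
    · exact htw.symm
    all_goals rfl
  refine ⟨MonoidHom.toMulEquiv f g (Con.hom_ext hgf) ?_, hf⟩
  · have : (f.comp g).comp grothMatPer.symm.toMonoidHom = grothMatPer.symm.toMonoidHom :=
      FreeCommMonoid.hom_ext fun a => by
        have ha : grothMatPer.symm (.of a) = genClassMatPer a := FreeCommMonoid.lift_of _ a
        change f (g (grothMatPer.symm (.of a))) = grothMatPer.symm (.of a)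
        rw [ha, hg, hf, homMatPer_groth_genClass]
        cases a <;> rfl
    refine MonoidHom.ext fun x => ?_
    simpa using DFunLike.congr_fun this (grothMatPer x)

/-- The target is no longer free, so the map back exists only because its single relation already
holds in the quotient. -/
lemma exists_mulEquiv_deltaMat : ∃ e : (conGen RelDeltaMat.{u}).Quotient ≃* deltaMat.{u}.Groth,
    ∀ p : deltaMatPer.{u}.Groth, e (Con.mk' (conGen RelDeltaMat) p) = homDeltaMat.groth p := by
  let q : deltaMatPer.{u}.Groth →* (conGen RelDeltaMat.{u}).Quotient := Con.mk' _
  have hsu : q (genClass .s) = q (genClass .u) :=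
    (Con.eq _).2 (ConGen.Rel.of _ _ RelDeltaMat.su)
  have htv : q (genClass .t) = q (genClass .v) :=
    (Con.eq _).2 (ConGen.Rel.of _ _ RelDeltaMat.tv)
  let f : (conGen RelDeltaMat.{u}).Quotient →* deltaMat.{u}.Groth :=
    Con.lift _ homDeltaMat.groth (Con.conGen_le.2 (by
      rintro _ _ h
      rw [Con.ker_rel]
      cases h <;> simp only [homDeltaMat_groth_genClass] <;> rfl))
  have hf : ∀ p, f (q p) = homDeltaMat.groth p := fun p => rfl
  -- Once s = u and t = v are imposed, w² = st reads w² = uv, the relation of `Mon3`.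
  have hw : q (genClass .w) ^ 2 = q (genClass .u) * q (genClass .v) := by
    rw [← hsu, ← htv, ← map_mul, ← genClass_w_sq, map_pow]
  let g : deltaMat.{u}.Groth →* (conGen RelDeltaMat.{u}).Quotient :=
    (Mon3.lift (fun a => q (genClass a.toGen5)) hw).comp grothDeltaMat.toMonoidHom
  have hg : ∀ a, g (genClassDeltaMat a) = q (genClass a.toGen5) := fun a => by
    change Mon3.lift _ hw (deltaMatNorm.lift _) = _
    rw [deltaMatNorm_lift_genClassDeltaMat]
    exact Mon3.lift_gen _ hw a
  have hgf : (g.comp f).comp q = q := groth_deltaMatPer_hom_ext (M := (conGen RelDeltaMat.{u}).Quotient)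
    (f := (g.comp f).comp q) (g := q) fun a => by
    change g (homDeltaMat.groth (genClass a)) = q (genClass a)
    rw [homDeltaMat_groth_genClass, hg]
    cases a
    · exact hsu.symm
    · exact htv.symm
    all_goals rfl
  refine ⟨MonoidHom.toMulEquiv f g (Con.hom_ext hgf) ?_, hf⟩
  · have : (f.comp g).comp grothDeltaMat.symm.toMonoidHom = grothDeltaMat.symm.toMonoidHom :=
      Mon3.hom_ext fun a => by
        have ha : grothDeltaMat.symm (Mon3.gen a) = genClassDeltaMat a := ofMon3_gen a
        change f (g (grothDeltaMat.symm (Mon3.gen a))) = grothDeltaMat.symm (Mon3.gen a)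
        rw [ha, hg, hf, homDeltaMat_groth_genClass]
        cases a <;> rfl
    refine MonoidHom.ext fun x => ?_
    simpa using DFunLike.congr_fun this (grothDeltaMat x)

/-! ### The ring of the universal Tutte character -/

section rings
open MvPolynomial
variable (K : Type*) [CommRing K]

lemma tvar_w_sq (i : Fin 2) : tvar K .w i ^ 2 = tvar K .s i * tvar K .t i := by
  rw [tvar, tvar, tvar, ← map_pow, ← map_mul]
  exact Ideal.Quotient.eq.2 (Ideal.subset_span ⟨i, rfl⟩)

/-- The two homomorphisms from `Mon5` to the ring of the universal Tutte character. -/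
noncomputable def monTutte (i : Fin 2) : Mon5 →* TutteRing K :=
  Mon5.lift (fun g => tvar K g i) (tvar_w_sq K i)

lemma monTutte_gen (i : Fin 2) (g : Gen5) : monTutte K i (Mon5.gen g) = tvar K g i :=
  Mon5.lift_gen _ (tvar_w_sq K i) g

lemma TutteRing.algHom_ext {R : Type*} [CommRing R] [Algebra K R] {f g : TutteRing K →ₐ[K] R}
    (h : ∀ a i, f (tvar K a i) = g (tvar K a i)) : f = g :=
  Ideal.Quotient.algHom_ext K (MvPolynomial.algHom_ext fun ⟨a, i⟩ => h a i)

/-- Homomorphisms out of `TutteRing K`. -/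
noncomputable def TutteRing.lift {R : Type*} [CommRing R] [Algebra K R] (z : Gen5 × Fin 2 → R)
    (h : ∀ i, z (.w, i) ^ 2 = z (.s, i) * z (.t, i)) : TutteRing K →ₐ[K] R :=
  Ideal.Quotient.liftₐ (tutteIdeal K) (aeval z) (by
    intro a ha
    have : tutteIdeal K ≤ RingHom.ker (aeval (R := K) z) := by
      rw [tutteIdeal, Ideal.span_le]
      rintro _ ⟨i, rfl⟩
      simp only [SetLike.mem_coe, RingHom.mem_ker, map_sub, map_mul, map_pow, aeval_X, h, sub_self]
    exact this ha)

lemma TutteRing.lift_tvar {R : Type*} [CommRing R] [Algebra K R] (z : Gen5 × Fin 2 → R)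
    (h : ∀ i, z (.w, i) ^ 2 = z (.s, i) * z (.t, i)) (a : Gen5) (i : Fin 2) :
    TutteRing.lift K z h (tvar K a i) = z (a, i) := by
  change aeval z (X (a, i)) = _
  rw [aeval_X]

lemma rootEmb_tvar (a : Gen5) (i : Fin 2) : rootEmb K (tvar K a i) = rootVal K (a, i) := by
  change aeval (rootVal K) (X (a, i)) = _
  rw [aeval_X]

/-- The exponent monoid of the ring of the universal Tutte character. -/
abbrev UnivMon := deltaMatPer.{u}.Groth × deltaMatPer.{u}.Str PEmpty.{u + 1} × deltaMatPer.{u}.Groth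

/-- The homomorphism that evaluates both Grothendieck monoids in `TutteRing K`. -/
noncomputable def univMonTutte : UnivMon.{u} →* TutteRing K :=
  ((monTutte K 0).comp (grothDeltaMatPer.toMonoidHom.comp (MonoidHom.fst _ _))) *
    ((monTutte K 1).comp (grothDeltaMatPer.toMonoidHom.comp
      ((MonoidHom.snd _ _).comp (MonoidHom.snd _ _))))

lemma univMonTutte_apply (p : UnivMon.{u}) : univMonTutte K p =
    monTutte K 0 (grothDeltaMatPer p.1) * monTutte K 1 (grothDeltaMatPer p.2.2) := rfl

/-- The class of a generator in one of the two copies of the Grothendieck monoid. -/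
noncomputable def univGen : Gen5 × Fin 2 → UnivMon.{u}
  | (g, 0) => (genClass g, 1, 1)
  | (g, 1) => (1, 1, genClass g)

lemma univGen_w_sq (i : Fin 2) :
    univGen.{u} (.w, i) ^ 2 = univGen (.s, i) * univGen (.t, i) := by
  match i with
  | 0 => simp [univGen, genClass_w_sq]
  | 1 => simp [univGen, genClass_w_sq]

lemma univMonTutte_univGen (a : Gen5) (i : Fin 2) :
    univMonTutte K (univGen.{u} (a, i)) = tvar K a i := by
  match i with
  | 0 => simp [univMonTutte_apply, univGen, grothDeltaMatPer_genClass, monTutte_gen]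
  | 1 => simp [univMonTutte_apply, univGen, grothDeltaMatPer_genClass, monTutte_gen]

/-- The factor of structures on the empty set is trivial, so the exponent monoid is generated by the
two copies of the Grothendieck monoid. -/
lemma univMon_hom_ext {M : Type*} [CommMonoid M] {f g : UnivMon.{u} →* M}
    (h : ∀ a, f (univGen a) = g (univGen a)) : f = g := by
  have h0 : f.comp (MonoidHom.inl _ _) = g.comp (MonoidHom.inl _ _) :=
    groth_deltaMatPer_hom_ext fun a => h (a, 0)
  have h1 : f.comp ((MonoidHom.inr _ _).comp (MonoidHom.inr _ _)) =
      g.comp ((MonoidHom.inr _ _).comp (MonoidHom.inr _ _)) :=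
    groth_deltaMatPer_hom_ext fun a => h (a, 1)
  refine MonoidHom.ext fun ⟨p, e, q⟩ => ?_
  have he : (p, e, q) = (MonoidHom.inl _ _ p : UnivMon.{u}) * (1, 1, q) := by
    rw [Subsingleton.elim e 1]; simp
  rw [he, map_mul, map_mul]
  exact congr_arg₂ _ (DFunLike.congr_fun h0 p) (DFunLike.congr_fun h1 q)

/-- The classes of the generators in the universal ring satisfy the relations. -/
lemma of_univGen_w_sq (i : Fin 2) :
    MonoidAlgebra.of K UnivMon.{u} (univGen (.w, i)) ^ 2 =
      MonoidAlgebra.of K UnivMon.{u} (univGen (.s, i)) *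
        MonoidAlgebra.of K UnivMon.{u} (univGen (.t, i)) := by
  rw [← map_pow, univGen_w_sq, map_mul]

/-- The universal ring is the ring with ten generators and two relations. -/
noncomputable def univRingEquiv : deltaMatPer.{u}.UnivRing K ≃ₐ[K] TutteRing K :=
  AlgEquiv.ofAlgHom (MonoidAlgebra.lift K (TutteRing K) UnivMon.{u} (univMonTutte K))
    (TutteRing.lift K (fun a => MonoidAlgebra.of K UnivMon.{u} (univGen a)) (of_univGen_w_sq K))
    (TutteRing.algHom_ext K fun a i => by
      rw [AlgHom.comp_apply, TutteRing.lift_tvar, MonoidAlgebra.lift_of, univMonTutte_univGen,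
        AlgHom.id_apply])
    (MonoidAlgebra.algHom_ext' (univMon_hom_ext fun a => by
      change TutteRing.lift K (fun a => MonoidAlgebra.of K UnivMon.{u} (univGen a))
        (of_univGen_w_sq K) (MonoidAlgebra.lift K (TutteRing K) UnivMon.{u} (univMonTutte K)
          (MonoidAlgebra.of K UnivMon.{u} (univGen a))) = MonoidAlgebra.of K UnivMon.{u} (univGen a)
      rw [MonoidAlgebra.lift_of, univMonTutte_univGen, TutteRing.lift_tvar])
      (Subsingleton.elim _ _))

lemma univRingEquiv_of (p : UnivMon.{u}) :
    univRingEquiv K (MonoidAlgebra.of K _ p) =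
      monTutte K 0 (grothDeltaMatPer p.1) * monTutte K 1 (grothDeltaMatPer p.2.2) := by
  change MonoidAlgebra.lift K (TutteRing K) UnivMon.{u} (univMonTutte K)
    (MonoidAlgebra.of K UnivMon.{u} p) = _
  rw [MonoidAlgebra.lift_of, univMonTutte_apply]

/-! ### The embedding that adjoins square roots -/

/-- The exponents of the image of a monomial under `rootEmb`. -/
def rootExp (e : Gen5 × Fin 2 → ℕ) : RootVar × Fin 2 → ℕ
  | (.rs, i) => 2 * e (.s, i) + e (.w, i)
  | (.rt, i) => 2 * e (.t, i) + e (.w, i)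
  | (.u, i) => e (.u, i)
  | (.v, i) => e (.v, i)

instance : Fintype Gen5 := ⟨⟨{.s, .t, .u, .v, .w}, by simp⟩, by rintro ⟨⟩ <;> simp⟩

instance : Fintype RootVar := ⟨⟨{.rs, .rt, .u, .v}, by simp⟩, by rintro ⟨⟩ <;> simp⟩

lemma prod_gen5 {M : Type*} [CommMonoid M] (f : Gen5 → M) :
    ∏ g, f g = f .s * (f .t * (f .u * (f .v * f .w))) := by
  change (Multiset.map f {.s, .t, .u, .v, .w}).prod = _
  simp

lemma prod_rootVar {M : Type*} [CommMonoid M] (f : RootVar → M) :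
    ∏ g, f g = f .rs * (f .rt * (f .u * f .v)) := by
  change (Multiset.map f {.rs, .rt, .u, .v}).prod = _
  simp

/-- Monomials go to monomials, so injectivity of `rootEmb` becomes a question about exponents: a
monomial of `TutteRing K` has to be recovered from its `rootExp`. -/
lemma prod_rootVal_pow (e : Gen5 × Fin 2 → ℕ) :
    ∏ a, rootVal K a ^ e a = ∏ b, (X b : MvPolynomial (RootVar × Fin 2) K) ^ rootExp e b := by
  rw [Fintype.prod_prod_type_right, Fintype.prod_prod_type_right]
  refine Finset.prod_congr rfl fun i _ => ?_
  rw [prod_gen5, prod_rootVar]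
  simp only [rootVal, rootExp, mul_pow, pow_add, ← pow_mul]
  ring

/-- The monomial in `TutteRing K` with given image under `rootEmb`, if there is one. -/
noncomputable def rootLift (m : RootVar × Fin 2 → ℕ) : TutteRing K :=
  -- In an image monomial the exponents of the two roots have the parity of the exponent of w. The
  -- normal form chosen here has w to the power 0 or 1; if the parities differ, the monomial is not
  -- an image of a monomial and the value is irrelevant.
  ∏ i : Fin 2, tvar K .s i ^ (m (.rs, i) / 2) * tvar K .t i ^ (m (.rt, i) / 2) *
    tvar K .u i ^ m (.u, i) * tvar K .v i ^ m (.v, i) * tvar K .w i ^ (m (.rs, i) % 2)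

/-- The relation w² = st reduces every monomial to the normal form with w-exponent at most 1, and
the reduction preserves 2a+e and 2b+e. -/
lemma rootLift_rootExp (e : Gen5 × Fin 2 → ℕ) :
    rootLift K (rootExp e) = ∏ a : Gen5 × Fin 2, tvar K a.1 a.2 ^ e a := by
  rw [Fintype.prod_prod_type_right, rootLift]
  refine Finset.prod_congr rfl fun i _ => ?_
  rw [prod_gen5]
  simp only [rootExp]
  have h := pow_mul_pow_congr (tvar_w_sq K i)
    (a := (2 * e (.s, i) + e (.w, i)) / 2) (b := (2 * e (.t, i) + e (.w, i)) / 2)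
    (e := (2 * e (.s, i) + e (.w, i)) % 2) (a' := e (.s, i)) (b' := e (.t, i)) (e' := e (.w, i))
    (by omega) (by omega)
  linear_combination (tvar K .u i ^ e (.u, i) * tvar K .v i ^ e (.v, i)) * h

lemma monomial_one_eq_prod {σ : Type*} [Fintype σ] (m : σ →₀ ℕ) :
    monomial m (1 : K) = ∏ a, X a ^ m a := by
  rw [monomial_eq, C_1, one_mul, Finsupp.prod_fintype _ _ fun _ => pow_zero _]

/-- A linear left inverse of `rootEmb`. -/
noncomputable def rootRetract : MvPolynomial (RootVar × Fin 2) K →ₗ[K] TutteRing K :=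
  (basisMonomials (RootVar × Fin 2) K).constr K fun m => rootLift K m

lemma rootRetract_prod (m : RootVar × Fin 2 → ℕ) :
    rootRetract K (∏ b, X b ^ m b) = rootLift K m := by
  have h := monomial_one_eq_prod K (Finsupp.equivFunOnFinite.symm m)
  simp only [Finsupp.equivFunOnFinite_symm_apply_apply] at h
  rw [← h]
  exact (basisMonomials (RootVar × Fin 2) K).constr_basis K _ _

/-- The retraction is defined only as a linear map, so the identity is checked on all monomials of
the polynomial ring above `TutteRing K` and not just on its generators. -/
lemma rootRetract_rootEmb (x : TutteRing K) : rootRetract K (rootEmb K x) = x := by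
  obtain ⟨p, rfl⟩ := Ideal.Quotient.mk_surjective x
  have : (rootRetract K).comp ((rootEmb K).toLinearMap.comp
      (Ideal.Quotient.mkₐ K (tutteIdeal K)).toLinearMap) =
      (Ideal.Quotient.mkₐ K (tutteIdeal K)).toLinearMap := by
    refine MvPolynomial.linearMap_ext fun e => LinearMap.ext_ring ?_
    change rootRetract K (aeval (rootVal K) (monomial e 1)) =
      Ideal.Quotient.mkₐ K (tutteIdeal K) (monomial e 1)
    rw [monomial_one_eq_prod, map_prod (aeval _)]
    simp only [map_pow, aeval_X]
    rw [prod_rootVal_pow, rootRetract_prod, rootLift_rootExp]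
    rfl
  exact DFunLike.congr_fun this p

lemma rootEmb_injective : Function.Injective (rootEmb K) :=
  Function.LeftInverse.injective (rootRetract_rootEmb K)

end rings

/-! ### The universal Tutte character and the Krushkal polynomial -/

section tutte
open MvPolynomial
variable (K : Type*) [CommRing K] {E : Type u} [Finite E] (P : DeltaMatPer E)

lemma monTutte_cls {F : Type u} [Finite F] (Q : DeltaMatPer F) (i : Fin 2) :
    monTutte K i (grothDeltaMatPer (deltaMatPer.cls (E := F) Q)) =
      tvar K .s i ^ (rank Q.D.lower - rank Q.N) * tvar K .t i ^ (rank Q.M - rank Q.D.upper) *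
        tvar K .u i ^ rank Q.N * tvar K .v i ^ corank Q.M *
        tvar K .w i ^ (rank Q.D.upper - rank Q.D.lower) := by
  rw [grothDeltaMatPer_cls]
  simp only [map_mul, map_pow, monTutte_gen]

/-- The monomial of a restriction in the universal Tutte character. -/
lemma monTutte_restrict (A : Set E) (i : Fin 2) :
    monTutte K i (grothDeltaMatPer (deltaMatPer.cls (E := A) (deltaMatPer.restrict P A))) =
      tvar K .s i ^ (rank (P.D.restrict A).lower - rk P.N A) *
        tvar K .t i ^ (rk P.M A - rank (P.D.restrict A).upper) *
        tvar K .u i ^ rk P.N A * tvar K .v i ^ (A.ncard - rk P.M A) *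
        tvar K .w i ^ (rank (P.D.restrict A).upper - rank (P.D.restrict A).lower) := by
  have h1 : rank (deltaMatPer.restrict P A : DeltaMatPer A).M = rk P.M A :=
    P.toMatPer.rank_restrict_M A
  have h2 : rank (deltaMatPer.restrict P A : DeltaMatPer A).N = rk P.N A :=
    P.toMatPer.rank_restrict_N A
  have h3 : corank (deltaMatPer.restrict P A : DeltaMatPer A).M = A.ncard - rk P.M A :=
    P.toMatPer.corank_restrict A
  refine (monTutte_cls K (deltaMatPer.restrict P A : DeltaMatPer A) i).trans ?_
  rw [h1, h2, h3]
  rfl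

/-- The monomial of a contraction in the universal Tutte character. -/
lemma monTutte_contract (A : Set E) (i : Fin 2) :
    monTutte K i (grothDeltaMatPer
        (deltaMatPer.cls (E := (Aᶜ : Set E)) (deltaMatPer.contract P A))) =
      tvar K .s i ^ (rank (P.D.contract A).lower - (rank P.N - rk P.N A)) *
        tvar K .t i ^ ((rank P.M - rk P.M A) - rank (P.D.contract A).upper) *
        tvar K .u i ^ (rank P.N - rk P.N A) *
        tvar K .v i ^ (Aᶜ.ncard - (rank P.M - rk P.M A)) *
        tvar K .w i ^ (rank (P.D.contract A).upper - rank (P.D.contract A).lower) := by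
  have h1 : rank (deltaMatPer.contract P A : DeltaMatPer (Aᶜ : Set E)).M = rank P.M - rk P.M A :=
    P.toMatPer.rank_contract_M A
  have h2 : rank (deltaMatPer.contract P A : DeltaMatPer (Aᶜ : Set E)).N = rank P.N - rk P.N A :=
    P.toMatPer.rank_contract_N A
  have h3 : corank (deltaMatPer.contract P A : DeltaMatPer (Aᶜ : Set E)).M =
    Aᶜ.ncard - (rank P.M - rk P.M A) := P.toMatPer.corank_contract A
  refine (monTutte_cls K (deltaMatPer.contract P A : DeltaMatPer (Aᶜ : Set E)) i).trans ?_
  rw [h1, h2, h3]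
  rfl

lemma map_finsum_set {R R' F : Type*} [CommRing R] [CommRing R'] [FunLike F R R']
    [RingHomClass F R R'] (φ : F) (f : Set E → R) :
    φ (∑ᶠ A, f A) = ∑ᶠ A, φ (f A) :=
  AddMonoidHom.map_finsum (φ : R →+ R') (Set.toFinite _)

lemma univRingEquiv_universalTutte :
    univRingEquiv K (MinorsSystem.universalTutte (S := deltaMatPer) K (E := E) P) =
      ∑ᶠ A : Set E,
        (tvar K .s 0 ^ (rank (P.D.restrict A).lower - rk P.N A) *
          tvar K .t 0 ^ (rk P.M A - rank (P.D.restrict A).upper) *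
          tvar K .u 0 ^ rk P.N A *
          tvar K .v 0 ^ (A.ncard - rk P.M A) *
          tvar K .w 0 ^ (rank (P.D.restrict A).upper - rank (P.D.restrict A).lower)) *
        (tvar K .s 1 ^ (rank (P.D.contract A).lower - (rank P.N - rk P.N A)) *
          tvar K .t 1 ^ ((rank P.M - rk P.M A) - rank (P.D.contract A).upper) *
          tvar K .u 1 ^ (rank P.N - rk P.N A) *
          tvar K .v 1 ^ (Aᶜ.ncard - (rank P.M - rk P.M A)) *
          tvar K .w 1 ^ (rank (P.D.contract A).upper - rank (P.D.contract A).lower)) := by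
  refine (map_finsum_set (univRingEquiv K) _).trans (finsum_congr fun A => ?_)
  rw [← monTutte_restrict, ← monTutte_contract]
  -- The three factors of a summand: the restriction in the first copy, a structure on the empty
  -- set, which becomes 1, and the contraction in the second copy.
  have e1 := univRingEquiv_of K
    (deltaMatPer.cls (E := A) (deltaMatPer.restrict P A), 1, 1)
  have e2 := univRingEquiv_of K
    (1, deltaMatPer.contractAll (E := A) (deltaMatPer.restrict P A), 1)
  have e3 := univRingEquiv_of K
    (1, 1, deltaMatPer.cls (E := (Aᶜ : Set E)) (deltaMatPer.contract P A))
  simp only [map_one, mul_one, one_mul] at e1 e2 e3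
  refine (map_mul (univRingEquiv K) _ _).trans ((congr_arg₂ _
    ((map_mul (univRingEquiv K) _ _).trans (congr_arg₂ _ e1 e2)) e3).trans ?_)
  rw [mul_one]

/-- Each factor w contributes one square root of s and one of t, each factor s or t two of its own.
-/
lemma rootEmb_monomial (i : Fin 2) {a b c d e a' b' : ℕ} (ha : 2 * a + e = a')
    (hb : 2 * b + e = b') :
    rootEmb K (tvar K .s i ^ a * tvar K .t i ^ b * tvar K .u i ^ c * tvar K .v i ^ d *
      tvar K .w i ^ e) =
      X (.rs, i) ^ a' * X (.rt, i) ^ b' * X (.u, i) ^ c * X (.v, i) ^ d := by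
  subst ha hb
  simp only [map_mul, map_pow, rootEmb_tvar, rootVal, pow_add, pow_mul, mul_pow]
  ring

/-- The inequalities between the ranks of a delta-matroid perspective and its minors. -/
lemma DeltaMatPer.rank_ineqs (A : Set E) :
    (rk P.N A ≤ rank (P.D.restrict A).lower ∧
      rank (P.D.restrict A).lower ≤ rank (P.D.restrict A).upper ∧
      rank (P.D.restrict A).upper ≤ rk P.M A) ∧
    (rank P.N - rk P.N A ≤ rank (P.D.contract A).lower ∧
      rank (P.D.contract A).lower ≤ rank (P.D.contract A).upper ∧
      rank (P.D.contract A).upper ≤ rank P.M - rk P.M A) := by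
  have h1 : rank (deltaMatPer.restrict P A : DeltaMatPer A).M = rk P.M A :=
    P.toMatPer.rank_restrict_M A
  have h2 : rank (deltaMatPer.restrict P A : DeltaMatPer A).N = rk P.N A :=
    P.toMatPer.rank_restrict_N A
  have h3 : rank (deltaMatPer.contract P A : DeltaMatPer (Aᶜ : Set E)).M = rank P.M - rk P.M A :=
    P.toMatPer.rank_contract_M A
  have h4 : rank (deltaMatPer.contract P A : DeltaMatPer (Aᶜ : Set E)).N = rank P.N - rk P.N A :=
    P.toMatPer.rank_contract_N A
  exact ⟨⟨h2.symm.trans_le (DeltaMatPer.rank_N_le (deltaMatPer.restrict P A : DeltaMatPer A)),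
      (P.D.restrict A).rank_lower_le_upper,
      (DeltaMatPer.rank_upper_le (deltaMatPer.restrict P A : DeltaMatPer A)).trans_eq h1⟩,
    h4.symm.trans_le (DeltaMatPer.rank_N_le (deltaMatPer.contract P A : DeltaMatPer (Aᶜ : Set E))),
    (P.D.contract A).rank_lower_le_upper,
    (DeltaMatPer.rank_upper_le
      (deltaMatPer.contract P A : DeltaMatPer (Aᶜ : Set E))).trans_eq h3⟩

/-- In the exponents of the roots the upper and lower ranks occur only through their sum: twice
rk(D_min) − rk(M') plus rk(D_max) − rk(D_min) is 2σ(D) − 2 rk(M'), and similarly for t. -/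
lemma rootEmb_universalTutte :
    rootEmb K (univRingEquiv K (MinorsSystem.universalTutte (S := deltaMatPer) K (E := E) P)) =
      ∑ᶠ A : Set E,
        (X (.rs, 0) ^ (twiceSigma (P.D.restrict A) - 2 * rk P.N A) *
          X (.rt, 0) ^ (2 * rk P.M A - twiceSigma (P.D.restrict A)) *
          X (.u, 0) ^ rk P.N A *
          X (.v, 0) ^ (A.ncard - rk P.M A)) *
        (X (.rs, 1) ^ (twiceSigma (P.D.contract A) - 2 * (rank P.N - rk P.N A)) *
          X (.rt, 1) ^ (2 * (rank P.M - rk P.M A) - twiceSigma (P.D.contract A)) *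
          X (.u, 1) ^ (rank P.N - rk P.N A) *
          X (.v, 1) ^ (Aᶜ.ncard - (rank P.M - rk P.M A))) := by
  rw [univRingEquiv_universalTutte, map_finsum_set]
  refine finsum_congr fun A => ?_
  obtain ⟨⟨h1, h2, h3⟩, h4, h5, h6⟩ := P.rank_ineqs A
  simp only [twiceSigma]
  rw [map_mul, rootEmb_monomial K 0 (a' := _) (b' := _) rfl rfl,
    rootEmb_monomial K 1 (a' := _) (b' := _) rfl rfl]
  -- The inequalities `h1`–`h6` make the truncated subtractions on both sides exact.
  congr 1 <;> congr 3 <;> congr 1 <;> omega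

lemma aeval_krushkalVal_universalTutte :
    aeval (krushkalVal K)
        (rootEmb K (univRingEquiv K
          (MinorsSystem.universalTutte (S := deltaMatPer) K (E := E) P))) =
      krushkal K P := by
  rw [rootEmb_universalTutte, krushkal, map_finsum_set]
  refine finsum_congr fun A => ?_
  simp only [map_mul, map_pow, aeval_X, krushkalVal, one_pow, mul_one, one_mul]
  ring

/-- Part of the power of the unit `b` clears the denominator of the ratio; the remaining `m` factors
survive. -/
lemma unit_pow_mul_ratio_pow {R : Type*} [CommRing R] {a b : R} (hb : IsUnit b) {n m k : ℕ}
    (h : n = m + k) : b ^ n * (a * Ring.inverse b) ^ k = a ^ k * b ^ m := by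
  have : (b * Ring.inverse b) ^ k = 1 := by rw [Ring.mul_inverse_cancel b hb, one_pow]
  rw [mul_pow] at this
  rw [h, pow_add, mul_pow]
  linear_combination b ^ m * a ^ k * this

/-- By additivity, every exponent of the prefactor is the sum of an exponent for `D|A` and one for
`D/A`. For s, t and v the restriction part clears the denominator and the contraction part remains.
For u the roles are exchanged, since x has u₁ in its denominator. -/
lemma aeval_universalTutte {R : Type*} [CommRing R] [Algebra K R] (z : RootVar × Fin 2 → R)
    (hrs : IsUnit (z (.rs, 1))) (hrt : IsUnit (z (.rt, 1))) (hu : IsUnit (z (.u, 0)))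
    (hv : IsUnit (z (.v, 1))) :
    aeval z (rootEmb K (univRingEquiv K
        (MinorsSystem.universalTutte (S := deltaMatPer) K (E := E) P))) =
      z (.rs, 1) ^ (twiceSigma P.D - 2 * rank P.N) *
        z (.rt, 1) ^ (2 * rank P.M - twiceSigma P.D) *
        z (.u, 0) ^ rank P.N * z (.v, 1) ^ corank P.M *
        aeval (ratioVal z) (krushkal K P) := by
  rw [rootEmb_universalTutte, krushkal, map_finsum_set (aeval (R := K) z),
    map_finsum_set (aeval (R := K) (ratioVal z)),
    mul_finsum' _ _ (Set.toFinite _)]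
  refine finsum_congr fun A => ?_
  simp only [map_mul, map_pow, aeval_X, ratioVal]
  obtain ⟨⟨h1, h2, h3⟩, h4, h5, h6⟩ := P.rank_ineqs A
  have h7 := P.D.twiceSigma_add A
  have h8 := rk_le_rank P.ground_M A
  have h9 := rk_le_rank P.ground_N A
  have h10 : corank P.M = _ := P.toMatPer.corank_add A
  have h11 : twiceSigma (P.D.restrict A) = _ + _ := rfl
  have h12 : twiceSigma (P.D.contract A) = _ + _ := rfl
  have e1 := unit_pow_mul_ratio_pow (a := z (.rs, 0)) hrs
    (show twiceSigma P.D - 2 * rank P.N =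
      (twiceSigma (P.D.contract A) - 2 * (rank P.N - rk P.N A)) +
        (twiceSigma (P.D.restrict A) - 2 * rk P.N A) by omega)
  have e2 := unit_pow_mul_ratio_pow (a := z (.rt, 0)) hrt
    (show 2 * rank P.M - twiceSigma P.D =
      (2 * (rank P.M - rk P.M A) - twiceSigma (P.D.contract A)) +
        (2 * rk P.M A - twiceSigma (P.D.restrict A)) by omega)
  have e3 := unit_pow_mul_ratio_pow (a := z (.u, 1)) hu
    (show rank P.N = rk P.N A + (rank P.N - rk P.N A) by omega)
  have e4 := unit_pow_mul_ratio_pow (a := z (.v, 0)) hv (h10.trans (add_comm _ _))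
  change z (.v, 1) ^ corank P.M * (z (.v, 0) * Ring.inverse (z (.v, 1))) ^ (A.ncard - rk P.M A) =
    z (.v, 0) ^ (A.ncard - rk P.M A) * z (.v, 1) ^ (Aᶜ.ncard - (rank P.M - rk P.M A)) at e4
  -- Each factor of the prefactor is placed next to the ratio whose denominator it clears.
  have split : ∀ p q r s a b c d : R, p * q * r * s * (a * b * c * d) =
      (p * c) * (q * d) * (r * a) * (s * b) := fun p q r s a b c d => by ring
  symm
  rw [split, e1, e2, e3, e4]
  ring

end tutte
end TutteMinors

theorem mainTheorem10 (K : Type*) [CommRing K] :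
    -- the Grothendieck monoid of delta-matroid perspectives
    (∃ φ : deltaMatPer.{u}.Groth ≃* Mon5,
      (∀ g : Gen5, φ (genClass g) = Mon5.gen g) ∧
      ∀ (E : Type u) [Finite E] (P : DeltaMatPer E),
        rank P.N ≤ rank P.D.lower ∧ rank P.D.lower ≤ rank P.D.upper ∧
        rank P.D.upper ≤ rank P.M ∧
        φ (deltaMatPer.cls (E := E) P) =
          Mon5.gen .s ^ (rank P.D.lower - rank P.N) * Mon5.gen .t ^ (rank P.M - rank P.D.upper) *
            Mon5.gen .u ^ rank P.N * Mon5.gen .v ^ corank P.M *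
            Mon5.gen .w ^ (rank P.D.upper - rank P.D.lower)) ∧
    -- the universal Tutte character and the Krushkal polynomial
    (Function.Injective (rootEmb K) ∧
      ∃ Θ : deltaMatPer.{u}.UnivRing K ≃ₐ[K] TutteRing K,
        (∀ g : Gen5, Θ (MonoidAlgebra.of K _ (genClass g, 1, 1)) = tvar K g 0 ∧
          Θ (MonoidAlgebra.of K _ (1, 1, genClass g)) = tvar K g 1) ∧
        ∀ (E : Type u) [Finite E] (P : DeltaMatPer E),
          Θ (MinorsSystem.universalTutte (S := deltaMatPer) K (E := E) P) =
            ∑ᶠ A : Set E,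
              (tvar K .s 0 ^ (rank (P.D.restrict A).lower - rk P.N A) *
                tvar K .t 0 ^ (rk P.M A - rank (P.D.restrict A).upper) *
                tvar K .u 0 ^ rk P.N A *
                tvar K .v 0 ^ (A.ncard - rk P.M A) *
                tvar K .w 0 ^ (rank (P.D.restrict A).upper - rank (P.D.restrict A).lower)) *
              (tvar K .s 1 ^ (rank (P.D.contract A).lower - (rank P.N - rk P.N A)) *
                tvar K .t 1 ^ ((rank P.M - rk P.M A) - rank (P.D.contract A).upper) *
                tvar K .u 1 ^ (rank P.N - rk P.N A) *
                tvar K .v 1 ^ (Aᶜ.ncard - (rank P.M - rk P.M A)) *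
                tvar K .w 1 ^ (rank (P.D.contract A).upper - rank (P.D.contract A).lower)) ∧
          rootEmb K (Θ (MinorsSystem.universalTutte (S := deltaMatPer) K (E := E) P)) =
            ∑ᶠ A : Set E,
              (MvPolynomial.X (.rs, 0) ^ (twiceSigma (P.D.restrict A) - 2 * rk P.N A) *
                MvPolynomial.X (.rt, 0) ^ (2 * rk P.M A - twiceSigma (P.D.restrict A)) *
                MvPolynomial.X (.u, 0) ^ rk P.N A *
                MvPolynomial.X (.v, 0) ^ (A.ncard - rk P.M A)) *
              (MvPolynomial.X (.rs, 1) ^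
                  (twiceSigma (P.D.contract A) - 2 * (rank P.N - rk P.N A)) *
                MvPolynomial.X (.rt, 1) ^
                  (2 * (rank P.M - rk P.M A) - twiceSigma (P.D.contract A)) *
                MvPolynomial.X (.u, 1) ^ (rank P.N - rk P.N A) *
                MvPolynomial.X (.v, 1) ^ (Aᶜ.ncard - (rank P.M - rk P.M A))) ∧
          MvPolynomial.aeval (krushkalVal K)
              (rootEmb K (Θ (MinorsSystem.universalTutte (S := deltaMatPer) K (E := E) P))) =
            krushkal K P ∧
          ∀ (R : Type*) [CommRing R] [Algebra K R] (z : RootVar × Fin 2 → R),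
            IsUnit (z (.rs, 1)) → IsUnit (z (.rt, 1)) → IsUnit (z (.u, 0)) →
            IsUnit (z (.v, 1)) →
            MvPolynomial.aeval z
                (rootEmb K (Θ (MinorsSystem.universalTutte (S := deltaMatPer) K (E := E) P))) =
              z (.rs, 1) ^ (twiceSigma P.D - 2 * rank P.N) *
                z (.rt, 1) ^ (2 * rank P.M - twiceSigma P.D) *
                z (.u, 0) ^ rank P.N * z (.v, 1) ^ corank P.M *
                MvPolynomial.aeval (ratioVal z) (krushkal K P)) ∧
    -- the Grothendieck monoid of matroid perspectives
    ((∃ e : (conGen RelMatPer.{u}).Quotient ≃* matPer.{u}.Groth,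
        ∀ p : deltaMatPer.{u}.Groth, e (Con.mk' (conGen RelMatPer) p) = homMatPer.groth p) ∧
      ∃ φ : matPer.{u}.Groth ≃* FreeCommMonoid Gen3,
        φ (matPer.cls cc) = .of .u ∧ φ (matPer.cls ll) = .of .v ∧ φ (matPer.cls cl) = .of .w ∧
        ∀ (E : Type u) [Finite E] (P : MatPer E),
          φ (matPer.cls (E := E) P) =
            .of .u ^ rank P.N * .of .v ^ corank P.M * .of .w ^ (rank P.M - rank P.N)) ∧
    -- the Grothendieck monoid of delta-matroids
    ((∃ e : (conGen RelDeltaMat.{u}).Quotient ≃* deltaMat.{u}.Groth,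
        ∀ p : deltaMatPer.{u}.Groth, e (Con.mk' (conGen RelDeltaMat) p) = homDeltaMat.groth p) ∧
      ∃ φ : deltaMat.{u}.Groth ≃* Mon3,
        φ (deltaMat.cls coloopDelta) = Mon3.gen .u ∧ φ (deltaMat.cls loopDelta) = Mon3.gen .v ∧
        φ (deltaMat.cls bothDelta) = Mon3.gen .w ∧
        ∀ (E : Type u) [Finite E] (D : DeltaMatroid E),
          φ (deltaMat.cls (E := E) D) =
            Mon3.gen .u ^ rank D.lower * Mon3.gen .v ^ (Nat.card E - rank D.upper) *
              Mon3.gen .w ^ (rank D.upper - rank D.lower)) := by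
  refine ⟨⟨grothDeltaMatPer, grothDeltaMatPer_genClass, fun E _ P =>
      ⟨P.rank_N_le, P.D.rank_lower_le_upper, P.rank_upper_le, grothDeltaMatPer_cls P⟩⟩,
    ⟨rootEmb_injective K, univRingEquiv K, fun g => ⟨?_, ?_⟩, fun E _ P =>
      ⟨univRingEquiv_universalTutte K P, rootEmb_universalTutte K P,
        aeval_krushkalVal_universalTutte K P, fun R _ _ z => aeval_universalTutte K P z⟩⟩,
    ⟨exists_mulEquiv_matPer, grothMatPer, matPerNorm_lift_genClassMatPer .u,
      matPerNorm_lift_genClassMatPer .v, matPerNorm_lift_genClassMatPer .w,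
      fun E _ P => matPerNorm.lift_cls (E := E) P⟩,
    exists_mulEquiv_deltaMat, grothDeltaMat, deltaMatNorm_lift_genClassDeltaMat .u,
    deltaMatNorm_lift_genClassDeltaMat .v, deltaMatNorm_lift_genClassDeltaMat .w,
    fun E _ D => deltaMatNorm.lift_cls (E := E) D⟩
  · exact (univRingEquiv_of K (univGen (g, 0))).trans (univMonTutte_univGen K g 0)
  · exact (univRingEquiv_of K (univGen (g, 1))).trans (univMonTutte_univGen K g 1)
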